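/- **Conventions.** Let $k$ be a field of characteristic $0$ and $d\in\mathbb Z$. A graded quiver $Q$ with set of objects $\mathcal O$ is a family of $\mathbb Z$-graded $k$-vector spaces ${}_xQ_y$ ($x,y\in\mathcal O$); words are composed from left to right, ${}_xQ_y\otimes{}_yQ_z$. No finiteness is assumed. We write $V[n]^i=V^{i+n}$; $s:Q\to Q[1]$ is the shift, so $|sa|=|a|-1$, and elements of $Q[-d]$ have degree $|a|+d$. The graded dual quiver is ${}_yQ^*_x=({}_xQ_y)^*$, and $t:Q^*\to Q^*[d]$ is the shift, so $|tf|=|f|-d$; note that $(Q\oplus Q^*[d-1])[1]=Q[1]\oplus Q^*[d]$. For $\bar x=(x_1,\dots,x_n)$ put $\operatorname{lt}\bar x=x_1$, $\operatorname{rt}\bar x=x_n$ and $Q[1]^{\otimes\bar x}={}_{x_1}Q_{x_2}[1]\otimes\cdots\otimes{}_{x_{n-1}}Q_{x_n}[1]$ (which is $k$ if $n=1$); an element of it is written $s\bar a$. **$A_\infty$-structures.** An $A_\infty$-structure on $Q$ is a family of maps $sm^{\bar x}:Q[1]^{\otimes\bar x}\to{}_{\operatorname{lt}\bar x}Q_{\operatorname{rt}\bar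 x}[1]$ of degree $1$, for all $\bar x$ with at least two entries, such that $\sum (-1)^{|sa_1|+\dots+|sa_i|}\,sm(sa_1,\dots,sa_i,sm(sa_{i+1},\dots,sa_j),sa_{j+1},\dots,sa_n)=0$ for every composable word, the sum being over $0\le i<j\le n$. It is *almost cyclic* with respect to a homogeneous bilinear form $\Gamma$, i.e. maps ${}_{x}\Gamma_y:{}_xQ_y[1]\otimes{}_yQ_x[1]\to k$, if for every $n\ge2$ and all $a_i\in{}_{x_i}Q_{x_{i+1}}$ ($i<n$), $a_n\in{}_{x_n}Q_{x_1}$, $$\Gamma(sm(sa_1,\dots,sa_{n-1}),sa_n)=(-1)^{|sa_n|(|sa_1|+\dots+|sa_{n-1}|)}\,\Gamma(sm(sa_n,sa_1,\dots,sa_{n-2}),sa_{n-1}).$$ **$d$-pre-Calabi–Yau structures.** Consider families $M=(M^{\bar x^1,\dots,\bar x^n})$, $n\ge1$, of maps of degree $d+2$ $$M^{\bar x^1,\dots,\bar x^n}:Q[1]^{\otimes\bar x^1}\otimes\cdots\otimes Q[1]^{\otimes\bar x^n}\to{}_{\operatorname{lt}\bar x^1}Q_{\operatorname{rt}\bar x^2}[-d]\otimes\cdots\otimes{}_{\operatorname{lt}\bar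 x^n}Q_{\operatorname{rt}\bar x^1}[-d].$$ A $d$-pre-Calabi–Yau structure on $Q$ is such a family $M$, with no component with $n=1$ and $\bar x^1$ of length $1$ (no input and one output), invariant under simultaneous cyclic permutation, with Koszul signs, of the $n$ words of inputs and of the $n$ outputs, and such that $s_{d+1}M\circ_{\mathrm{nec}}s_{d+1}M=0$. Here $|s_{d+1}M|=1$ and the necklace product $s_{d+1}F\circ_{\mathrm{nec}}s_{d+1}G$ is the sum over all ways of connecting one output of $G$ to one input of $F$ in a planar way: first reorder the inputs so that those of $G$ come first, apply $G$, apply $F\circ s_{d+1}$ (of degree $1$, the connected output being shifted from $Q[-d]$ to $Q[1]$) to the connected output of $G$ and to the remaining inputs, and reorder the outputs, all with Koszul signs; the last output of the resulting diagram is the last output of $F$ (then the connected output may be taken to be the last one of $G$) or the last output of $G$ (then the connected input may be taken in the first word of $F$). **Strict morphisms.** Let $(\mathcal A,M_{\mathcal A})$ and $(\mathcal B,M_{\mathcal B})$ be graded quivers with $d$-pre-Calabi–Yau structures, with sets of objects $\mathcal O_{\mathcal A},\mathcal O_{\mathcal B}$. A strict $d$-pre-Calabi–Yau morphism $\Phi$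 from the first to the second is a map $\Phi_0:\mathcal O_{\mathcal A}\to\mathcal O_{\mathcal B}$ with degree $0$ linear maps $\Phi:{}_x\mathcal A_y\to{}_{\Phi_0(x)}\mathcal B_{\Phi_0(y)}$ such that $(\Phi\otimes\cdots\otimes\Phi)\circ M_{\mathcal A}=M_{\mathcal B}\circ(\Phi\otimes\cdots\otimes\Phi)$ on every tuple of words in $\mathcal A$. Write $\Phi^*(f)=f\circ\Phi$. **The maps attached to a structure.** For a $d$-pre-Calabi–Yau structure $M$ on $Q$, define $sm_{Q\oplus Q^*\to Q}$ on words with letters in $Q[1]$ and in $Q^*[d]$ by $$(s\bar a^n,tf^{n-1},s\bar a^{n-1},\dots,tf^1,s\bar a^1)\mapsto(-1)^{\epsilon}\,(f^1\otimes\cdots\otimes f^{n-1}\otimes\mathrm{id})\,M(s\bar a^1,\dots,s\bar a^n),$$ where the functionals on the right are applied factor by factor without further sign (in particular the value is zero unless degrees match) and $$\epsilon=\sum_{i<j}|tf^i||s\bar a^j|+(|M|+d)\sum_i|tf^i|+d(n-1)+\sum_{i<j}|s\bar a^i||s\bar a^j|+2\sum_{i<j}|tf^i||tf^j|,\qquad|M|=d+2.$$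 Let $\Gamma^Q$ be the natural bilinear form, i.e. the form $\Gamma^{\Phi}$ below for $\Phi=\mathrm{id}_Q$. Define $sm_{Q\oplus Q^*\to Q^*}$, with values in $Q^*[d]$, to be zero on words all of whose letters are in $Q[1]$; on a word $(w,tf,u)$ whose last letter in $Q^*[d]$ is $tf$, it is the element determined by $\Gamma^Q(sm_{Q\oplus Q^*\to Q^*}(w,tf,u),sb)=(-1)^{(|u|+|sb|)(|w|+|tf|)}\Gamma^Q(sm_{Q\oplus Q^*\to Q}(u,sb,w),tf)$ for all $b$. **The structure on $\mathcal A\oplus\mathcal B^*[d-1]$.** This is the graded quiver with set of objects $\mathcal O_{\mathcal A}$ and spaces ${}_x\mathcal A_y\oplus{}_{\Phi_0(x)}\mathcal B^*_{\Phi_0(y)}[d-1]$. Let $sm_{\mathcal A\oplus\mathcal B^*}$ be the element whose value on a composable word with letters in $\mathcal A[1]$ and $\mathcal B^*[d]$ has component in $\mathcal A[1]$ equal to $sm_{\mathcal A\oplus\mathcal A^*\to\mathcal A}$ applied to the word in which every letter $tf$ is replaced by $t\Phi^*(f)$, and component in $\mathcal B^*[d]$ equal to $sm_{\mathcal B\oplus\mathcal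 B^*\to\mathcal B^*}$ applied to the word in which every letter $sa$ is replaced by $s\Phi(a)$. The $\Phi$-mixed bilinear form $\Gamma^\Phi$ on $\mathcal A[1]\oplus\mathcal B^*[d]$ is given by $$\Gamma^\Phi(tf,sa)=-(-1)^{|sa||tf|}\Gamma^\Phi(sa,tf)=(-1)^{|tf|+1}f(\Phi(a)),\qquad\Gamma^\Phi(sa,sb)=\Gamma^\Phi(tf,tg)=0.$$ **Proposition.** For every strict $d$-pre-Calabi–Yau morphism $\Phi:(\mathcal A,M_{\mathcal A})\to(\mathcal B,M_{\mathcal B})$, the element $sm_{\mathcal A\oplus\mathcal B^*}$ is an $A_\infty$-structure on $\mathcal A\oplus\mathcal B^*[d-1]$, and it is almost cyclic with respect to the $\Phi$-mixed bilinear form $\Gamma^\Phi$. -/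

import Mathlib

open scoped TensorProduct

universe u v w

noncomputable section

namespace PreCY

/-! ### Graded quivers

A graded quiver is given by the homogeneous components of its spaces of morphisms:
`Q.Hom x y p` is the degree `p` component of `ₓQ_y`. The graded space `ₓQ_y` is the direct sum of
these components. A composable word is read from left to right, as in `ₓQ_y ⊗ _yQ_z`. -/

/-- A graded quiver over `k` with set of objects `O`. -/
structure GradedQuiver (k : Type u) [Field k] (O : Type v) where
  Hom : O → O → ℤ → Type u
  [addCommGroup : ∀ x y p, AddCommGroup (Hom x y p)]
  [module : ∀ x y p, Module k (Hom x y p)]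

attribute [instance] GradedQuiver.addCommGroup GradedQuiver.module

/-- The index of a homogeneous component: a source, a target and a degree. -/
structure Letter (O : Type v) where
  src : O
  tgt : O
  deg : ℤ

variable {k : Type u} [Field k] {O : Type v} {O' : Type w}

/-- The homogeneous component with a given index. -/
abbrev GradedQuiver.at (Q : GradedQuiver k O) (ℓ : Letter O) : Type u := Q.Hom ℓ.src ℓ.tgt ℓ.deg

/-- Homogeneous elements of a graded quiver, with their index. -/
structure Elt (Q : GradedQuiver k O) where
  letter : Letter O
  val : Q.at letter

/-- Homogeneous functionals `f ∈ (ₓQ_y^p)^*`. Such an `f` is an element of degree `-p` of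
`_yQ^*_x = (ₓQ_y)^*`; its letter records `x`, `y` and `p`. -/
structure DualElt (Q : GradedQuiver k O) where
  letter : Letter O
  val : Module.Dual k (Q.at letter)

/-- The degree `|sa| = |a| - 1` of `sa ∈ Q[1]`. -/
def Elt.sdeg {Q : GradedQuiver k O} (a : Elt Q) : ℤ := a.letter.deg - 1

/-- The degree `|tf| = |f| - d` of `tf ∈ Q^*[d]`. -/
def DualElt.tdeg {Q : GradedQuiver k O} (d : ℤ) (f : DualElt Q) : ℤ := -f.letter.deg - d

/-- The degree of `sa₁ ⊗ ⋯ ⊗ saₙ` in `Q[1]^{⊗ n}`. -/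
def segDeg {Q : GradedQuiver k O} (s : List (Elt Q)) : ℤ := (s.map Elt.sdeg).sum

/-- The degree of an element of a tensor product of words of `Q[1]`. -/
def inDeg {Q : GradedQuiver k O} (z : List (List (Elt Q))) : ℤ := (z.map segDeg).sum

/-- The degree, in the tensor product of the `Q[-d]`, of the component indexed by `r`. -/
def outDeg (d : ℤ) (r : List (Letter O)) : ℤ := (r.map fun ℓ => ℓ.deg + d).sum

/-- The word `s` is composable, from the object `x` to the object `y`. -/
def IsPath {Q : GradedQuiver k O} : O → List (Elt Q) → O → Prop
  | x, [], y => x = y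
  | x, a :: s, y => a.letter.src = x ∧ IsPath a.letter.tgt s y

/-- The object reached from `x` after the first `i` letters of the word `s`. -/
def pt {Q : GradedQuiver k O} (x : O) (s : List (Elt Q)) (i : ℕ) : O :=
  (s.take i).foldl (fun _ a => a.letter.tgt) x

/-! ### `A_∞`-structures -/

/-- The raw data of an element `sm ∈ C(Q)[1]`: `m l c` is the component in `Q.at c` of the value of
`m` at the word `l` (as a map with values in `Q[1]` the value of `sm` is the same vector). -/
abbrev Op (Q : GradedQuiver k O) := List (Elt Q) → (c : Letter O) → Q.at c

/-- `m` is a family of multilinear maps `Q[1]^{⊗ x̄} → _{lt x̄}Q_{rt x̄}`, one for each composable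
word with at least one letter, such that `sm` is homogeneous of degree `1`. -/
structure IsCochain {Q : GradedQuiver k O} (m : Op Q) : Prop where
  map_add : ∀ (l₁ : List (Elt Q)) (ℓ : Letter O) (a b : Q.at ℓ) (l₂ : List (Elt Q)) (c : Letter O),
    m (l₁ ++ ⟨ℓ, a + b⟩ :: l₂) c = m (l₁ ++ ⟨ℓ, a⟩ :: l₂) c + m (l₁ ++ ⟨ℓ, b⟩ :: l₂) c
  map_smul : ∀ (l₁ : List (Elt Q)) (ℓ : Letter O) (t : k) (a : Q.at ℓ) (l₂ : List (Elt Q))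
    (c : Letter O), m (l₁ ++ ⟨ℓ, t • a⟩ :: l₂) c = t • m (l₁ ++ ⟨ℓ, a⟩ :: l₂) c
  support : ∀ (l : List (Elt Q)) (c : Letter O), m l c ≠ 0 →
    l ≠ [] ∧ IsPath c.src l c.tgt ∧ c.deg - 1 = segDeg l + 1

/-- The index of the value of `m` at the subword of `l` strictly after its first `i` letters and up
to its `j`-th letter. -/
def midLetter {Q : GradedQuiver k O} (x : O) (l : List (Elt Q)) (i j : ℕ) : Letter O :=
  ⟨pt x l i, pt x l j, segDeg ((l.drop i).take (j - i)) + 2⟩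

/-- The Gerstenhaber product `sm ∘ sm` for `sm` of degree `1`: all insertions of `sm`, applied to a
nonempty subword, into `sm`, with the Koszul sign of `sm` passing the letters on its left. -/
def gerstenhaberSq {Q : GradedQuiver k O} (m : Op Q) : Op Q := fun l c =>
  ∑ j ∈ Finset.range (l.length + 1), ∑ i ∈ Finset.range j,
    (segDeg (l.take i)).negOnePow •
      m (l.take i ++
          ⟨midLetter c.src l i j, m ((l.drop i).take (j - i)) (midLetter c.src l i j)⟩ ::
          l.drop j) c

/-- `sm` is an `A_∞`-structure on `Q`: it is of degree `1` and satisfies the Stasheff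
identities `sm ∘ sm = 0` (that is, `[sm, sm] = 2 (sm ∘ sm) = 0`). -/
structure IsAInfinity {Q : GradedQuiver k O} (m : Op Q) : Prop where
  cochain : IsCochain m
  stasheff : ∀ (l : List (Elt Q)) (c : Letter O), IsPath c.src l c.tgt → gerstenhaberSq m l c = 0

/-- A bilinear form of degree `e` on `Q`: homogeneous maps `ₓQ_y[1] ⊗ _yQₓ[1] → k` of degree
`e + 2`. -/
structure BilinForm (Q : GradedQuiver k O) (e : ℤ) where
  form : ∀ (x y : O) (p q : ℤ), Q.Hom x y p →ₗ[k] Q.Hom y x q →ₗ[k] k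
  degree : ∀ (x y : O) (p q : ℤ), (p - 1) + (q - 1) + (e + 2) ≠ 0 → form x y p q = 0

/-- `Γ(sm(sa₁,…,saₙ₋₁), saₙ) = ± Γ(sm(saₙ,sa₁,…,saₙ₋₂), saₙ₋₁)` with
`± = (-1)^{|saₙ|(|sa₁|+⋯+|saₙ₋₁|)}`, for composable cyclic words with at least two letters; in the
statement `saₙ = a`, `saₙ₋₁ = b` and `l = (sa₁,…,saₙ₋₂)`. -/
def IsAlmostCyclic {Q : GradedQuiver k O} {e : ℤ} (m : Op Q) (Γ : BilinForm Q e) : Prop :=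
  ∀ (l : List (Elt Q)) (b a : Elt Q), IsPath a.letter.tgt (l ++ [b]) a.letter.src →
    Γ.form a.letter.tgt a.letter.src (segDeg (l ++ [b]) + 2) a.letter.deg
        (m (l ++ [b]) ⟨a.letter.tgt, a.letter.src, segDeg (l ++ [b]) + 2⟩) a.val =
      (a.sdeg * segDeg (l ++ [b])).negOnePow •
        Γ.form b.letter.tgt b.letter.src (segDeg (a :: l) + 2) b.letter.deg
          (m (a :: l) ⟨b.letter.tgt, b.letter.src, segDeg (a :: l) + 2⟩) b.val

/-! ### Tensor products along a list of letters -/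

/-- Auxiliary bundled form of `Tens`. -/
def TensMod (Q : GradedQuiver k O) : List (Letter O) → ModuleCat.{u} k
  | [] => ModuleCat.of k k
  | ℓ :: r => ModuleCat.of k (Q.at ℓ ⊗[k] TensMod Q r)

/-- `Q.at ℓ₁ ⊗ (Q.at ℓ₂ ⊗ (⋯ ⊗ (Q.at ℓₙ ⊗ k)))`, for `r = [ℓ₁, …, ℓₙ]`. -/
abbrev Tens (Q : GradedQuiver k O) (r : List (Letter O)) : Type u := TensMod Q r

namespace Tens

def nilEquiv (Q : GradedQuiver k O) : Tens Q [] ≃ₗ[k] k := LinearEquiv.refl k k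

def consEquiv (Q : GradedQuiver k O) (ℓ : Letter O) (r : List (Letter O)) :
    Tens Q (ℓ :: r) ≃ₗ[k] Q.at ℓ ⊗[k] Tens Q r := LinearEquiv.refl k _

def singleEquiv (Q : GradedQuiver k O) (ℓ : Letter O) : Tens Q [ℓ] ≃ₗ[k] Q.at ℓ :=
  consEquiv Q ℓ [] ≪≫ₗ TensorProduct.congr (LinearEquiv.refl k _) (nilEquiv Q) ≪≫ₗ
    TensorProduct.rid k _

/-- Concatenation of tensors. -/
def appendEquiv (Q : GradedQuiver k O) : ∀ r s : List (Letter O),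
    Tens Q r ⊗[k] Tens Q s ≃ₗ[k] Tens Q (r ++ s)
  | [], _ => TensorProduct.congr (nilEquiv Q) (LinearEquiv.refl k _) ≪≫ₗ TensorProduct.lid k _
  | ℓ :: r, s =>
    TensorProduct.congr (consEquiv Q ℓ r) (LinearEquiv.refl k _) ≪≫ₗ
      TensorProduct.assoc k _ _ _ ≪≫ₗ
      TensorProduct.congr (LinearEquiv.refl k _) (appendEquiv Q r s) ≪≫ₗ
      (consEquiv Q ℓ (r ++ s)).symm

/-- Transport along an equality of lists of letters. -/
def cast (Q : GradedQuiver k O) {r s : List (Letter O)} (h : r = s) : Tens Q r ≃ₗ[k] Tens Q s :=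
  h ▸ LinearEquiv.refl k _

/-- `a₁ ⊗ a₂ ⊗ ⋯ ⊗ aₙ ↦ a₂ ⊗ ⋯ ⊗ aₙ ⊗ a₁`, without sign. -/
def rot (Q : GradedQuiver k O) (ℓ : Letter O) (r : List (Letter O)) :
    Tens Q (ℓ :: r) ≃ₗ[k] Tens Q (r ++ [ℓ]) :=
  consEquiv Q ℓ r ≪≫ₗ TensorProduct.comm k _ _ ≪≫ₗ
    TensorProduct.congr (LinearEquiv.refl k _) (singleEquiv Q ℓ).symm ≪≫ₗ appendEquiv Q r [ℓ]

/-- `(id ⊗ φ ⊗ id)` without sign: the letter `c` between `u₁` and `u₂` is replaced by the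
word `r`, by means of `φ`. -/
def substMid (Q : GradedQuiver k O) (u₁ : List (Letter O)) (c : Letter O) (u₂ r : List (Letter O))
    (φ : Q.at c →ₗ[k] Tens Q r) : Tens Q (u₁ ++ c :: u₂) →ₗ[k] Tens Q (u₁ ++ (r ++ u₂)) :=
  (appendEquiv Q u₁ (r ++ u₂)).toLinearMap ∘ₗ
    TensorProduct.map LinearMap.id
      ((appendEquiv Q r u₂).toLinearMap ∘ₗ TensorProduct.map φ LinearMap.id ∘ₗ
        (consEquiv Q c u₂).toLinearMap) ∘ₗ
    (appendEquiv Q u₁ (c :: u₂)).symm.toLinearMap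

/-- `u ⊗ c ↦ w₁ ⊗ u ⊗ w₂` without sign, where `φ(c) = w₁ ⊗ w₂`. -/
def substLast (Q : GradedQuiver k O) (u : List (Letter O)) (c : Letter O)
    (w₁ w₂ : List (Letter O)) (φ : Q.at c →ₗ[k] Tens Q (w₁ ++ w₂)) :
    Tens Q (u ++ [c]) →ₗ[k] Tens Q (w₁ ++ (u ++ w₂)) :=
  (appendEquiv Q w₁ (u ++ w₂)).toLinearMap ∘ₗ
    TensorProduct.map LinearMap.id (appendEquiv Q u w₂).toLinearMap ∘ₗ
    (TensorProduct.leftComm k _ _ _).toLinearMap ∘ₗ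
    TensorProduct.map LinearMap.id
      ((appendEquiv Q w₁ w₂).symm.toLinearMap ∘ₗ φ ∘ₗ (singleEquiv Q c).toLinearMap) ∘ₗ
    (appendEquiv Q u [c]).symm.toLinearMap

/-- `o₁ ⊗ ⋯ ⊗ oₙ₋₁ ⊗ oₙ ↦ f₁(o₁) ⋯ fₙ₋₁(oₙ₋₁) oₙ`, without sign. -/
def contract (Q : GradedQuiver k O) (c : Letter O) : ∀ fs : List (DualElt Q),
    Tens Q (fs.map DualElt.letter ++ [c]) →ₗ[k] Q.at c
  | [] => (singleEquiv Q c).toLinearMap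
  | f :: fs =>
    (TensorProduct.lid k _).toLinearMap ∘ₗ TensorProduct.map f.val (contract Q c fs) ∘ₗ
      (consEquiv Q f.letter (fs.map DualElt.letter ++ [c])).toLinearMap

end Tens

/-! ### Pre-Calabi-Yau structures -/

/-- Given words `z = (x̄¹, …, x̄ⁿ)` and outputs `r = (r₁, …, rₙ)`: the word `z_i` goes from the source
of `r_i` to the target of `r_{i-1}`; `t` is the target of the output that precedes `r`. -/
def NecklaceFrom {Q : GradedQuiver k O} : O → List (List (Elt Q)) → List (Letter O) → Prop
  | _, [], [] => True
  | t, s :: z, ℓ :: r => IsPath ℓ.src s t ∧ NecklaceFrom ℓ.tgt z r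
  | _, [], _ :: _ => False
  | _, _ :: _, [] => False

/-- The objects of `z` and of the outputs `r` match: there are `n ≥ 1` words `z₁, …, zₙ` and `n`
outputs, `r_i` goes from `lt(x̄ⁱ)` to `rt(x̄ⁱ⁺¹)`, cyclically, where `x̄ⁱ` is the tuple of objects
of `z_i` (a word may be empty, `x̄ⁱ` is then one object). -/
def IsNecklace {Q : GradedQuiver k O} (z : List (List (Elt Q))) (r : List (Letter O)) : Prop :=
  ∃ h : r ≠ [], NecklaceFrom (r.getLast h).tgt z r

/-- A homogeneous element of degree `e` of the product over all tuples `(x̄¹, …, x̄ⁿ)`, `n ≥ 1`, of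
the graded spaces of maps
`Q[1]^{⊗ x̄¹} ⊗ ⋯ ⊗ Q[1]^{⊗ x̄ⁿ} → _{lt x̄¹}Q_{rt x̄²}[-d] ⊗ ⋯ ⊗ _{lt x̄ⁿ}Q_{rt x̄¹}[-d]`.
Here `toFun z r` is the component of the value at `z = (sā¹, …, sāⁿ)` in the tensor product of the
homogeneous components indexed by `r`. -/
structure Multi (Q : GradedQuiver k O) (d e : ℤ) where
  toFun : List (List (Elt Q)) → (r : List (Letter O)) → Tens Q r
  map_add' : ∀ (Z₁ : List (List (Elt Q))) (s₁ : List (Elt Q)) (ℓ : Letter O) (a b : Q.at ℓ)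
    (s₂ : List (Elt Q)) (Z₂ : List (List (Elt Q))) (r : List (Letter O)),
    toFun (Z₁ ++ (s₁ ++ ⟨ℓ, a + b⟩ :: s₂) :: Z₂) r =
      toFun (Z₁ ++ (s₁ ++ ⟨ℓ, a⟩ :: s₂) :: Z₂) r + toFun (Z₁ ++ (s₁ ++ ⟨ℓ, b⟩ :: s₂) :: Z₂) r
  map_smul' : ∀ (Z₁ : List (List (Elt Q))) (s₁ : List (Elt Q)) (ℓ : Letter O) (t : k) (a : Q.at ℓ)
    (s₂ : List (Elt Q)) (Z₂ : List (List (Elt Q))) (r : List (Letter O)),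
    toFun (Z₁ ++ (s₁ ++ ⟨ℓ, t • a⟩ :: s₂) :: Z₂) r =
      t • toFun (Z₁ ++ (s₁ ++ ⟨ℓ, a⟩ :: s₂) :: Z₂) r
  support' : ∀ (z : List (List (Elt Q))) (r : List (Letter O)), toFun z r ≠ 0 →
    IsNecklace z r ∧ outDeg d r = inDeg z + e
  finite' : ∀ z : List (List (Elt Q)), {r | toFun z r ≠ 0}.Finite

namespace Multi

variable {Q : GradedQuiver k O} {d e : ℤ}

/-- The value of `M` as a linear function of one letter. -/
def slot (M : Multi Q d e) (Z₁ : List (List (Elt Q))) (s₁ : List (Elt Q)) (c : Letter O)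
    (s₂ : List (Elt Q)) (Z₂ : List (List (Elt Q))) (r : List (Letter O)) :
    Q.at c →ₗ[k] Tens Q r where
  toFun a := M.toFun (Z₁ ++ (s₁ ++ ⟨c, a⟩ :: s₂) :: Z₂) r
  map_add' a b := M.map_add' Z₁ s₁ c a b s₂ Z₂ r
  map_smul' t a := M.map_smul' Z₁ s₁ c t a s₂ Z₂ r

end Multi

/-! #### The necklace product

Below, `M` has degree `d + 2`, so that `s_{d+1}M` has degree `1`. The necklace product
`s_{d+1}M ∘ s_{d+1}M` is the sum over all the ways to connect one output of a disc `G = M` to one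
input of a second disc `F = M`; the connected output is shifted from `Q[-d]` to `Q[1]`, and all
signs are Koszul signs, for inputs in `Q[1]`, outputs in `Q[-d]` and the map `F ∘ s_{d+1}` of
degree `1`. The discs are rotated so that the last output of the diagram is the last output of `F`
or of `G`; in the first case the connected arrow is the last output of `G` (inner compositions), in
the second case the connected input lies in the first word of `F` (outer compositions).

The result is evaluated at `z = (z₁, …, z_N)` in the component indexed by `r = (r₁, …, r_N)`. -/

section Necklace

variable {Q : GradedQuiver k O} {d : ℤ}

/-- `z_a`, for `a < N`, counted from `0`. -/
def seg (z : List (List (Elt Q))) (a : ℕ) : List (Elt Q) := z.getD a []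

/-- The object of `z_a` after its first `i` letters. -/
def necPt (z : List (List (Elt Q))) (r : List (Letter O)) (a : Fin r.length) (i : ℕ) : O :=
  pt (r.get a).src (seg z a) i

/-- Inner compositions with a disc `G` with one output. The word `z_a` is `L ⊔ y ⊔ R`, the arguments
are `G(y)` and `F(X₁, L ⊔ G(y) ⊔ R, X₂)`. -/
def innerOne (M : Multi Q d (d + 2)) (z : List (List (Elt Q))) (r : List (Letter O)) : Tens Q r :=
  ∑ a : Fin r.length, ∑ j ∈ Finset.range ((seg z a).length + 1), ∑ i ∈ Finset.range (j + 1),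
    let X₁ := z.take a
    let X₂ := z.drop (a + 1)
    let L := (seg z a).take i
    let y := ((seg z a).drop i).take (j - i)
    let R := (seg z a).drop j
    let c : Letter O := ⟨necPt z r a i, necPt z r a j, segDeg y + 2⟩
    (inDeg X₁ + segDeg L).negOnePow •
      M.slot X₁ L c R X₂ r (Tens.singleEquiv Q c (M.toFun [y] [c]))

/-- Inner compositions with a disc `G` with `m ≥ 2` outputs. Here `z = (X₁, z_a, Y, z_b, X₂)` with
`z_a = y₁ ⊔ R`, `z_b = L ⊔ y_m`, and `r = (w₁, u, w₂)`; the disc `G` has arguments `(y₁, Y, y_m)` and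
outputs `(u, c)`, and `F` has arguments `(X₁, L ⊔ c ⊔ R, X₂)` and outputs `(w₁, w₂)`. -/
def innerMany (M : Multi Q d (d + 2)) (z : List (List (Elt Q))) (r : List (Letter O)) : Tens Q r :=
  ∑ a : Fin r.length, ∑ b ∈ Finset.Ioi a,
    ∑ i ∈ Finset.range ((seg z a).length + 1), ∑ j ∈ Finset.range ((seg z b).length + 1),
      let X₁ := z.take a
      let Y := (z.drop (a + 1)).take (b - a - 1)
      let X₂ := z.drop (b + 1)
      let y₁ := (seg z a).take i
      let R := (seg z a).drop i
      let L := (seg z b).take j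
      let yₘ := (seg z b).drop j
      let w₁ := r.take a
      let u := (r.drop a).take (b - a)
      let w₂ := (r.drop a).drop (b - a)
      let zG := y₁ :: (Y ++ [yₘ])
      let c : Letter O := ⟨necPt z r b j, necPt z r a i, inDeg zG + 2 - outDeg d u⟩
      -- reordering `(X₁, y₁, R, Y, L, yₘ, X₂)` to `(y₁, Y, yₘ, X₁, L, R, X₂)`
      let κ := segDeg y₁ * inDeg X₁ + inDeg Y * (inDeg X₁ + segDeg R) +
        segDeg yₘ * (inDeg X₁ + segDeg R + segDeg L) + segDeg R * segDeg L
      -- `u` passes `F ∘ s_{d+1}` and `w₁`, and the shifted output `c` passes `X₁` and `L`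
      let ε := κ + outDeg d u + (c.deg - 1) * (inDeg X₁ + segDeg L) + outDeg d u * outDeg d w₁
      ε.negOnePow •
        Tens.cast Q (by simp [w₁, u, w₂] : w₁ ++ (u ++ w₂) = r)
          (Tens.substLast Q u c w₁ w₂ (M.slot X₁ L c R X₂ (w₁ ++ w₂)) (M.toFun zG (u ++ [c])))

/-- Outer compositions. Here `z = (Y₁, z_a, X, z_b, Y₂)` with `z_a = L ⊔ y`, `z_b = y' ⊔ R`, and
`r = (u₁, w, u₂)`; the disc `G` has arguments `(Y₁, y, y', Y₂)` and outputs `(u₁, c, u₂)`, and `F` has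
arguments `(L ⊔ c ⊔ R, X)` and outputs `w`. -/
def outer (M : Multi Q d (d + 2)) (z : List (List (Elt Q))) (r : List (Letter O)) : Tens Q r :=
  ∑ a : Fin r.length, ∑ b ∈ Finset.Ioi a,
    ∑ i ∈ Finset.range ((seg z a).length + 1), ∑ j ∈ Finset.range ((seg z b).length + 1),
      let Y₁ := z.take a
      let X := (z.drop (a + 1)).take (b - a - 1)
      let Y₂ := z.drop (b + 1)
      let L := (seg z a).take i
      let y := (seg z a).drop i
      let y' := (seg z b).take j
      let R := (seg z b).drop j
      let u₁ := r.take a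
      let w := (r.drop a).take (b - a)
      let u₂ := (r.drop a).drop (b - a)
      let zG := Y₁ ++ y :: y' :: Y₂
      let c : Letter O :=
        ⟨necPt z r a i, necPt z r b j, inDeg zG + 2 - outDeg d u₁ - outDeg d u₂⟩
      -- reordering `(Y₁, L, y, X, y', R, Y₂)` to `(Y₁, y, y', Y₂, L, R, X)`
      let κ := segDeg y * segDeg L + segDeg y' * (segDeg L + inDeg X) +
        inDeg Y₂ * (segDeg L + inDeg X + segDeg R) + inDeg X * segDeg R
      -- `F ∘ s_{d+1}` passes `u₁`, `u₂` passes `L, R, X`, and the shifted output `c` passes `L`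
      let ε := κ + outDeg d u₁ + outDeg d u₂ * (segDeg L + segDeg R + inDeg X) +
        (c.deg - 1) * segDeg L
      ε.negOnePow •
        Tens.cast Q (by simp [u₁, w, u₂] : u₁ ++ (w ++ u₂) = r)
          (Tens.substMid Q u₁ c u₂ w (M.slot [] L c R X w) (M.toFun zG (u₁ ++ c :: u₂)))

/-- The component at `z`, `r` of the necklace product `s_{d+1}M ∘ s_{d+1}M`. -/
def necklaceSq (M : Multi Q d (d + 2)) (z : List (List (Elt Q))) (r : List (Letter O)) :
    Tens Q r :=
  innerOne M z r + innerMany M z r + outer M z r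

end Necklace

/-- A `d`-pre-Calabi-Yau structure on `Q`: an element `s_{d+1}M` of degree `1`, without component
with no input and one output, invariant under the cyclic groups (acting with Koszul signs on
inputs in `Q[1]` and outputs in `Q[-d]`), with `s_{d+1}M ∘ s_{d+1}M = 0` for the necklace product
(that is, `[s_{d+1}M, s_{d+1}M] = 0`). -/
structure PreCYStructure (Q : GradedQuiver k O) (d : ℤ) extends Multi Q d (d + 2) where
  no_curvature : ∀ r : List (Letter O), toFun [[]] r = 0
  cyclic : ∀ (s : List (Elt Q)) (z : List (List (Elt Q))) (ℓ : Letter O) (r : List (Letter O)),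
    IsNecklace (s :: z) (ℓ :: r) →
    toFun (z ++ [s]) (r ++ [ℓ]) =
      (segDeg s * inDeg z + (ℓ.deg + d) * outDeg d r).negOnePow •
        Tens.rot Q ℓ r (toFun (s :: z) (ℓ :: r))
  maurerCartan : ∀ (z : List (List (Elt Q))) (r : List (Letter O)),
    IsNecklace z r → necklaceSq toMulti z r = 0

/-! ### The maps `sm_{Q ⊕ Q^* → Q}` and `sm_{Q ⊕ Q^* → Q^*}` of a pre-Calabi-Yau structure -/

section Boundary

variable {Q : GradedQuiver k O} {d : ℤ}

/-- A word `S₀, tf₀, S₁, tf₁, S₂, …` with letters in `Q[1]` and in `Q^*[d]`, the `S_i` having all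
their letters in `Q[1]`, is cut into `S₀` and the list of the `(tf_i, S_{i+1})`. -/
def cut : List (Elt Q ⊕ DualElt Q) → List (Elt Q) × List (DualElt Q × List (Elt Q))
  | [] => ([], [])
  | Sum.inl a :: l => (a :: (cut l).1, (cut l).2)
  | Sum.inr f :: l => ([], (f, (cut l).1) :: (cut l).2)

/-- `∑_{i < j} n_i n_j`. -/
def pairSum : List ℤ → ℤ
  | [] => 0
  | n :: l => n * l.sum + pairSum l

/-- `∑_i t_i ∑_{j ≥ i} n_j`. -/
def crossSum : List ℤ → List ℤ → ℤ
  | t :: ts, n :: ns => t * (n :: ns).sum + crossSum ts ns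
  | _, _ => 0

/-- The words `(sā¹, …, sāⁿ)` of the word `(sāⁿ, tfⁿ⁻¹, sāⁿ⁻¹, …, tf¹, sā¹)`. -/
def cutSegs (l : List (Elt Q ⊕ DualElt Q)) : List (List (Elt Q)) :=
  ((cut l).2.map Prod.snd).reverse ++ [(cut l).1]

/-- The functionals `(f¹, …, fⁿ⁻¹)` of the word `(sāⁿ, tfⁿ⁻¹, sāⁿ⁻¹, …, tf¹, sā¹)`. -/
def cutDuals (l : List (Elt Q ⊕ DualElt Q)) : List (DualElt Q) := ((cut l).2.map Prod.fst).reverse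

/-- The sign exponent, with `tf = (|tf¹|, …, |tfⁿ⁻¹|)` and `sa = (|sā¹|, …, |sāⁿ|)`:
`∑_i |tfⁱ| ∑_{j>i} |sāʲ| + (|M| + d) ∑_i |tfⁱ| + d (n - 1) + ∑_{i<j} |sāⁱ||sāʲ| + ∑_{i<j} |tfⁱ||tfʲ|`,
plus the Koszul sign exponent `∑_{i<j} |tfⁱ||tfʲ|` of the evaluation of `f¹ ⊗ ⋯ ⊗ fⁿ⁻¹`. -/
def boundarySign (d : ℤ) (tf sa : List ℤ) : ℤ :=
  crossSum tf sa.tail + ((d + 2) + d) * tf.sum + d * tf.length + pairSum sa + pairSum tf +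
    pairSum tf

/-- `sm_{Q ⊕ Q^* → Q}` at a word with letters in `Q[1]` and in `Q^*[d]`:
`(sāⁿ, tfⁿ⁻¹, sāⁿ⁻¹, …, tf¹, sā¹) ↦ ± (f¹ ⊗ ⋯ ⊗ fⁿ⁻¹ ⊗ id)(M(sā¹, …, sāⁿ))`. -/
def toQ (M : Multi Q d (d + 2)) (l : List (Elt Q ⊕ DualElt Q)) (c : Letter O) : Q.at c :=
  (boundarySign d ((cutDuals l).map (DualElt.tdeg d)) ((cutSegs l).map segDeg)).negOnePow •
    Tens.contract Q c (cutDuals l)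
      (M.toFun (cutSegs l) ((cutDuals l).map DualElt.letter ++ [c]))

/-- The degree of a letter in `Q[1]` or in `Q^*[d]`. -/
def wdeg (d : ℤ) : Elt Q ⊕ DualElt Q → ℤ
  | Sum.inl a => a.sdeg
  | Sum.inr f => f.tdeg d

/-- If the word `l` has a letter in `Q^*[d]`, it is written `l = (l₀, tf, s)` where `tf` is the last
one, so that all the letters of `s` are in `Q[1]`. -/
def splitLast : List (Elt Q ⊕ DualElt Q) →
    Option (List (Elt Q ⊕ DualElt Q) × DualElt Q × List (Elt Q))
  | [] => none
  | x :: l =>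
    match splitLast l, x with
    | some (l₀, f, s), x => some (x :: l₀, f, s)
    | none, Sum.inl _ => none
    | none, Sum.inr f => some ([], f, (cut l).1)

theorem cut_append (s : List (Elt Q)) (b : Elt Q) (l : List (Elt Q ⊕ DualElt Q)) :
    cut (s.map Sum.inl ++ Sum.inl b :: l) = (s ++ b :: (cut l).1, (cut l).2) := by
  induction s with
  | nil => simp [cut]
  | cons a s ih => simp [cut, ih]

theorem segDeg_congr (s₁ s₂ : List (Elt Q)) (q : Letter O) (a b : Q.at q) :
    segDeg (s₁ ++ ⟨q, a⟩ :: s₂) = segDeg (s₁ ++ ⟨q, b⟩ :: s₂) := by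
  simp [segDeg, Elt.sdeg]

theorem toQ_slot (M : Multi Q d (d + 2)) (s : List (Elt Q)) (q : Letter O) (b : Q.at q)
    (l : List (Elt Q ⊕ DualElt Q)) (c : Letter O) :
    toQ M (s.map Sum.inl ++ Sum.inl ⟨q, b⟩ :: l) c =
      (boundarySign d ((cutDuals l).map (DualElt.tdeg d))
        ((((cut l).2.map Prod.snd).reverse ++ [s ++ ⟨q, 0⟩ :: (cut l).1]).map segDeg)).negOnePow •
      Tens.contract Q c (cutDuals l)
        (M.slot ((cut l).2.map Prod.snd).reverse s q (cut l).1 []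
          ((cutDuals l).map DualElt.letter ++ [c]) b) := by
  have key : ∀ p : List (Elt Q) × List (DualElt Q × List (Elt Q)),
      p = (s ++ ⟨q, b⟩ :: (cut l).1, (cut l).2) →
      (boundarySign d (((p.2.map Prod.fst).reverse).map (DualElt.tdeg d))
          (((p.2.map Prod.snd).reverse ++ [p.1]).map segDeg)).negOnePow •
        Tens.contract Q c (p.2.map Prod.fst).reverse
          (M.toFun ((p.2.map Prod.snd).reverse ++ [p.1])
            (((p.2.map Prod.fst).reverse).map DualElt.letter ++ [c])) =
      (boundarySign d ((cutDuals l).map (DualElt.tdeg d))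
        ((((cut l).2.map Prod.snd).reverse ++ [s ++ ⟨q, 0⟩ :: (cut l).1]).map segDeg)).negOnePow •
      Tens.contract Q c (cutDuals l)
        (M.slot ((cut l).2.map Prod.snd).reverse s q (cut l).1 []
          ((cutDuals l).map DualElt.letter ++ [c]) b) := by
    rintro p rfl
    simp only [List.map_append, List.map_cons, List.map_nil, segDeg_congr s (cut l).1 q b 0]
    rfl
  exact key _ (cut_append s ⟨q, b⟩ l)

/-- `sb ↦ Γ(sm_{Q ⊕ Q^* → Q}(s, sb, l), tf)` where `Γ` is the natural bilinear form of
`Q ⊕ Q^*[d-1]`, given by `Γ(sa, tf) = (-1)^{|sa||tf| + |tf|} f(a)`. -/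
def pairLast (M : Multi Q d (d + 2)) (s : List (Elt Q)) (q : Letter O)
    (l : List (Elt Q ⊕ DualElt Q)) (f : DualElt Q) : Module.Dual k (Q.at q) where
  toFun b := ((f.letter.deg - 1) * f.tdeg d + f.tdeg d).negOnePow •
    f.val (toQ M (s.map Sum.inl ++ Sum.inl ⟨q, b⟩ :: l) f.letter)
  map_add' a b := by
    simp only [toQ_slot, map_add, smul_add, Units.smul_def, map_zsmul]
  map_smul' t a := by
    simp only [toQ_slot, map_smul, RingHom.id_apply, Units.smul_def, map_zsmul]
    simp only [smul_comm t]

/-- `sm_{Q ⊕ Q^* → Q^*}` at a word with letters in `Q[1]` and in `Q^*[d]`, as a functional `g` on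
`Q.at q`. It vanishes on words without letter in `Q^*[d]`; on the word `(l₀, tf, s)` it is determined
by the cyclicity condition with respect to the natural bilinear form `Γ`:
`Γ(tg, sb) = (-1)^{ε'} Γ(sm_{Q ⊕ Q^* → Q}(s, sb, l₀), tf)` with `ε' = (|s| + |sb|)(|l₀| + |tf|)`,
where `Γ(tg, sb) = (-1)^{|tg| + 1} g(b)`. -/
def toDual (M : Multi Q d (d + 2)) (l : List (Elt Q ⊕ DualElt Q)) (q : Letter O) :
    Module.Dual k (Q.at q) :=
  match splitLast l with
  | none => 0
  | some (l₀, f, s) =>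
    ((-q.deg - d) + 1 +
        (segDeg s + (q.deg - 1)) * ((l₀.map (wdeg d)).sum + f.tdeg d)).negOnePow •
      pairLast M s q l₀ f

end Boundary

/-! ### Morphisms -/

/-- The image of the index of a homogeneous component. -/
abbrev Letter.map (φ : O → O') (ℓ : Letter O) : Letter O' := ⟨φ ℓ.src, φ ℓ.tgt, ℓ.deg⟩

/-- A morphism of graded quivers. -/
structure QuiverHom (A : GradedQuiver k O) (B : GradedQuiver k O') where
  obj : O → O'
  map : ∀ (x y : O) (p : ℤ), A.Hom x y p →ₗ[k] B.Hom (obj x) (obj y) p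

namespace QuiverHom

variable {A : GradedQuiver k O} {B : GradedQuiver k O'}

/-- The image of a homogeneous element. -/
def elt (Φ : QuiverHom A B) (a : Elt A) : Elt B :=
  ⟨a.letter.map Φ.obj, Φ.map a.letter.src a.letter.tgt a.letter.deg a.val⟩

/-- `Φ ⊗ ⋯ ⊗ Φ`. -/
def tens (Φ : QuiverHom A B) : ∀ r : List (Letter O),
    Tens A r →ₗ[k] Tens B (r.map (Letter.map Φ.obj))
  | [] => LinearMap.id
  | ℓ :: r =>
    (Tens.consEquiv B (ℓ.map Φ.obj) (r.map (Letter.map Φ.obj))).symm.toLinearMap ∘ₗ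
      TensorProduct.map (Φ.map ℓ.src ℓ.tgt ℓ.deg) (tens Φ r) ∘ₗ
      (Tens.consEquiv A ℓ r).toLinearMap

/-- `Φ` is a strict `d`-pre-Calabi-Yau morphism:
`(Φ ⊗ ⋯ ⊗ Φ) ∘ M_A = M_B ∘ (Φ ⊗ ⋯ ⊗ Φ)` for every tuple of words in `A`. -/
def IsStrict {d : ℤ} (Φ : QuiverHom A B) (MA : PreCYStructure A d) (MB : PreCYStructure B d) :
    Prop :=
  ∀ (z : List (List (Elt A))) (r : List (Letter O)), IsNecklace z r →
    Φ.tens r (MA.toFun z r) = MB.toFun (z.map (List.map Φ.elt)) (r.map (Letter.map Φ.obj))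

end QuiverHom

/-! ### The `A_∞`-structure on `A ⊕ B^*[d-1]` -/

/-- The graded quiver `A ⊕ B^*[d-1]` relative to a map `φ` on objects: its objects are those of `A`
and `ₓ(A ⊕ B^*[d-1])_y = ₓA_y ⊕ _{φ x}B^*_{φ y}[d-1]`, with `_{x}B^*_{y} = (_yBₓ)^*` the graded
dual, whose degree `n` component is the dual of the degree `-n` component. -/
def mixedQuiver (A : GradedQuiver k O) (B : GradedQuiver k O') (φ : O → O') (d : ℤ) :
    GradedQuiver k O where
  Hom x y p := A.Hom x y p × Module.Dual k (B.Hom (φ y) (φ x) (-(p + (d - 1))))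

section Mixed

variable {A : GradedQuiver k O} {B : GradedQuiver k O'} {d : ℤ}

/-- The component in `A` of a homogeneous element of `A ⊕ B^*[d-1]`. -/
def partA (Φ : QuiverHom A B) (h : Elt (mixedQuiver A B Φ.obj d)) : Elt A := ⟨h.letter, h.val.1⟩

/-- The component in `B^*` of a homogeneous element of `A ⊕ B^*[d-1]`. -/
def partB (Φ : QuiverHom A B) (h : Elt (mixedQuiver A B Φ.obj d)) : DualElt B :=
  ⟨⟨Φ.obj h.letter.tgt, Φ.obj h.letter.src, -(h.letter.deg + (d - 1))⟩, h.val.2⟩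

/-- The functional `Φ^*(f) = f ∘ Φ` on `A`, for `f` the component in `B^*` of a homogeneous element
of `A ⊕ B^*[d-1]`. -/
def pullB (Φ : QuiverHom A B) (h : Elt (mixedQuiver A B Φ.obj d)) : DualElt A :=
  ⟨⟨h.letter.tgt, h.letter.src, -(h.letter.deg + (d - 1))⟩,
    h.val.2 ∘ₗ Φ.map h.letter.tgt h.letter.src (-(h.letter.deg + (d - 1)))⟩

/-- The element `sm_{A ⊕ B^*}`: on words with letters in `A[1]` and in `B^*[d]`, its component in `A`
is `sm_{A ⊕ A^* → A} ∘ (id or Φ^*)` and its component in `B^*` is `sm_{B ⊕ B^* → B^*} ∘ (Φ or id)`. A word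
in `A[1] ⊕ B^*[d]` is expanded by multilinearity into words with letters in `A[1]` and in
`B^*[d]`. -/
def mixedOp (Φ : QuiverHom A B) (MA : PreCYStructure A d) (MB : PreCYStructure B d) :
    Op (mixedQuiver A B Φ.obj d) := fun l c =>
  open Classical in
  if IsPath c.src l c.tgt then
    (((l.map fun h => [Sum.inl (partA Φ h), Sum.inr (pullB Φ h)]).sections.map
        fun l' => toQ MA.toMulti l' c).sum,
     ((l.map fun h => [Sum.inl (Φ.elt (partA Φ h)), Sum.inr (partB Φ h)]).sections.map
        fun l' => toDual MB.toMulti l'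
          ⟨Φ.obj c.tgt, Φ.obj c.src, -(c.deg + (d - 1))⟩).sum)
  else 0

/-- Extension by zero, to the degree `q`, of a functional on the degree `p` component. -/
def extend (x y : O') (p q : ℤ) :
    Module.Dual k (B.Hom x y p) →ₗ[k] B.Hom x y q →ₗ[k] k :=
  if h : p = q then h ▸ LinearMap.id else 0

/-- The `Φ`-mixed bilinear form on `A ⊕ B^*[d-1]`:
`Γ(tf, sa) = (-1)^{|tf| + 1} f(Φ(a))`, `Γ(sa, tf) = -(-1)^{|sa||tf|} Γ(tf, sa)`,
`Γ(sa, sb) = 0` and `Γ(tf, tg) = 0`; here the left argument has degree `p - 1` and the right argument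
has degree `q - 1`. -/
def mixedPairing (Φ : QuiverHom A B) (d : ℤ) (x y : O) (p q : ℤ) :
    (A.Hom x y p × Module.Dual k (B.Hom (Φ.obj y) (Φ.obj x) (-(p + (d - 1))))) →ₗ[k]
      (A.Hom y x q × Module.Dual k (B.Hom (Φ.obj x) (Φ.obj y) (-(q + (d - 1))))) →ₗ[k] k :=
  -- first term: the pairing of `tf` on the left with `sa` on the right
  ((p - 1) + 1).negOnePow •
    ((extend (B := B) (Φ.obj y) (Φ.obj x) (-(p + (d - 1))) q).compl₁₂
      (LinearMap.snd k (A.Hom x y p) _) (Φ.map y x q ∘ₗ LinearMap.fst k (A.Hom y x q) _)) +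
  -- second term: the pairing of `sa` on the left with `tf` on the right
  (-((p - 1) * (q - 1)).negOnePow * ((q - 1) + 1).negOnePow) •
    ((extend (B := B) (Φ.obj x) (Φ.obj y) (-(q + (d - 1))) p).flip.compl₁₂
      (Φ.map x y p ∘ₗ LinearMap.fst k (A.Hom x y p) _) (LinearMap.snd k (A.Hom y x q) _))

/-- The `Φ`-mixed bilinear form, of degree `d - 1`. -/
def mixedForm (Φ : QuiverHom A B) (d : ℤ) : BilinForm (mixedQuiver A B Φ.obj d) (d - 1) where
  form x y p q := mixedPairing Φ d x y p q
  degree x y p q h := by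
    have h₁ : ¬ -(p + (d - 1)) = q := fun e => h (by omega)
    have h₂ : ¬ -(q + (d - 1)) = p := fun e => h (by omega)
    have e₁ : extend (B := B) (Φ.obj y) (Φ.obj x) (-(p + (d - 1))) q = 0 := by
      simp only [extend, dif_neg h₁]
    have e₂ : extend (B := B) (Φ.obj x) (Φ.obj y) (-(q + (d - 1))) p = 0 := by
      simp only [extend, dif_neg h₂]
    have e : mixedPairing Φ d x y p q = 0 := by
      unfold mixedPairing
      rw [e₁, e₂]
      refine LinearMap.ext fun a => LinearMap.ext fun b => ?_
      simp only [LinearMap.add_apply, LinearMap.smul_apply, LinearMap.compl₁₂_apply,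
        LinearMap.flip_apply, LinearMap.zero_apply, Units.smul_def, smul_zero, add_zero]
    exact e

end Mixed

end PreCY

end

noncomputable section

namespace PreCY

variable {k : Type u} [Field k] {O : Type v} {O' : Type w}

/-! ### Signs -/

/-! The argument lives on scalars attached to cyclic words. Applying one more functional to a value
of `toQ` gives, up to an explicit sign, the full evaluation `mv` of M on n words and n functionals
(`dual_toQ`), and `toDual` is defined so that its values are rotations of such scalars. Hence, for
one pre-Calabi–Yau structure, the number `pairing` = Γ(sm(l), y) depends, up to Koszul sign, only on
the cyclic word (l, y): this is `pairing_rotate`, which combines the cyclic invariance of M with the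
definition of `toDual`.

For the Stasheff identities on Q ⊕ Q^*, pair them first with a functional f. Putting tf in front of
the word gives tfⁿ, sⁿ, …, tf¹, s¹, and the inserted subword is delimited by two cuts. If both cuts
fall in the same sⁱ, the term is an inner composition with a disc with one output. If they fall in
different segments, the Q-component of the inserted value gives an inner composition with a disc
with several outputs, and its Q^*-component gives an outer composition. All signs differ from those
of the necklace product by the common factor `stasheffSign`, so the sum is ± an evaluation of the
necklace square, which vanishes (`wstasheff_inr`). The paired Stasheff expression is itself cyclic
(`wstasheff_rotate`), because Γ is graded antisymmetric on two values of sm; so pairing with an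
element of Q reduces to the previous case as soon as the word contains a functional, and is trivial
otherwise. Functionals and vectors separate points, so the pairing can be removed (`wstasheff_toQ`,
`wstasheff_toDual`).

A strict morphism intertwines the two structures: Φ carries `toQ` of A to `toQ` of B, and Φ^*
carries `toDual` of B to `toDual` of A (`toQ_strict`, `toDual_strict`). Consequently the A-component
of the Stasheff sum of the mixed operation is the Stasheff sum of M_A at the letters (a, Φ^*f), and
its B^*-component is that of M_B at the letters (Φa, f). Likewise Γ^Φ of a mixed value is the
natural pairing of B at the images of the letters (`mixedForm_mixedOp`), and almost cyclicity
follows from `pairing_rotate` for M_B. -/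

theorem negOnePow_congr {m n : ℤ} (h : (m : ZMod 2) = n) : m.negOnePow = n.negOnePow := by
  rw [Int.negOnePow_eq_iff, ← ZMod.intCast_eq_zero_iff_even]
  push_cast
  rw [h, sub_self]

theorem map_sign {V V' : Type*} [AddCommGroup V] [AddCommGroup V'] [Module k V] [Module k V']
    (f : V →ₗ[k] V') (n : ℤ) (x : V) : f (n.negOnePow • x) = n.negOnePow • f x := by
  simp only [Units.smul_def, map_zsmul]

theorem sign_smul_smul {V : Type*} [AddCommGroup V] (m n : ℤ) (x : V) :
    m.negOnePow • n.negOnePow • x = (m + n).negOnePow • x := by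
  rw [smul_smul, Int.negOnePow_add]

/-- Signs are compared as polynomial identities in `ZMod 2`. Idempotence of a variable is not a ring
identity, so it is supplied by hand wherever a degree meets itself. -/
theorem zmod_two_sq (x : ZMod 2) : x ^ 2 = x := by
  revert x
  decide

theorem sign_smul_eq_zero {V : Type*} [AddCommGroup V] (n : ℤ) (x : V) :
    n.negOnePow • x = 0 ↔ x = 0 := by
  constructor
  · intro h
    have := congrArg (fun y => n.negOnePow • y) h
    simpa only [smul_zero, sign_smul_smul, Int.negOnePow_even _ (Even.add_self n), one_smul]
      using this
  · rintro rfl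
    rw [smul_zero]

/-! ### Evaluation of tensors on lists of functionals -/

section Ev

variable {Q : GradedQuiver k O}

/-- Extension by zero of a homogeneous functional to the other homogeneous components. -/
def ev1 (ℓ : Letter O) (f : DualElt Q) : Q.at ℓ →ₗ[k] k :=
  open Classical in if h : f.letter = ℓ then h ▸ f.val else 0

theorem ev1_self (ℓ : Letter O) (φ : Module.Dual k (Q.at ℓ)) : ev1 ℓ ⟨ℓ, φ⟩ = φ := by
  simp [ev1]

/-- The evaluation of `f₁ ⊗ ⋯ ⊗ fₙ`, without sign. -/
def ev : ∀ (r : List (Letter O)) (_ : List (DualElt Q)), Tens Q r →ₗ[k] k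
  | [], [] => (Tens.nilEquiv Q).toLinearMap
  | ℓ :: r, f :: fs => (TensorProduct.lid k k).toLinearMap ∘ₗ
      TensorProduct.map (ev1 ℓ f) (ev r fs) ∘ₗ (Tens.consEquiv Q ℓ r).toLinearMap
  | [], _ :: _ => 0
  | _ :: _, [] => 0

theorem ev_cons (ℓ : Letter O) (r : List (Letter O)) (f : DualElt Q) (fs : List (DualElt Q))
    (a : Q.at ℓ) (x : Tens Q r) :
    ev (ℓ :: r) (f :: fs) ((Tens.consEquiv Q ℓ r).symm (a ⊗ₜ x)) = ev1 ℓ f a * ev r fs x := by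
  simp [ev]

theorem Tens.cons_induction {ℓ : Letter O} {r : List (Letter O)} {p : Tens Q (ℓ :: r) → Prop}
    (x : Tens Q (ℓ :: r)) (zero : p 0)
    (tmul : ∀ (a : Q.at ℓ) (y : Tens Q r), p ((Tens.consEquiv Q ℓ r).symm (a ⊗ₜ y)))
    (add : ∀ x y, p x → p y → p (x + y)) : p x := by
  rw [← (Tens.consEquiv Q ℓ r).symm_apply_apply x]
  induction (Tens.consEquiv Q ℓ r) x using TensorProduct.induction_on with
  | zero => simpa using zero
  | tmul a y => exact tmul a y
  | add x y hx hy => simpa using add _ _ hx hy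

theorem Tens.append_induction {r s : List (Letter O)} {p : Tens Q (r ++ s) → Prop}
    (x : Tens Q (r ++ s)) (zero : p 0)
    (tmul : ∀ (a : Tens Q r) (y : Tens Q s), p (Tens.appendEquiv Q r s (a ⊗ₜ y)))
    (add : ∀ x y, p x → p y → p (x + y)) : p x := by
  rw [← (Tens.appendEquiv Q r s).apply_symm_apply x]
  induction (Tens.appendEquiv Q r s).symm x using TensorProduct.induction_on with
  | zero => simpa using zero
  | tmul a y => exact tmul a y
  | add x y hx hy => simpa using add _ _ hx hy

theorem Tens.appendEquiv_cons (ℓ : Letter O) (r s : List (Letter O)) (a : Q.at ℓ) (x : Tens Q r)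
    (y : Tens Q s) :
    Tens.appendEquiv Q (ℓ :: r) s ((Tens.consEquiv Q ℓ r).symm (a ⊗ₜ x) ⊗ₜ y) =
      (Tens.consEquiv Q ℓ (r ++ s)).symm (a ⊗ₜ Tens.appendEquiv Q r s (x ⊗ₜ y)) := by
  simp [Tens.appendEquiv]

theorem ev_append (r s : List (Letter O)) (fs gs : List (DualElt Q)) (h : r.length = fs.length)
    (x : Tens Q r) (y : Tens Q s) :
    ev (r ++ s) (fs ++ gs) (Tens.appendEquiv Q r s (x ⊗ₜ y)) = ev r fs x * ev s gs y := by
  induction r generalizing fs with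
  | nil =>
    obtain rfl : fs = [] := by simpa using h.symm
    simp [ev, Tens.appendEquiv]
  | cons ℓ r ih =>
    cases fs with
    | nil => simp at h
    | cons f fs =>
      simp only [List.length_cons, Nat.add_right_cancel_iff] at h
      induction x using Tens.cons_induction with
      | zero => simp
      | tmul a x =>
        rw [Tens.appendEquiv_cons]
        refine (ev_cons ℓ (r ++ s) f (fs ++ gs) a _).trans ?_
        rw [ev_cons, ih fs h, mul_assoc]
      | add x₁ x₂ h₁ h₂ =>
        rw [TensorProduct.add_tmul, map_add, map_add, h₁, h₂, map_add, add_mul]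

theorem ev_single (ℓ : Letter O) (f : DualElt Q) (x : Tens Q [ℓ]) :
    ev [ℓ] [f] x = ev1 ℓ f (Tens.singleEquiv Q ℓ x) := by
  induction x using Tens.cons_induction with
  | zero => simp
  | tmul a y => rw [ev_cons]; simp [ev, Tens.singleEquiv, mul_comm]
  | add x y hx hy => rw [map_add, hx, hy, map_add, map_add]

theorem contract_cons (c : Letter O) (f : DualElt Q) (fs : List (DualElt Q)) :
    Tens.contract Q c (f :: fs) = (TensorProduct.lid k _).toLinearMap ∘ₗ
      TensorProduct.map f.val (Tens.contract Q c fs) ∘ₗ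
      (Tens.consEquiv Q f.letter (fs.map DualElt.letter ++ [c])).toLinearMap :=
  rfl

theorem ev_eq_comp (ℓ : Letter O) (r : List (Letter O)) (f : DualElt Q) (fs : List (DualElt Q)) :
    ev (ℓ :: r) (f :: fs) = (TensorProduct.lid k k).toLinearMap ∘ₗ
      TensorProduct.map (ev1 ℓ f) (ev r fs) ∘ₗ (Tens.consEquiv Q ℓ r).toLinearMap :=
  rfl

/-- The bridge from vectors to scalars: a partial contraction followed by a functional on the
surviving factor is a full evaluation. Identities between values of M can therefore be checked on
`ev`. -/
theorem comp_contract (c : Letter O) (fs : List (DualElt Q)) (φ : Module.Dual k (Q.at c)) :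
    φ ∘ₗ Tens.contract Q c fs = ev (fs.map DualElt.letter ++ [c]) (fs ++ [⟨c, φ⟩]) := by
  induction fs with
  | nil =>
    refine LinearMap.ext fun x => ?_
    have h := ev_single c ⟨c, φ⟩ x
    rw [ev1_self] at h
    exact h.symm
  | cons f fs ih =>
    have h := ev1_self f.letter f.val
    have e := ev_eq_comp f.letter (fs.map DualElt.letter ++ [c]) f (fs ++ [⟨c, φ⟩])
    refine Eq.trans ?_ e.symm
    rw [contract_cons, ← ih, h, ← LinearMap.comp_assoc, ← LinearMap.comp_assoc,
      ← LinearMap.comp_assoc]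
    congr 1
    refine TensorProduct.ext' fun a y => ?_
    simp only [LinearMap.comp_apply, LinearEquiv.coe_coe, TensorProduct.map_tmul,
      TensorProduct.lid_tmul, map_smul]

theorem ev_contract (c : Letter O) (fs : List (DualElt Q)) (φ : Module.Dual k (Q.at c))
    (x : Tens Q (fs.map DualElt.letter ++ [c])) :
    φ (Tens.contract Q c fs x) = ev (fs.map DualElt.letter ++ [c]) (fs ++ [⟨c, φ⟩]) x := by
  rw [← comp_contract, LinearMap.comp_apply]

theorem ev_rot (ℓ : Letter O) (r : List (Letter O)) (f : DualElt Q) (fs : List (DualElt Q))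
    (h : r.length = fs.length) (x : Tens Q (ℓ :: r)) :
    ev (r ++ [ℓ]) (fs ++ [f]) (Tens.rot Q ℓ r x) = ev (ℓ :: r) (f :: fs) x := by
  induction x using Tens.cons_induction with
  | zero => simp
  | tmul a y =>
    rw [ev_cons]
    simp only [Tens.rot, LinearEquiv.trans_apply, LinearEquiv.apply_symm_apply,
      TensorProduct.comm_tmul, TensorProduct.congr_tmul, LinearEquiv.refl_apply]
    rw [ev_append _ _ _ _ h, ev_single, LinearEquiv.apply_symm_apply, mul_comm]
  | add x y hx hy => simp only [map_add, hx, hy]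

theorem ev_cast {r s : List (Letter O)} (h : r = s) (fs : List (DualElt Q)) (x : Tens Q r) :
    ev s fs (Tens.cast Q h x) = ev r fs x := by
  subst h
  rfl

/-- In an outer composition the disc F, closed up by its own functionals, acts as one functional in
the slot of the connected output of G. -/
theorem ev_substMid (u₁ : List (Letter O)) (c : Letter O) (u₂ r : List (Letter O))
    (φ : Q.at c →ₗ[k] Tens Q r) (f₁ f₂ fr : List (DualElt Q)) (h₁ : u₁.length = f₁.length)
    (hr : r.length = fr.length) (x : Tens Q (u₁ ++ c :: u₂)) :
    ev (u₁ ++ (r ++ u₂)) (f₁ ++ (fr ++ f₂)) (Tens.substMid Q u₁ c u₂ r φ x) =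
      ev (u₁ ++ c :: u₂) (f₁ ++ ⟨c, ev r fr ∘ₗ φ⟩ :: f₂) x := by
  induction x using Tens.append_induction with
  | zero => simp
  | tmul a y =>
    rw [ev_append _ _ _ _ h₁]
    induction y using Tens.cons_induction with
    | zero => simp
    | tmul b y =>
      rw [ev_cons, ev1_self]
      simp only [Tens.substMid, LinearMap.comp_apply, LinearEquiv.coe_coe,
        LinearEquiv.symm_apply_apply, TensorProduct.map_tmul, LinearMap.id_apply,
        LinearEquiv.apply_symm_apply]
      rw [ev_append _ _ _ _ h₁, ev_append _ _ _ _ hr]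
    | add x y hx hy => simp only [TensorProduct.tmul_add, map_add, mul_add, hx, hy]
  | add x y hx hy => simp only [map_add, hx, hy]

/-- In an inner composition the functionals on the free outputs of G act first; what remains is an
element of Q, which is fed to F. -/
theorem ev_substLast (fu f₁ f₂ : List (DualElt Q)) (c : Letter O) (w₁ w₂ : List (Letter O))
    (φ : Q.at c →ₗ[k] Tens Q (w₁ ++ w₂)) (h₁ : w₁.length = f₁.length)
    (x : Tens Q (fu.map DualElt.letter ++ [c])) :
    ev (w₁ ++ (fu.map DualElt.letter ++ w₂)) (f₁ ++ (fu ++ f₂))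
        (Tens.substLast Q (fu.map DualElt.letter) c w₁ w₂ φ x) =
      ev (w₁ ++ w₂) (f₁ ++ f₂) (φ (Tens.contract Q c fu x)) := by
  -- The contraction is rewritten as an evaluation so that both sides become `ev` of a tensor over
  -- an appended list, which can be tested on pure tensors.
  have hc : ∀ ψ : Module.Dual k (Q.at c), ψ (Tens.contract Q c fu x) =
      ev (fu.map DualElt.letter ++ [c]) (fu ++ [⟨c, ψ⟩]) x := fun ψ => ev_contract c fu ψ x
  have hc' := hc (ev (w₁ ++ w₂) (f₁ ++ f₂) ∘ₗ φ)
  rw [LinearMap.comp_apply] at hc'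
  rw [hc']
  clear hc hc'
  induction x using Tens.append_induction with
  | zero => simp
  | tmul a y =>
    rw [ev_append _ _ _ _ (by simp), ev_single, ev1_self]
    simp only [Tens.substLast, LinearMap.comp_apply, LinearEquiv.coe_coe,
        LinearEquiv.symm_apply_apply, TensorProduct.map_tmul, LinearMap.id_apply]
    obtain ⟨t, ht⟩ := (Tens.appendEquiv Q w₁ w₂).surjective (φ (Tens.singleEquiv Q c y))
    rw [← ht, LinearEquiv.symm_apply_apply]
    clear ht
    induction t using TensorProduct.induction_on with
    | zero => simp
    | tmul p q =>
      simp only [TensorProduct.leftComm_tmul, TensorProduct.map_tmul, LinearMap.id_apply,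
        LinearEquiv.coe_coe]
      rw [ev_append _ _ _ _ h₁, ev_append _ _ _ _ h₁, ev_append _ _ _ _ (by simp)]
      ring
    | add x y hx hy => simp only [TensorProduct.tmul_add, map_add, mul_add, hx, hy]
  | add x y hx hy => simp only [map_add, hx, hy]

end Ev


/-! ### Cyclic words -/

section Words

variable {Q : GradedQuiver k O} {d : ℤ}

/-- The value of `f₁ ⊗ ⋯ ⊗ fₙ` on the component indexed by `r` of `M(z)`. -/
def evM {e : ℤ} (M : Multi Q d e) (z : List (List (Elt Q))) (r : List (Letter O))
    (fs : List (DualElt Q)) : k :=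
  ev r fs (M.toFun z r)

/-- The value of `f₁ ⊗ ⋯ ⊗ fₙ` on `M(s₁, …, sₙ)`, for `P = ((s₁, f₁), …, (sₙ, fₙ))`. -/
def mv {e : ℤ} (M : Multi Q d e) (P : List (List (Elt Q) × DualElt Q)) : k :=
  evM M (P.map Prod.fst) (P.map fun p => p.2.letter) (P.map Prod.snd)

/-- The sum of the degrees of the words of `P`. -/
def sumS (P : List (List (Elt Q) × DualElt Q)) : ℤ := inDeg (P.map Prod.fst)

/-- The sum of the degrees of the functionals of `P`. -/
def sumT (d : ℤ) (P : List (List (Elt Q) × DualElt Q)) : ℤ := (P.map fun p => p.2.tdeg d).sum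

@[simp] theorem segDeg_nil : segDeg ([] : List (Elt Q)) = 0 := rfl

@[simp] theorem segDeg_cons (a : Elt Q) (s : List (Elt Q)) :
    segDeg (a :: s) = a.sdeg + segDeg s := by
  simp [segDeg]

@[simp] theorem segDeg_append (s t : List (Elt Q)) : segDeg (s ++ t) = segDeg s + segDeg t := by
  simp [segDeg]

@[simp] theorem inDeg_nil : inDeg ([] : List (List (Elt Q))) = 0 := rfl

@[simp] theorem inDeg_cons (s : List (Elt Q)) (z : List (List (Elt Q))) :
    inDeg (s :: z) = segDeg s + inDeg z := by
  simp [inDeg]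

@[simp] theorem inDeg_append (z z' : List (List (Elt Q))) :
    inDeg (z ++ z') = inDeg z + inDeg z' := by
  simp [inDeg]

@[simp] theorem sumS_nil : sumS ([] : List (List (Elt Q) × DualElt Q)) = 0 := rfl

@[simp] theorem sumS_cons (p : List (Elt Q) × DualElt Q) (P : List (List (Elt Q) × DualElt Q)) :
    sumS (p :: P) = segDeg p.1 + sumS P := by
  simp [sumS]

@[simp] theorem sumS_append (P P' : List (List (Elt Q) × DualElt Q)) :
    sumS (P ++ P') = sumS P + sumS P' := by
  simp [sumS]

@[simp] theorem sumT_nil : sumT d ([] : List (List (Elt Q) × DualElt Q)) = 0 := rfl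

@[simp] theorem sumT_cons (p : List (Elt Q) × DualElt Q) (P : List (List (Elt Q) × DualElt Q)) :
    sumT d (p :: P) = p.2.tdeg d + sumT d P := by
  simp [sumT]

@[simp] theorem sumT_append (P P' : List (List (Elt Q) × DualElt Q)) :
    sumT d (P ++ P') = sumT d P + sumT d P' := by
  simp [sumT]

/-- A functional on the degree p component has |tf| = -p - d, the opposite of the degree p + d of
the output that it consumes. -/
theorem outDeg_letters (P : List (List (Elt Q) × DualElt Q)) :
    outDeg d (P.map fun p => p.2.letter) = -sumT d P := by
  induction P with
  | nil => simp [outDeg]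
  | cons p P ih =>
    simp only [outDeg, List.map_cons, List.sum_cons, sumT_cons, DualElt.tdeg] at ih ⊢
    rw [ih]
    ring

theorem mv_support {e : ℤ} (M : Multi Q d e) {P : List (List (Elt Q) × DualElt Q)}
    (h : mv M P ≠ 0) :
    IsNecklace (P.map Prod.fst) (P.map fun p => p.2.letter) ∧ sumS P + sumT d P = -e := by
  have h' : M.toFun (P.map Prod.fst) (P.map fun p => p.2.letter) ≠ 0 := by
    intro h0
    exact h (by rw [mv, evM, h0, map_zero])
  have h₂ := (M.support' _ _ h').2
  rw [outDeg_letters] at h₂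
  refine ⟨(M.support' _ _ h').1, ?_⟩
  rw [sumS]
  linarith

theorem necklaceFrom_append {t : O} {z : List (List (Elt Q))} {r : List (Letter O)}
    {s : List (Elt Q)} {ℓ : Letter O} (h : NecklaceFrom t (z ++ [s]) (r ++ [ℓ])) :
    NecklaceFrom t z r ∧ IsPath ℓ.src s ((r.getLast?.map Letter.tgt).getD t) := by
  induction z generalizing t r with
  | nil =>
    cases r with
    | nil => exact ⟨trivial, h.1⟩
    | cons m r =>
      have := h.2
      cases r <;> exact absurd this (by simp [NecklaceFrom])
  | cons s' z ih =>
    cases r with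
    | nil =>
      have := h.2
      cases z <;> exact absurd this (by simp [NecklaceFrom])
    | cons m r =>
      have h₂ := ih h.2
      refine ⟨⟨h.1, h₂.1⟩, ?_⟩
      have h₃ := h₂.2
      cases r with
      | nil => exact h₃
      | cons m' r =>
        rw [List.getLast?_cons_cons]
        simpa [List.getLast?_cons] using h₃

theorem isNecklace_rotate {z : List (List (Elt Q))} {r : List (Letter O)}
    {s : List (Elt Q)} {ℓ : Letter O} (h : IsNecklace (z ++ [s]) (r ++ [ℓ])) :
    IsNecklace (s :: z) (ℓ :: r) := by
  obtain ⟨h₁, h₂⟩ := h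
  rw [List.getLast_append_singleton] at h₂
  obtain ⟨h₃, h₄⟩ := necklaceFrom_append h₂
  refine ⟨by simp, ?_, h₃⟩
  cases r with
  | nil => exact h₄
  | cons m r =>
    rw [List.getLast_cons (by simp)]
    rwa [List.getLast?_eq_some_getLast (by simp)] at h₄

/-- The cyclic axiom is only available on necklaces. Away from them both sides vanish, since being a
necklace is itself invariant under rotation. -/
theorem mv_rotate (M : PreCYStructure Q d) (P : List (List (Elt Q) × DualElt Q))
    (p : List (Elt Q) × DualElt Q) :
    mv M.toMulti (P ++ [p]) = (segDeg p.1 * sumS P + p.2.tdeg d * sumT d P).negOnePow •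
      mv M.toMulti (p :: P) := by
  by_cases h : IsNecklace (p.1 :: P.map Prod.fst) (p.2.letter :: P.map fun p => p.2.letter)
  · have hc := M.cyclic _ _ _ _ h
    simp only [mv, List.map_append, List.map_cons, List.map_nil]
    rw [evM, hc, map_sign, ev_rot _ _ _ _ (by simp), outDeg_letters, sumS]
    rw [evM, DualElt.tdeg]
    congr 2
    ring
  · have h₁ : mv M.toMulti (p :: P) = 0 := by
      by_contra h'
      exact h (mv_support _ h').1
    have h₂ : mv M.toMulti (P ++ [p]) = 0 := by
      by_contra h'
      have := (mv_support _ h').1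
      simp only [List.map_append, List.map_cons, List.map_nil] at this
      exact h (isNecklace_rotate this)
    rw [h₁, h₂, smul_zero]

/-- The value of `mv` as a linear function of one letter. -/
def mvSlot {e : ℤ} (M : Multi Q d e) (X₁ : List (List (Elt Q) × DualElt Q)) (L : List (Elt Q))
    (c : Letter O) (R : List (Elt Q)) (f : DualElt Q) (X₂ : List (List (Elt Q) × DualElt Q)) :
    Q.at c →ₗ[k] k :=
  ev (X₁.map (fun p => p.2.letter) ++ f.letter :: X₂.map (fun p => p.2.letter))
      (X₁.map Prod.snd ++ f :: X₂.map Prod.snd) ∘ₗ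
    M.slot (X₁.map Prod.fst) L c R (X₂.map Prod.fst)
      (X₁.map (fun p => p.2.letter) ++ f.letter :: X₂.map (fun p => p.2.letter))

theorem mvSlot_apply {e : ℤ} (M : Multi Q d e) (X₁ : List (List (Elt Q) × DualElt Q))
    (L : List (Elt Q)) (c : Letter O) (R : List (Elt Q)) (f : DualElt Q)
    (X₂ : List (List (Elt Q) × DualElt Q)) (a : Q.at c) :
    mvSlot M X₁ L c R f X₂ a = mv M (X₁ ++ (L ++ ⟨c, a⟩ :: R, f) :: X₂) := by
  simp only [mv, List.map_append, List.map_cons]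
  rfl

/-- The word `tfₙ, sₙ, …, tf₁, s₁`, for `P = ((s₁, f₁), …, (sₙ, fₙ))`. -/
def wd : List (List (Elt Q) × DualElt Q) → List (Elt Q ⊕ DualElt Q)
  | [] => []
  | p :: P => wd P ++ Sum.inr p.2 :: p.1.map Sum.inl

theorem wd_append (P P' : List (List (Elt Q) × DualElt Q)) : wd (P ++ P') = wd P' ++ wd P := by
  induction P with
  | nil => simp [wd]
  | cons p P ih => simp [wd, ih]

/-- A normal form: the list P is read backwards by `wd`, so that its order is that of the arguments
of M. -/
theorem exists_word (l : List (Elt Q ⊕ DualElt Q)) :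
    ∃ (s : List (Elt Q)) (P : List (List (Elt Q) × DualElt Q)), l = s.map Sum.inl ++ wd P := by
  induction l with
  | nil => exact ⟨[], [], rfl⟩
  | cons x l ih =>
    obtain ⟨s, P, rfl⟩ := ih
    cases x with
    | inl a => exact ⟨a :: s, P, rfl⟩
    | inr f => exact ⟨[], P ++ [(s, f)], by simp [wd_append, wd]⟩

theorem word_cases (l : List (Elt Q ⊕ DualElt Q)) :
    (∃ s : List (Elt Q), l = s.map Sum.inl) ∨
      ∃ (l₀ : List (Elt Q ⊕ DualElt Q)) (f : DualElt Q) (s : List (Elt Q)),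
        l = l₀ ++ Sum.inr f :: s.map Sum.inl := by
  obtain ⟨s, P, rfl⟩ := exists_word l
  cases P with
  | nil => exact Or.inl ⟨s, by simp [wd]⟩
  | cons p P => exact Or.inr ⟨s.map Sum.inl ++ wd P, p.2, p.1, by simp [wd]⟩

/-- The degree of a word with letters in `Q[1]` and in `Q^*[d]`. -/
def wsum (d : ℤ) (l : List (Elt Q ⊕ DualElt Q)) : ℤ := (l.map (wdeg d)).sum

@[simp] theorem wsum_nil : wsum d ([] : List (Elt Q ⊕ DualElt Q)) = 0 := rfl

@[simp] theorem wsum_cons (x : Elt Q ⊕ DualElt Q) (l : List (Elt Q ⊕ DualElt Q)) :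
    wsum d (x :: l) = wdeg d x + wsum d l := by
  simp [wsum]

@[simp] theorem wsum_append (l l' : List (Elt Q ⊕ DualElt Q)) :
    wsum d (l ++ l') = wsum d l + wsum d l' := by
  simp [wsum]

@[simp] theorem wsum_map_inl (s : List (Elt Q)) : wsum d (s.map Sum.inl) = segDeg s := by
  induction s with
  | nil => rfl
  | cons a s ih => simp [ih, wdeg]

@[simp] theorem wsum_wd (P : List (List (Elt Q) × DualElt Q)) :
    wsum d (wd P) = sumS P + sumT d P := by
  induction P with
  | nil => rfl
  | cons p P ih =>
    simp only [wd, wsum_append, wsum_cons, wsum_map_inl, ih, sumS_cons, sumT_cons, wdeg]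
    ring

theorem cut_map_inl (s : List (Elt Q)) : cut (s.map Sum.inl : List (Elt Q ⊕ DualElt Q)) = (s, []) := by
  induction s with
  | nil => rfl
  | cons a s ih => simp [cut, ih]

theorem cut_append_inr (l : List (Elt Q ⊕ DualElt Q)) (f : DualElt Q) (s : List (Elt Q)) :
    cut (l ++ Sum.inr f :: s.map Sum.inl) = ((cut l).1, (cut l).2 ++ [(f, s)]) := by
  induction l with
  | nil => simp [cut, cut_map_inl]
  | cons x l ih => cases x <;> simp [cut, ih]

theorem cutSegs_word (s : List (Elt Q)) (P : List (List (Elt Q) × DualElt Q)) :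
    cutSegs (s.map Sum.inl ++ wd P) = P.map Prod.fst ++ [s] := by
  induction P with
  | nil => simp [wd, cutSegs, cut_map_inl]
  | cons p P ih =>
    rw [wd, ← List.append_assoc, cutSegs, cut_append_inr]
    rw [cutSegs] at ih
    simpa using ih

theorem cutDuals_word (s : List (Elt Q)) (P : List (List (Elt Q) × DualElt Q)) :
    cutDuals (s.map Sum.inl ++ wd P) = P.map Prod.snd := by
  induction P with
  | nil => simp [wd, cutDuals, cut_map_inl]
  | cons p P ih =>
    rw [wd, ← List.append_assoc, cutDuals, cut_append_inr]
    rw [cutDuals] at ih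
    simpa using ih

theorem splitLast_map_inl (s : List (Elt Q)) :
    splitLast (s.map Sum.inl : List (Elt Q ⊕ DualElt Q)) = none := by
  induction s with
  | nil => rfl
  | cons a s ih => simp [splitLast, ih]

theorem splitLast_append (l : List (Elt Q ⊕ DualElt Q)) (f : DualElt Q) (s : List (Elt Q)) :
    splitLast (l ++ Sum.inr f :: s.map Sum.inl) = some (l, f, s) := by
  induction l with
  | nil => simp [splitLast, splitLast_map_inl, cut_map_inl]
  | cons x l ih => simp [splitLast, ih]

/-- `∑_{i < j} (|tfⁱ| + |sⁱ|) |sʲ|`. -/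
def wordSign (d : ℤ) : List (List (Elt Q) × DualElt Q) → ℤ
  | [] => 0
  | p :: P => (p.2.tdeg d + segDeg p.1) * sumS P + wordSign d P

theorem wordSign_append (P P' : List (List (Elt Q) × DualElt Q)) :
    wordSign d (P ++ P') = wordSign d P + (sumT d P + sumS P) * sumS P' + wordSign d P' := by
  induction P with
  | nil => simp [wordSign]
  | cons p P ih =>
    simp only [wordSign, List.cons_append, ih, sumS_append, sumS_cons, sumT_cons]
    ring

theorem crossSum_cons (t : ℤ) (ts ns : List ℤ) :
    crossSum (t :: ts) ns = t * ns.sum + crossSum ts ns.tail := by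
  cases ns with
  | nil => cases ts <;> simp [crossSum]
  | cons n ns => rfl

/-- Both double sums run over i < j against |sʲ|, so they merge into ∑ (|tfⁱ| + |sⁱ|)|sʲ|; the last
word s is the index j with no functional of its own. -/
theorem cross_pair_sum (P : List (List (Elt Q) × DualElt Q)) (s : List (Elt Q)) :
    crossSum ((P.map Prod.snd).map (DualElt.tdeg d)) ((P.map Prod.fst ++ [s]).map segDeg).tail +
      pairSum ((P.map Prod.fst ++ [s]).map segDeg) =
    wordSign d P + (sumT d P + sumS P) * segDeg s := by
  induction P with
  | nil => simp [crossSum, pairSum, wordSign]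
  | cons p P ih =>
    have hs : ((P.map Prod.fst ++ [s]).map segDeg).sum = sumS P + segDeg s := by
      simp [sumS, inDeg]
    simp only [List.map_cons, List.cons_append, List.tail_cons, crossSum_cons, pairSum, wordSign,
      sumT_cons, sumS_cons, hs]
    linear_combination ih

/-- Modulo 2 the two copies of `pairSum` of the functionals cancel and the coefficient (d + 2) + d
vanishes, which leaves this shorter sign. -/
theorem toQ_word (M : Multi Q d (d + 2)) (s : List (Elt Q))
    (P : List (List (Elt Q) × DualElt Q)) (c : Letter O) :
    toQ M (s.map Sum.inl ++ wd P) c =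
      (wordSign d P + (sumT d P + sumS P) * segDeg s + d * P.length).negOnePow •
        Tens.contract Q c (P.map Prod.snd)
          (M.toFun (P.map Prod.fst ++ [s]) ((P.map Prod.snd).map DualElt.letter ++ [c])) := by
  have key : ∀ z fs, z = P.map Prod.fst ++ [s] → fs = P.map Prod.snd →
      (boundarySign d (fs.map (DualElt.tdeg d)) (z.map segDeg)).negOnePow •
        Tens.contract Q c fs (M.toFun z (fs.map DualElt.letter ++ [c])) =
      (wordSign d P + (sumT d P + sumS P) * segDeg s + d * P.length).negOnePow •
        Tens.contract Q c (P.map Prod.snd)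
          (M.toFun (P.map Prod.fst ++ [s]) ((P.map Prod.snd).map DualElt.letter ++ [c])) := by
    rintro z fs rfl rfl
    congr 1
    apply negOnePow_congr
    rw [← cross_pair_sum, boundarySign]
    push_cast
    simp only [List.length_map]
    grind
  exact key _ _ (cutSegs_word s P) (cutDuals_word s P)

theorem dual_toQ (M : Multi Q d (d + 2)) (s : List (Elt Q))
    (P : List (List (Elt Q) × DualElt Q)) (f : DualElt Q) :
    f.val (toQ M (s.map Sum.inl ++ wd P) f.letter) =
      (wordSign d P + (sumT d P + sumS P) * segDeg s + d * P.length).negOnePow •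
        mv M (P ++ [(s, f)]) := by
  rw [toQ_word, map_sign, ev_contract, mv, evM]
  have e : (P ++ [(s, f)]).map (fun p => p.2.letter) =
      (P.map Prod.snd).map DualElt.letter ++ [f.letter] := by
    simp
  rw [e]
  simp only [List.map_append, List.map_cons, List.map_nil]

/-- The value `Γ(sm(l), y)` on words with letters in `Q[1]` and in `Q^*[d]`. -/
def pairing (M : Multi Q d (d + 2)) (l : List (Elt Q ⊕ DualElt Q)) : Elt Q ⊕ DualElt Q → k
  | Sum.inl a => (-a.letter.deg - d + 1).negOnePow • toDual M l a.letter a.val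
  | Sum.inr f => ((f.letter.deg - 1) * f.tdeg d + f.tdeg d).negOnePow • f.val (toQ M l f.letter)

theorem toDual_map_inl (M : Multi Q d (d + 2)) (s : List (Elt Q)) (q : Letter O) :
    toDual M (s.map Sum.inl) q = 0 := by
  rw [toDual, splitLast_map_inl]

theorem pairing_map_inl (M : Multi Q d (d + 2)) (s : List (Elt Q)) (a : Elt Q) :
    pairing M (s.map Sum.inl) (Sum.inl a) = 0 := by
  rw [pairing, toDual_map_inl, LinearMap.zero_apply, smul_zero]

/-- The defining relation of `toDual`, in terms of `pairing`: the sign (-1)^{|tg|+1} of the form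
cancels the one built into `toDual`. -/
theorem pairing_inl (M : Multi Q d (d + 2)) (l : List (Elt Q ⊕ DualElt Q)) (f : DualElt Q)
    (s : List (Elt Q)) (b : Elt Q) :
    pairing M (l ++ Sum.inr f :: s.map Sum.inl) (Sum.inl b) =
      ((segDeg s + b.sdeg) * (wsum d l + f.tdeg d)).negOnePow •
        pairing M (s.map Sum.inl ++ Sum.inl b :: l) (Sum.inr f) := by
  simp only [pairing, toDual, splitLast_append]
  rw [LinearMap.smul_apply, sign_smul_smul]
  change _ • (_ : ℤ).negOnePow • f.val _ = _
  congr 1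
  apply negOnePow_congr
  simp only [wsum, Elt.sdeg]
  push_cast
  grind

/-- Both sides are evaluations of M, and the underlying lists differ by one rotation; the cyclic
invariance of M does the rest, up to comparing signs. -/
theorem pairing_inr_rotate (M : PreCYStructure Q d) (l : List (Elt Q ⊕ DualElt Q)) (g : DualElt Q)
    (s : List (Elt Q)) (f : DualElt Q) :
    pairing M.toMulti (l ++ Sum.inr g :: s.map Sum.inl) (Sum.inr f) =
      ((segDeg s + f.tdeg d) * (wsum d l + g.tdeg d)).negOnePow •
        pairing M.toMulti (s.map Sum.inl ++ Sum.inr f :: l) (Sum.inr g) := by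
  obtain ⟨s', P, rfl⟩ := exists_word l
  have e₁ : s'.map Sum.inl ++ wd P ++ Sum.inr g :: s.map Sum.inl =
      s'.map Sum.inl ++ wd ((s, g) :: P) := by simp [wd]
  have e₂ : s.map Sum.inl ++ Sum.inr f :: (s'.map Sum.inl ++ wd P) =
      s.map Sum.inl ++ wd (P ++ [(s', f)]) := by simp [wd, wd_append]
  simp only [pairing]
  rw [e₁, e₂, dual_toQ, dual_toQ, mv_rotate M (P ++ [(s', f)]) (s, g), List.cons_append]
  -- The signs agree only modulo the degree constraint, which holds when the evaluation is nonzero.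
  by_cases h : mv M.toMulti ((s, g) :: (P ++ [(s', f)])) = 0
  · rw [h]
    simp only [smul_zero]
  · have hd := (mv_support _ h).2
    simp only [sign_smul_smul]
    congr 1
    apply negOnePow_congr
    have hd' := congrArg (Int.cast : ℤ → ZMod 2) hd
    simp only [wordSign, wordSign_append, sumS_append, sumS_cons, sumS_nil, sumT_append,
      sumT_cons, sumT_nil, wsum_append, wsum_wd, wsum_map_inl, List.length_cons,
      List.length_append, List.length_nil] at hd' ⊢
    have hf : f.letter.deg = - f.tdeg d - d := by rw [DualElt.tdeg]; ring
    have hg : g.letter.deg = - g.tdeg d - d := by rw [DualElt.tdeg]; ring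
    rw [hf, hg]
    push_cast at hd' ⊢
    have h1 := zmod_two_sq (f.tdeg d)
    have h2 := zmod_two_sq (g.tdeg d)
    generalize ((f.tdeg d : ℤ) : ZMod 2) = tf at *
    generalize ((g.tdeg d : ℤ) : ZMod 2) = tg at *
    generalize ((d : ℤ) : ZMod 2) = d' at *
    generalize ((segDeg s : ℤ) : ZMod 2) = a at *
    generalize ((segDeg s' : ℤ) : ZMod 2) = a' at *
    generalize ((sumS P : ℤ) : ZMod 2) = x at *
    generalize ((sumT d P : ℤ) : ZMod 2) = y at *
    generalize ((wordSign d P : ℤ) : ZMod 2) = z at *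
    generalize ((P.length : ℕ) : ZMod 2) = n at *
    clear hf hg e₁ e₂ h hd
    -- The degree constraint is used to eliminate the total degree of the functionals of P; what is
    -- left is a polynomial identity in idempotent variables.
    have hy : y = d' + tf + tg + a + a' + x := by grind
    subst hy
    grind

/-- `Γ(sm(l, y), x) = ± Γ(sm(x, l), y)`. -/
theorem pairing_rotate (M : PreCYStructure Q d) (l : List (Elt Q ⊕ DualElt Q))
    (y x : Elt Q ⊕ DualElt Q) :
    pairing M.toMulti (l ++ [y]) x =
      (wdeg d x * (wsum d l + wdeg d y)).negOnePow • pairing M.toMulti (x :: l) y := by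
  cases y with
  | inr g =>
    cases x with
    | inl a =>
      have h := pairing_inl M.toMulti l g [] a
      simpa [wdeg] using h
    | inr f =>
      have h := pairing_inr_rotate M l g [] f
      simpa [wdeg] using h
  | inl b =>
    -- If l contains a functional, let g be the last one. Both sides are rotated until g is the
    -- paired letter, where the two expressions coincide. If l contains none, the claim is either 0
    -- = 0 or the definition of `toDual`.
    rcases word_cases l with ⟨s, rfl⟩ | ⟨l₀, g, s, rfl⟩
    · cases x with
      | inl a =>
        have h₁ := pairing_map_inl M.toMulti (s ++ [b]) a
        have h₂ := pairing_map_inl M.toMulti (a :: s) b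
        simp only [List.map_append, List.map_cons, List.map_nil] at h₁ h₂
        rw [h₁, h₂, smul_zero]
      | inr f =>
        have h := pairing_inl M.toMulti [] f s b
        simp only [List.nil_append, wsum_nil, zero_add] at h
        rw [h, sign_smul_smul, wsum_map_inl]
        simp only [wdeg]
        rw [Int.negOnePow_even _ ⟨f.tdeg d * (segDeg s + b.sdeg), by ring⟩, one_smul]
    · have e : l₀ ++ Sum.inr g :: s.map Sum.inl ++ [Sum.inl b] =
          l₀ ++ Sum.inr g :: (s ++ [b]).map Sum.inl := by simp
      have h₂ := pairing_inl M.toMulti (x :: l₀) g s b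
      rw [List.cons_append] at h₂
      rw [e, h₂, sign_smul_smul]
      have h₁ : pairing M.toMulti (l₀ ++ Sum.inr g :: (s ++ [b]).map Sum.inl) x =
          ((segDeg (s ++ [b]) + wdeg d x) * (wsum d l₀ + g.tdeg d)).negOnePow •
            pairing M.toMulti ((s ++ [b]).map Sum.inl ++ x :: l₀) (Sum.inr g) := by
        cases x with
        | inl a => exact pairing_inl M.toMulti l₀ g (s ++ [b]) a
        | inr f => exact pairing_inr_rotate M l₀ g (s ++ [b]) f
      rw [h₁]
      simp only [List.map_append, List.map_cons, List.map_nil, List.append_assoc,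
        List.cons_append, List.nil_append]
      congr 1
      apply negOnePow_congr
      simp only [wsum_append, wsum_cons, wsum_map_inl, segDeg_append, segDeg_cons, segDeg_nil]
      simp only [wdeg]
      push_cast
      grind

theorem pairing_rotate_append (M : PreCYStructure Q d) (L R : List (Elt Q ⊕ DualElt Q))
    (x y : Elt Q ⊕ DualElt Q) :
    pairing M.toMulti (L ++ x :: R) y =
      ((wsum d R + wdeg d y) * (wsum d L + wdeg d x)).negOnePow •
        pairing M.toMulti (R ++ y :: L) x := by
  induction R using List.reverseRecOn generalizing L y with
  | nil =>
    rw [pairing_rotate]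
    simp
  | append_singleton R r ih =>
    have e : L ++ x :: (R ++ [r]) = (L ++ x :: R) ++ [r] := by simp
    rw [e, pairing_rotate, ← List.cons_append, ih, sign_smul_smul]
    simp only [List.append_assoc, List.cons_append, List.nil_append]
    congr 1
    apply negOnePow_congr
    simp only [wsum_append, wsum_cons, wsum_nil]
    push_cast
    grind

end Words


/-! ### Degree constraints and multilinearity, obtained from cyclicity -/

section Slots

variable {Q : GradedQuiver k O} {d : ℤ}

theorem pairing_degree (M : Multi Q d (d + 2)) {l : List (Elt Q ⊕ DualElt Q)}
    {y : Elt Q ⊕ DualElt Q} (h : pairing M l y ≠ 0) : wsum d l + wdeg d y = -d - 2 := by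
  have key : ∀ (l : List (Elt Q ⊕ DualElt Q)) (f : DualElt Q),
      pairing M l (Sum.inr f) ≠ 0 → wsum d l + f.tdeg d = -d - 2 := by
    intro l f h
    obtain ⟨s, P, rfl⟩ := exists_word l
    rw [pairing, dual_toQ, ne_eq, sign_smul_eq_zero, sign_smul_eq_zero] at h
    have hd := (mv_support _ h).2
    simp only [sumS_append, sumS_cons, sumS_nil, sumT_append, sumT_cons, sumT_nil, wsum_append,
      wsum_wd, wsum_map_inl] at hd ⊢
    linarith
  cases y with
  | inr f => exact key l f h
  | inl b =>
    rcases word_cases l with ⟨s, rfl⟩ | ⟨l₀, g, s, rfl⟩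
    · exact absurd (pairing_map_inl M s b) h
    · rw [pairing_inl, ne_eq, sign_smul_eq_zero] at h
      have := key _ _ h
      simp only [wsum_append, wsum_cons, wsum_map_inl, wdeg] at this ⊢
      linarith

theorem toQ_degree (M : Multi Q d (d + 2)) {l : List (Elt Q ⊕ DualElt Q)} {c : Letter O}
    (h : toQ M l c ≠ 0) : c.deg - 1 = wsum d l + 1 := by
  obtain ⟨φ, hφ⟩ : ∃ φ : Module.Dual k (Q.at c), φ (toQ M l c) ≠ 0 := by
    by_contra! h'
    exact h ((Module.forall_dual_apply_eq_zero_iff k _).1 h')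
  have : pairing M l (Sum.inr ⟨c, φ⟩) ≠ 0 := by
    rw [pairing, ne_eq, sign_smul_eq_zero]
    exact hφ
  have := pairing_degree M this
  simp only [wdeg, DualElt.tdeg] at this
  linarith

theorem toDual_degree (M : Multi Q d (d + 2)) {l : List (Elt Q ⊕ DualElt Q)} {q : Letter O}
    (h : toDual M l q ≠ 0) : wsum d l + (q.deg - 1) = -d - 2 := by
  obtain ⟨b, hb⟩ : ∃ b : Q.at q, toDual M l q b ≠ 0 := by
    by_contra! h'
    exact h (LinearMap.ext h')
  have : pairing M l (Sum.inl ⟨q, b⟩) ≠ 0 := by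
    rw [pairing, ne_eq, sign_smul_eq_zero]
    exact hb
  exact pairing_degree M this

/-- This is the absence of curvature. It allows the insertions at empty subwords to be added to the
Stasheff sums without changing them. -/
theorem toQ_nil (M : PreCYStructure Q d) (c : Letter O) : toQ M.toMulti [] c = 0 := by
  have h := toQ_word M.toMulti [] [] c
  refine h.trans ?_
  simp [M.no_curvature]

/-- A function of words with letters in `Q[1]` and in `Q^*[d]` that is linear in every letter. -/
structure SlotLinear {V : Type*} [AddCommGroup V] [Module k V]
    (Λ : List (Elt Q ⊕ DualElt Q) → V) : Prop where
  inl : ∀ L ℓ R, IsLinearMap k fun a : Q.at ℓ => Λ (L ++ Sum.inl ⟨ℓ, a⟩ :: R)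
  inr : ∀ L ℓ R, IsLinearMap k fun f : Module.Dual k (Q.at ℓ) => Λ (L ++ Sum.inr ⟨ℓ, f⟩ :: R)

theorem IsLinearMap.sign_smul {V V' : Type*} [AddCommGroup V] [Module k V] [AddCommGroup V']
    [Module k V'] {g : V → V'} (h : IsLinearMap k g) (n : ℤ) :
    IsLinearMap k fun x => n.negOnePow • g x where
  map_add x y := by simp only [h.map_add, smul_add]
  map_smul t x := by simp only [h.map_smul, Units.smul_def]; rw [smul_comm]

/-- Rotate the letter in question to the paired position. There linearity is visible: either a
linear functional is applied to that letter, or that letter is a functional applied to a fixed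
vector. -/
theorem slotLinear_pairing (M : PreCYStructure Q d) (y : Elt Q ⊕ DualElt Q) :
    SlotLinear fun l => pairing M.toMulti l y where
  inl L ℓ R := by
    simp only [pairing_rotate_append M L R]
    exact IsLinearMap.sign_smul (IsLinearMap.sign_smul
      (toDual M.toMulti (R ++ y :: L) ℓ).isLinear (-ℓ.deg - d + 1))
      ((wsum d R + wdeg d y) * (wsum d L + (ℓ.deg - 1)))
  inr L ℓ R := by
    simp only [pairing_rotate_append M L R]
    have h : IsLinearMap k fun f : Module.Dual k (Q.at ℓ) =>
        f (toQ M.toMulti (R ++ y :: L) ℓ) := ⟨fun _ _ => rfl, fun _ _ => rfl⟩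
    exact IsLinearMap.sign_smul (IsLinearMap.sign_smul h
      ((ℓ.deg - 1) * (-ℓ.deg - d) + (-ℓ.deg - d)))
      ((wsum d R + wdeg d y) * (wsum d L + (-ℓ.deg - d)))

theorem isLinearMap_of_dual {V V' : Type*} [AddCommGroup V] [Module k V] [AddCommGroup V']
    [Module k V'] {g : V → V'} (h : ∀ φ : Module.Dual k V', IsLinearMap k fun x => φ (g x)) :
    IsLinearMap k g where
  map_add x y := by
    rw [← sub_eq_zero]
    refine (Module.forall_dual_apply_eq_zero_iff k _).1 fun φ => ?_
    rw [map_sub, map_add, (h φ).map_add, sub_self]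
  map_smul t x := by
    rw [← sub_eq_zero]
    refine (Module.forall_dual_apply_eq_zero_iff k _).1 fun φ => ?_
    rw [map_sub, map_smul, (h φ).map_smul, sub_self]

theorem slotLinear_of_sign {Λ : List (Elt Q ⊕ DualElt Q) → k} (n : ℤ)
    (h : SlotLinear fun l => n.negOnePow • Λ l) : SlotLinear Λ := by
  have e : Λ = fun l => n.negOnePow • n.negOnePow • Λ l := by
    funext l
    rw [sign_smul_smul, Int.negOnePow_even _ (Even.add_self n), one_smul]
  rw [e]
  exact ⟨fun L ℓ R => IsLinearMap.sign_smul (h.inl L ℓ R) n,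
    fun L ℓ R => IsLinearMap.sign_smul (h.inr L ℓ R) n⟩

theorem slotLinear_toQ (M : PreCYStructure Q d) (c : Letter O) :
    SlotLinear fun l => toQ M.toMulti l c where
  inl L ℓ R := isLinearMap_of_dual fun φ =>
    (slotLinear_of_sign _ (slotLinear_pairing M (Sum.inr ⟨c, φ⟩))).inl L ℓ R
  inr L ℓ R := isLinearMap_of_dual fun φ =>
    (slotLinear_of_sign _ (slotLinear_pairing M (Sum.inr ⟨c, φ⟩))).inr L ℓ R

theorem isLinearMap_of_apply {V W U : Type*} [AddCommGroup V] [Module k V] [AddCommGroup W]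
    [Module k W] [AddCommGroup U] [Module k U] {g : V → W →ₗ[k] U}
    (h : ∀ b, IsLinearMap k fun x => g x b) : IsLinearMap k g where
  map_add x y := LinearMap.ext fun b => (h b).map_add x y
  map_smul t x := LinearMap.ext fun b => (h b).map_smul t x

theorem slotLinear_toDual (M : PreCYStructure Q d) (q : Letter O) :
    SlotLinear fun l => toDual M.toMulti l q where
  inl L ℓ R := isLinearMap_of_apply fun b =>
    (slotLinear_of_sign _ (slotLinear_pairing M (Sum.inl ⟨q, b⟩))).inl L ℓ R
  inr L ℓ R := isLinearMap_of_apply fun b =>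
    (slotLinear_of_sign _ (slotLinear_pairing M (Sum.inl ⟨q, b⟩))).inr L ℓ R

end Slots

/-! ### Sums over splittings and decompositions of a list -/

section Sums

variable {α V : Type*} [AddCommGroup V]

/-- The sum of `F p q` over all `p ++ q = l`. -/
def splitSum : List α → (List α → List α → V) → V
  | [], F => F [] []
  | x :: l, F => F [] (x :: l) + splitSum l fun p q => F (x :: p) q

/-- The sum of `F p q` over all `p ++ q = l` with `p` nonempty. -/
def splitSum' : List α → (List α → List α → V) → V
  | [], _ => 0
  | x :: l, F => splitSum l fun p q => F (x :: p) q

/-- The sum of `F p x q` over all `p ++ x :: q = l`. -/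
def decompSum : List α → (List α → α → List α → V) → V
  | [], _ => 0
  | x :: l, F => F [] x l + decompSum l fun p y q => F (x :: p) y q

theorem splitSum_eq_sum (l : List α) (F : List α → List α → V) :
    splitSum l F = ∑ i ∈ Finset.range (l.length + 1), F (l.take i) (l.drop i) := by
  induction l generalizing F with
  | nil => simp [splitSum]
  | cons x l ih =>
    rw [splitSum, ih, List.length_cons, Finset.sum_range_succ' _ (l.length + 1)]
    simp [add_comm]

theorem splitSum_congr {l : List α} {F G : List α → List α → V}
    (h : ∀ p q, l = p ++ q → F p q = G p q) : splitSum l F = splitSum l G := by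
  rw [splitSum_eq_sum, splitSum_eq_sum]
  exact Finset.sum_congr rfl fun i _ => h _ _ (List.take_append_drop i l).symm

theorem splitSum_add (l : List α) (F G : List α → List α → V) :
    splitSum l (fun p q => F p q + G p q) = splitSum l F + splitSum l G := by
  simp only [splitSum_eq_sum, Finset.sum_add_distrib]

theorem splitSum_zero (l : List α) : splitSum l (fun _ _ => (0 : V)) = 0 := by
  simp [splitSum_eq_sum]

theorem splitSum_sign_smul (l : List α) (F : List α → List α → V) (n : ℤ) :
    splitSum l (fun p q => n.negOnePow • F p q) = n.negOnePow • splitSum l F := by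
  simp only [splitSum_eq_sum, Finset.smul_sum]

theorem splitSum_map {β : Type*} (g : β → α) (l : List β) (F : List α → List α → V) :
    splitSum (l.map g) F = splitSum l fun p q => F (p.map g) (q.map g) := by
  simp only [splitSum_eq_sum, List.length_map, List.map_take, List.map_drop]

/-- The cut at the junction is counted with the first list, which is why the second sum asks for a
nonempty prefix. -/
theorem splitSum_append (l l' : List α) (F : List α → List α → V) :
    splitSum (l ++ l') F =
      splitSum l (fun p q => F p (q ++ l')) + splitSum' l' fun p q => F (l ++ p) q := by
  induction l generalizing F with
  | nil => cases l' <;> simp [splitSum, splitSum']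
  | cons x l ih => simp [splitSum, ih, add_assoc]

theorem splitSum'_append (l l' : List α) (F : List α → List α → V) :
    splitSum' (l ++ l') F =
      splitSum' l (fun p q => F p (q ++ l')) + splitSum' l' fun p q => F (l ++ p) q := by
  cases l with
  | nil => simp [splitSum']
  | cons x l => simp [splitSum', splitSum_append]

theorem decompSum_congr {l : List α} {F G : List α → α → List α → V}
    (h : ∀ p x q, l = p ++ x :: q → F p x q = G p x q) : decompSum l F = decompSum l G := by
  induction l generalizing F G with
  | nil => rfl
  | cons x l ih =>
    rw [decompSum, decompSum, h [] x l rfl,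
      ih fun p y q e => h (x :: p) y q (by rw [e, List.cons_append])]

theorem decompSum_add (l : List α) (F G : List α → α → List α → V) :
    decompSum l (fun p x q => F p x q + G p x q) = decompSum l F + decompSum l G := by
  induction l generalizing F G with
  | nil => simp [decompSum]
  | cons x l ih => simp only [decompSum, ih]; abel

theorem decompSum_sign_smul (l : List α) (F : List α → α → List α → V) (n : ℤ) :
    decompSum l (fun p x q => n.negOnePow • F p x q) = n.negOnePow • decompSum l F := by
  induction l generalizing F with
  | nil => simp [decompSum]
  | cons x l ih => simp only [decompSum, ih, smul_add]

theorem splitSum_decompSum {β : Type*} (s : List β) (l : List α)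
    (F : List β → List β → List α → α → List α → V) :
    splitSum s (fun u v => decompSum l (F u v)) =
      decompSum l fun p x q => splitSum s fun u v => F u v p x q := by
  induction l generalizing F with
  | nil => simp [decompSum, splitSum_zero]
  | cons x l ih => simp only [decompSum, splitSum_add, ih]

theorem sum_fin_eq_decompSum {n : ℕ} {l : List α} (hn : n = l.length) (H : Fin n → V)
    (F : List α → α → List α → V)
    (h : ∀ p x q (a : Fin n), l = p ++ x :: q → a.val = p.length → H a = F p x q) :
    ∑ a, H a = decompSum l F := by
  subst hn
  induction l generalizing F with
  | nil => simp [decompSum]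
  | cons x l ih =>
    refine (Fin.sum_univ_succ H).trans ?_
    rw [decompSum, h [] x l 0 rfl rfl]
    congr 1
    refine ih _ (fun a => H a.succ) fun p y q a e ha => ?_
    exact h (x :: p) y q a.succ (by rw [e, List.cons_append])
      (by rw [Fin.val_succ, ha, List.length_cons])

/-- Positions a < b are replaced by the decompositions that they define, so that the index
arithmetic of the necklace product is done once, in the hypothesis `h`. -/
theorem sum_fin_Ioi_eq_decompSum {n : ℕ} {l : List α} (hn : n = l.length) (H : Fin n → Fin n → V)
    (F : List α → α → List α → α → List α → V)
    (h : ∀ p x m y q (a b : Fin n), l = p ++ x :: (m ++ y :: q) → a.val = p.length →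
      b.val = p.length + 1 + m.length → H a b = F p x m y q) :
    ∑ a, ∑ b ∈ Finset.Ioi a, H a b =
      decompSum l fun p x l' => decompSum l' fun m y q => F p x m y q := by
  subst hn
  induction l generalizing F with
  | nil => simp [decompSum]
  | cons x l ih =>
    refine (Fin.sum_univ_succ fun a => ∑ b ∈ Finset.Ioi a, H a b).trans ?_
    rw [decompSum]
    congr 1
    · have e : Finset.Ioi (0 : Fin (l.length + 1)) =
          (Finset.univ : Finset (Fin l.length)).map (Fin.succEmb _) := by
        ext b
        simp [Fin.exists_succ_eq]
      refine (congrArg (fun t => ∑ b ∈ t, H 0 b) e).trans ?_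
      rw [Finset.sum_map]
      refine sum_fin_eq_decompSum rfl _ _ fun m y q b e' hb => ?_
      refine h [] x m y q 0 b.succ (by rw [e', List.nil_append]) rfl ?_
      rw [Fin.val_succ, hb, List.length_nil]
      omega
    · refine Eq.trans (Finset.sum_congr rfl fun a _ => ?_)
        (ih (fun p y m y' q => F (x :: p) y m y' q) (fun a b => H a.succ b.succ)
          fun p y m y' q a b e ha hb => ?_)
      · have e : Finset.Ioi a.succ = (Finset.Ioi a).map (Fin.succEmb _) := by
          ext b
          simp only [Finset.mem_Ioi, Finset.mem_map, Fin.coe_succEmb]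
          constructor
          · intro hb
            obtain ⟨b', rfl⟩ := Fin.exists_succ_eq.2 (Fin.ne_zero_of_lt hb)
            exact ⟨b', Fin.succ_lt_succ_iff.1 hb, rfl⟩
          · rintro ⟨b', hb', rfl⟩
            exact Fin.succ_lt_succ_iff.2 hb'
        refine (congrArg (fun t => ∑ b ∈ t, H a.succ b) e).trans ?_
        rw [Finset.sum_map]
        rfl
      · exact h (x :: p) y m y' q a.succ b.succ (by rw [e, List.cons_append])
          (by rw [Fin.val_succ, ha, List.length_cons])
          (by rw [Fin.val_succ, hb, List.length_cons]; omega)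

end Sums

/-! ### Cuts of the words tfⁿ, sⁿ, …, tf¹, s¹ -/

section WordSums

variable {Q : GradedQuiver k O} {V : Type*} [AddCommGroup V]

/-- A nonempty prefix contains the leading functional, so the cut falls inside exactly one segment,
its two ends included. The prefix involves the later entries of P because `wd` reverses the order.
-/
theorem splitSum'_wd (P : List (List (Elt Q) × DualElt Q))
    (F : List (Elt Q ⊕ DualElt Q) → List (Elt Q ⊕ DualElt Q) → V) :
    splitSum' (wd P) F = decompSum P fun X₁ p X₂ => splitSum p.1 fun x y =>
      F (wd ((x, p.2) :: X₂)) (y.map Sum.inl ++ wd X₁) := by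
  induction P generalizing F with
  | nil => rfl
  | cons p P ih =>
    rw [wd, splitSum'_append, ih, decompSum, add_comm]
    congr 1
    · rw [splitSum', splitSum_map]
      simp [wd]
    · simp [wd]

/-- Two successive cuts lie in one segment or in two different ones. These are the index sets of
`innerOne` and, in the second case, of both `innerMany` and `outer`. -/
theorem splitSum'_splitSum'_wd (P : List (List (Elt Q) × DualElt Q))
    (t : List (Elt Q ⊕ DualElt Q) → List (Elt Q ⊕ DualElt Q) → List (Elt Q ⊕ DualElt Q) → V) :
    (splitSum' (wd P) fun pre R => splitSum' pre fun L mid => t L mid R) =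
      decompSum P (fun X₁ p X₂ => splitSum p.1 fun x y => splitSum x fun x₁ x₂ =>
        t (wd ((x₁, p.2) :: X₂)) (x₂.map Sum.inl) (y.map Sum.inl ++ wd X₁)) +
      decompSum P (fun X₁ p P' => decompSum P' fun Y q X₂ => splitSum p.1 fun x y =>
        splitSum q.1 fun x' y' =>
          t (wd ((x', q.2) :: X₂)) (y'.map Sum.inl ++ wd ((x, p.2) :: Y))
            (y.map Sum.inl ++ wd X₁)) := by
  rw [splitSum'_wd, ← decompSum_add]
  congr 1
  funext X₁ p X₂
  rw [← splitSum_decompSum, ← splitSum_add]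
  congr 1
  funext x y
  rw [splitSum'_wd, decompSum]
  simp [wd]

end WordSums


/-! ### Evaluation of the necklace product -/

section NecklaceEval

variable {Q : GradedQuiver k O} {d : ℤ}

/-- The object reached from `x` after the word `s`. -/
def endpt (x : O) (s : List (Elt Q)) : O := s.foldl (fun _ a => a.letter.tgt) x

/-- The element `(f₁ ⊗ ⋯ ⊗ fₙ₋₁ ⊗ id)(M(z))` of degree `c`, without sign. -/
def insQ {e : ℤ} (M : Multi Q d e) (z : List (List (Elt Q))) (fs : List (DualElt Q))
    (c : Letter O) : Elt Q :=
  ⟨c, Tens.contract Q c fs (M.toFun z (fs.map DualElt.letter ++ [c]))⟩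

/-- The functional `b ↦ (f₁ ⊗ ⋯ ⊗ fₙ)(M(L ⊔ b ⊔ R, z))`. -/
def insDual {e : ℤ} (M : Multi Q d e) (L R : List (Elt Q)) (f : DualElt Q)
    (X : List (List (Elt Q) × DualElt Q)) (c : Letter O) : DualElt Q :=
  ⟨c, mvSlot M [] L c R f X⟩

/-- The terms of `innerOne`, evaluated. -/
def neckOne (M : Multi Q d (d + 2)) (X₁ : List (List (Elt Q) × DualElt Q)) (f : DualElt Q)
    (X₂ : List (List (Elt Q) × DualElt Q)) (L y R : List (Elt Q)) : k :=
  (sumS X₁ + segDeg L).negOnePow • mv M (X₁ ++ (L ++ insQ M [y] []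
    ⟨endpt f.letter.src L, endpt f.letter.src (L ++ y), segDeg y + 2⟩ :: R, f) :: X₂)

/-- The terms of `innerMany`, evaluated. -/
def neckInner (M : Multi Q d (d + 2)) (X₁ : List (List (Elt Q) × DualElt Q)) (f : DualElt Q)
    (Y : List (List (Elt Q) × DualElt Q)) (g : DualElt Q) (X₂ : List (List (Elt Q) × DualElt Q))
    (y₁ R L yₘ : List (Elt Q)) : k :=
  (segDeg y₁ * sumS X₁ + sumS Y * (sumS X₁ + segDeg R) +
    segDeg yₘ * (sumS X₁ + segDeg R + segDeg L) + segDeg R * segDeg L +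
    (f.tdeg d + sumT d Y) + (segDeg y₁ + sumS Y + segDeg yₘ + (f.tdeg d + sumT d Y) + 1) *
    (sumS X₁ + segDeg L) + (f.tdeg d + sumT d Y) * sumT d X₁).negOnePow •
  mv M (X₁ ++ (L ++ insQ M (y₁ :: (Y.map Prod.fst ++ [yₘ])) (f :: Y.map Prod.snd)
    ⟨endpt g.letter.src L, endpt f.letter.src y₁,
      segDeg y₁ + sumS Y + segDeg yₘ + 2 + (f.tdeg d + sumT d Y)⟩ :: R, g) :: X₂)

/-- The terms of `outer`, evaluated. -/
def neckOuter (M : Multi Q d (d + 2)) (X₁ : List (List (Elt Q) × DualElt Q)) (f : DualElt Q)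
    (Y : List (List (Elt Q) × DualElt Q)) (g : DualElt Q) (X₂ : List (List (Elt Q) × DualElt Q))
    (L y y' R : List (Elt Q)) : k :=
  (segDeg y * segDeg L + segDeg y' * (segDeg L + sumS Y) +
    sumS X₂ * (segDeg L + sumS Y + segDeg R) + sumS Y * segDeg R + sumT d X₁ +
    (g.tdeg d + sumT d X₂) * (segDeg L + segDeg R + sumS Y) +
    (sumS X₁ + segDeg y + segDeg y' + sumS X₂ + 1 + sumT d X₁ + (g.tdeg d + sumT d X₂)) *
    segDeg L).negOnePow •
  mv M (X₁ ++ (y, insDual M L R f Y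
    ⟨endpt f.letter.src L, endpt g.letter.src y', sumS X₁ + segDeg y + segDeg y' + sumS X₂ + 2 +
      sumT d X₁ + (g.tdeg d + sumT d X₂)⟩) :: (y', g) :: X₂)

/-- The lists of outputs are kept as variables related by equations, so that substituting them turns
the cast into the identity. -/
theorem ev_inner_term {r w₁ u w₂ : List (Letter O)} (h : w₁ ++ (u ++ w₂) = r)
    (M : Multi Q d (d + 2)) (X₁ X₂ zG : List (List (Elt Q))) (c : Letter O) (L R : List (Elt Q))
    (fu f₁ f₂ : List (DualElt Q)) (hu : u = fu.map DualElt.letter)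
    (h₁ : w₁ = f₁.map DualElt.letter) (h₂ : w₂ = f₂.map DualElt.letter) :
    ev r (f₁ ++ (fu ++ f₂)) (Tens.cast Q h
        (Tens.substLast Q u c w₁ w₂ (M.slot X₁ L c R X₂ (w₁ ++ w₂)) (M.toFun zG (u ++ [c])))) =
      evM M (X₁ ++ (L ++ insQ M zG fu c :: R) :: X₂)
        (f₁.map DualElt.letter ++ f₂.map DualElt.letter) (f₁ ++ f₂) := by
  subst hu h₁ h₂
  rw [ev_cast, ev_substLast _ _ _ _ _ _ _ (by simp)]
  rfl

theorem ev_outer_term {r u₁ w u₂ : List (Letter O)} (h : u₁ ++ (w ++ u₂) = r)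
    (M : Multi Q d (d + 2)) (Y : List (List (Elt Q) × DualElt Q)) (f : DualElt Q)
    (X zG : List (List (Elt Q))) (c : Letter O) (L R : List (Elt Q))
    (f₁ f₂ : List (DualElt Q)) (h₁ : u₁ = f₁.map DualElt.letter)
    (hw : w = f.letter :: Y.map fun p => p.2.letter) (h₂ : u₂ = f₂.map DualElt.letter)
    (hX : X = Y.map Prod.fst) :
    ev r (f₁ ++ ((f :: Y.map Prod.snd) ++ f₂)) (Tens.cast Q h
        (Tens.substMid Q u₁ c u₂ w (M.slot [] L c R X w) (M.toFun zG (u₁ ++ c :: u₂)))) =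
      evM M zG (f₁.map DualElt.letter ++ c :: f₂.map DualElt.letter)
        (f₁ ++ insDual M L R f Y c :: f₂) := by
  subst hw h₁ h₂ hX
  rw [ev_cast, ev_substMid _ _ _ _ _ _ _ _ (by simp) (by simp)]
  rfl

theorem take_eq_of_append {α : Type*} {l p q : List α} {a : ℕ} (h : l = p ++ q)
    (ha : a = p.length) : l.take a = p := by
  subst h ha
  simp

theorem drop_eq_of_append {α : Type*} {l p q : List α} {a : ℕ} (h : l = p ++ q)
    (ha : a = p.length) : l.drop a = q := by
  subst h ha
  simp

theorem seg_of_append {P X₁ X₂ : List (List (Elt Q) × DualElt Q)}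
    {p : List (Elt Q) × DualElt Q} {a : ℕ} (hP : P = X₁ ++ p :: X₂) (ha : a = X₁.length) :
    seg (P.map Prod.fst) a = p.1 := by
  subst hP ha
  simp [seg]

theorem get_src_of_append {P X₁ X₂ : List (List (Elt Q) × DualElt Q)}
    {p : List (Elt Q) × DualElt Q}
    {a : Fin (P.map fun p : List (Elt Q) × DualElt Q => p.2.letter).length}
    (hP : P = X₁ ++ p :: X₂) (ha : a.val = X₁.length) :
    ((P.map fun p : List (Elt Q) × DualElt Q => p.2.letter).get a).src = p.2.letter.src := by
  subst hP
  simp [ha]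

theorem ev_innerOne (M : Multi Q d (d + 2)) (P : List (List (Elt Q) × DualElt Q)) :
    ev (P.map fun p => p.2.letter) (P.map Prod.snd)
        (innerOne M (P.map Prod.fst) (P.map fun p => p.2.letter)) =
      decompSum P fun X₁ p X₂ => splitSum p.1 fun x R => splitSum x fun L y =>
        neckOne M X₁ p.2 X₂ L y R := by
  rw [innerOne, map_sum]
  refine sum_fin_eq_decompSum (by simp) _ _ fun X₁ p X₂ a hP ha => ?_
  have hseg := seg_of_append hP ha
  have hsrc := get_src_of_append hP ha
  have hP' : P = (X₁ ++ [p]) ++ X₂ := by simp [hP]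
  have h₁ : (P.map Prod.fst).take a = X₁.map Prod.fst := by
    rw [← List.map_take, take_eq_of_append hP ha]
  have h₂ : (P.map Prod.fst).drop (a + 1) = X₂.map Prod.fst := by
    rw [← List.map_drop, drop_eq_of_append hP' (by simp [ha])]
  rw [map_sum, splitSum_eq_sum]
  refine Finset.sum_congr (by rw [hseg]) fun j hj => ?_
  rw [map_sum, splitSum_eq_sum]
  rw [Finset.mem_range] at hj
  have hlen : (p.1.take j).length = j := by rw [List.length_take]; omega
  refine Finset.sum_congr (by rw [hlen]) fun i hi => ?_
  rw [hlen, Finset.mem_range] at hi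
  rw [map_sign]
  change _ • evM M (_ ++ (_ ++ insQ M _ [] _ :: _) :: _) _ _ = _
  simp only [necPt, pt, hseg, hsrc, h₁, h₂]
  rw [neckOne, mv, List.take_take, Nat.min_eq_left (by omega)]
  have e : (p.1.take j).drop i = (p.1.drop i).take (j - i) := List.drop_take
  have e' : p.1.take i ++ (p.1.drop i).take (j - i) = p.1.take j := by
    rw [← List.take_add]
    congr 1
    omega
  rw [e, e', hP]
  simp only [List.map_append, List.map_cons, endpt, sumS]

theorem ev_innerMany (M : Multi Q d (d + 2)) (P : List (List (Elt Q) × DualElt Q)) :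
    ev (P.map fun p => p.2.letter) (P.map Prod.snd)
        (innerMany M (P.map Prod.fst) (P.map fun p => p.2.letter)) =
      decompSum P fun X₁ p P' => decompSum P' fun Y q X₂ => splitSum p.1 fun y₁ R =>
        splitSum q.1 fun L yₘ => neckInner M X₁ p.2 Y q.2 X₂ y₁ R L yₘ := by
  rw [innerMany, map_sum]
  simp only [map_sum (ev (P.map fun p => p.2.letter) (P.map Prod.snd)) _ (Finset.Ioi _)]
  refine sum_fin_Ioi_eq_decompSum (by simp) _ _ fun X₁ p Y q X₂ a b hP ha hb => ?_
  have hP₁ : P = (X₁ ++ [p]) ++ (Y ++ q :: X₂) := by simp [hP]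
  have hP₂ : P = (X₁ ++ p :: Y) ++ q :: X₂ := by simp [hP]
  have hP₃ : P = (X₁ ++ p :: Y ++ [q]) ++ X₂ := by simp [hP]
  have hb' : b.val = (X₁ ++ p :: Y).length := by simp [hb]; omega
  have hsega := seg_of_append hP ha
  have hsegb := seg_of_append hP₂ hb'
  have hsrca := get_src_of_append hP ha
  have hsrcb := get_src_of_append hP₂ hb'
  have hba : b.val - a.val - 1 = Y.length := by omega
  have hba' : b.val - a.val = (p :: Y).length := by rw [List.length_cons]; omega
  have h₁ : (P.map Prod.fst).take a = X₁.map Prod.fst := by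
    rw [← List.map_take, take_eq_of_append hP ha]
  have h₂ : (P.map Prod.fst).drop (b + 1) = X₂.map Prod.fst := by
    rw [← List.map_drop, drop_eq_of_append hP₃ (by simp [hb']; omega)]
  have h₃ : ((P.map Prod.fst).drop (a + 1)).take (b - a - 1) = Y.map Prod.fst := by
    rw [← List.map_drop, ← List.map_take, drop_eq_of_append hP₁ (by simp [ha]),
      take_eq_of_append rfl hba]
  have k₁ : (P.map fun p => p.2.letter).take a = (X₁.map Prod.snd).map DualElt.letter := by
    rw [← List.map_take, take_eq_of_append hP ha, List.map_map]
    rfl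
  have k₂ : ((P.map fun p => p.2.letter).drop a).take (b - a) =
      (p.2 :: Y.map Prod.snd).map DualElt.letter := by
    rw [← List.map_drop, ← List.map_take, drop_eq_of_append hP ha,
      take_eq_of_append (List.cons_append (a := p) (as := Y)).symm hba']
    rw [List.map_cons, List.map_cons, List.map_map]
    rfl
  have k₃ : ((P.map fun p => p.2.letter).drop a).drop (b - a) =
      ((q.2 :: X₂.map Prod.snd)).map DualElt.letter := by
    rw [← List.map_drop, ← List.map_drop, drop_eq_of_append hP ha,
      drop_eq_of_append (List.cons_append (a := p) (as := Y)).symm hba',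
      List.map_cons, List.map_cons, List.map_map]
    rfl
  have hfs : P.map Prod.snd =
      X₁.map Prod.snd ++ ((p.2 :: Y.map Prod.snd) ++ (q.2 :: X₂.map Prod.snd)) := by
    simp [hP]
  rw [map_sum, splitSum_eq_sum]
  refine Finset.sum_congr (by rw [hsega]) fun i hi => ?_
  rw [map_sum, splitSum_eq_sum]
  refine Finset.sum_congr (by rw [hsegb]) fun j hj => ?_
  rw [map_sign, hfs]
  refine (congrArg _ (ev_inner_term _ M _ _ _ _ _ _ _ _ _ k₂ k₁ k₃)).trans ?_
  have hu : outDeg d ((p.2 :: Y.map Prod.snd).map DualElt.letter) = -(p.2.tdeg d + sumT d Y) := by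
    have := outDeg_letters (d := d) (p :: Y)
    simpa only [List.map_cons, List.map_map, Function.comp_def, sumT_cons] using this
  have hw : outDeg d ((X₁.map Prod.snd).map DualElt.letter) = -sumT d X₁ := by
    have := outDeg_letters (d := d) X₁
    simpa only [List.map_cons, List.map_map, Function.comp_def, sumT_cons] using this
  have hY : inDeg (Y.map Prod.fst) = sumS Y := rfl
  have hX : inDeg (X₁.map Prod.fst) = sumS X₁ := rfl
  simp only [necPt, pt, hsega, hsegb, hsrca, hsrcb, h₁, h₂, h₃, k₁, k₂, hu, hw, inDeg_cons,
    inDeg_append, inDeg_nil, add_zero, hX, hY]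
  rw [neckInner, mv]
  have e : segDeg (p.1.take i) + (sumS Y + segDeg (q.1.drop j)) + 2 - -(p.2.tdeg d + sumT d Y) =
      segDeg (p.1.take i) + sumS Y + segDeg (q.1.drop j) + 2 + (p.2.tdeg d + sumT d Y) := by ring
  rw [e]
  congr 1
  · apply negOnePow_congr
    push_cast
    grind
  · simp only [List.map_append, List.map_cons, List.map_map, endpt]
    rfl

theorem ev_outer (M : Multi Q d (d + 2)) (P : List (List (Elt Q) × DualElt Q)) :
    ev (P.map fun p => p.2.letter) (P.map Prod.snd)
        (outer M (P.map Prod.fst) (P.map fun p => p.2.letter)) =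
      decompSum P fun X₁ p P' => decompSum P' fun Y q X₂ => splitSum p.1 fun L y =>
        splitSum q.1 fun y' R => neckOuter M X₁ p.2 Y q.2 X₂ L y y' R := by
  rw [outer, map_sum]
  simp only [map_sum (ev (P.map fun p => p.2.letter) (P.map Prod.snd)) _ (Finset.Ioi _)]
  refine sum_fin_Ioi_eq_decompSum (by simp) _ _ fun X₁ p Y q X₂ a b hP ha hb => ?_
  have hP₁ : P = (X₁ ++ [p]) ++ (Y ++ q :: X₂) := by simp [hP]
  have hP₂ : P = (X₁ ++ p :: Y) ++ q :: X₂ := by simp [hP]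
  have hP₃ : P = (X₁ ++ p :: Y ++ [q]) ++ X₂ := by simp [hP]
  have hb' : b.val = (X₁ ++ p :: Y).length := by simp [hb]; omega
  have hsega := seg_of_append hP ha
  have hsegb := seg_of_append hP₂ hb'
  have hsrca := get_src_of_append hP ha
  have hsrcb := get_src_of_append hP₂ hb'
  have hba : b.val - a.val - 1 = Y.length := by omega
  have hba' : b.val - a.val = (p :: Y).length := by rw [List.length_cons]; omega
  have h₁ : (P.map Prod.fst).take a = X₁.map Prod.fst := by
    rw [← List.map_take, take_eq_of_append hP ha]
  have h₂ : (P.map Prod.fst).drop (b + 1) = X₂.map Prod.fst := by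
    rw [← List.map_drop, drop_eq_of_append hP₃ (by simp [hb']; omega)]
  have h₃ : ((P.map Prod.fst).drop (a + 1)).take (b - a - 1) = Y.map Prod.fst := by
    rw [← List.map_drop, ← List.map_take, drop_eq_of_append hP₁ (by simp [ha]),
      take_eq_of_append rfl hba]
  have k₁ : (P.map fun p => p.2.letter).take a = (X₁.map Prod.snd).map DualElt.letter := by
    rw [← List.map_take, take_eq_of_append hP ha, List.map_map]
    rfl
  have k₂ : ((P.map fun p => p.2.letter).drop a).take (b - a) =
      p.2.letter :: Y.map fun p => p.2.letter := by
    rw [← List.map_drop, ← List.map_take, drop_eq_of_append hP ha,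
      take_eq_of_append (List.cons_append (a := p) (as := Y)).symm hba']
    rfl
  have k₃ : ((P.map fun p => p.2.letter).drop a).drop (b - a) =
      ((q.2 :: X₂.map Prod.snd)).map DualElt.letter := by
    rw [← List.map_drop, ← List.map_drop, drop_eq_of_append hP ha,
      drop_eq_of_append (List.cons_append (a := p) (as := Y)).symm hba',
      List.map_cons, List.map_cons, List.map_map]
    rfl
  have hfs : P.map Prod.snd =
      X₁.map Prod.snd ++ ((p.2 :: Y.map Prod.snd) ++ (q.2 :: X₂.map Prod.snd)) := by
    simp [hP]
  rw [map_sum, splitSum_eq_sum]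
  refine Finset.sum_congr (by rw [hsega]) fun i hi => ?_
  rw [map_sum, splitSum_eq_sum]
  refine Finset.sum_congr (by rw [hsegb]) fun j hj => ?_
  rw [map_sign, hfs]
  refine (congrArg _ (ev_outer_term _ M Y p.2 _ _ _ _ _ _ _ k₁ k₂ k₃ h₃)).trans ?_
  have hu : outDeg d ((X₁.map Prod.snd).map DualElt.letter) = -sumT d X₁ := by
    have := outDeg_letters (d := d) X₁
    simpa only [List.map_cons, List.map_map, Function.comp_def, sumT_cons] using this
  have hw : outDeg d ((q.2 :: X₂.map Prod.snd).map DualElt.letter) =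
      -(q.2.tdeg d + sumT d X₂) := by
    have := outDeg_letters (d := d) (q :: X₂)
    simpa only [List.map_cons, List.map_map, Function.comp_def, sumT_cons] using this
  have hY : inDeg (Y.map Prod.fst) = sumS Y := rfl
  have hX : inDeg (X₁.map Prod.fst) = sumS X₁ := rfl
  have hX₂ : inDeg (X₂.map Prod.fst) = sumS X₂ := rfl
  simp only [necPt, pt, hsega, hsegb, hsrca, hsrcb, h₁, h₂, h₃, k₁, k₃, hu, hw, inDeg_cons,
    inDeg_append, hX, hX₂, hY]
  rw [neckOuter, mv]
  have e : sumS X₁ + (segDeg (p.1.drop i) + (segDeg (q.1.take j) + sumS X₂)) + 2 - -sumT d X₁ -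
        -(q.2.tdeg d + sumT d X₂) =
      sumS X₁ + segDeg (p.1.drop i) + segDeg (q.1.take j) + sumS X₂ + 2 + sumT d X₁ +
        (q.2.tdeg d + sumT d X₂) := by ring
  rw [e]
  congr 1
  · apply negOnePow_congr
    push_cast
    grind
  · simp only [List.map_append, List.map_cons, List.map_map, endpt]
    rfl

end NecklaceEval


/-! ### The Stasheff identities with values in `Q` -/

section Stasheff

variable {Q : GradedQuiver k O} {d : ℤ}

/-- The source of a letter in `Q` or in `Q^*`. -/
def wsrc : Elt Q ⊕ DualElt Q → O
  | Sum.inl a => a.letter.src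
  | Sum.inr f => f.letter.tgt

/-- The target of a letter in `Q` or in `Q^*`. -/
def wtgt : Elt Q ⊕ DualElt Q → O
  | Sum.inl a => a.letter.tgt
  | Sum.inr f => f.letter.src

/-- The word `l` is composable, from `x` to `y`. -/
def WPath : O → List (Elt Q ⊕ DualElt Q) → O → Prop
  | x, [], y => x = y
  | x, z :: l, y => wsrc z = x ∧ WPath (wtgt z) l y

/-- The object reached from `x` after the word `l`. -/
def wpt (x : O) (l : List (Elt Q ⊕ DualElt Q)) : O := l.foldl (fun _ z => wtgt z) x

@[simp] theorem wpt_nil (x : O) : wpt x ([] : List (Elt Q ⊕ DualElt Q)) = x := rfl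

@[simp] theorem wpt_cons (x : O) (z : Elt Q ⊕ DualElt Q) (l : List (Elt Q ⊕ DualElt Q)) :
    wpt x (z :: l) = wpt (wtgt z) l := rfl

@[simp] theorem wpt_append (x : O) (l l' : List (Elt Q ⊕ DualElt Q)) :
    wpt x (l ++ l') = wpt (wpt x l) l' := by
  simp [wpt]

@[simp] theorem wpt_map_inl (x : O) (s : List (Elt Q)) : wpt x (s.map Sum.inl) = endpt x s := by
  simp [wpt, endpt, List.foldl_map, wtgt]

theorem wPath_append {x y : O} {l l' : List (Elt Q ⊕ DualElt Q)} :
    WPath x (l ++ l') y ↔ WPath x l (wpt x l) ∧ WPath (wpt x l) l' y := by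
  induction l generalizing x with
  | nil => simp [WPath]
  | cons z l ih => simp [WPath, ih, and_assoc]

theorem wPath_wpt {x y : O} {l : List (Elt Q ⊕ DualElt Q)} (h : WPath x l y) : wpt x l = y := by
  induction l generalizing x with
  | nil => exact h
  | cons z l ih => exact ih h.2

theorem wPath_map_inl {x y : O} {s : List (Elt Q)} : WPath x (s.map Sum.inl) y ↔ IsPath x s y := by
  induction s generalizing x with
  | nil => rfl
  | cons a s ih =>
    simp only [List.map_cons, WPath, IsPath, ih]
    rfl

/-- Since tf runs opposite to the output that f consumes, composability of the word is the matching
of words and outputs around the disc. -/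
theorem necklaceFrom_of_wPath {x t : O} {P : List (List (Elt Q) × DualElt Q)}
    (h : WPath x (wd P) t) :
    NecklaceFrom t (P.map Prod.fst) (P.map fun p => p.2.letter) := by
  induction P generalizing t with
  | nil => trivial
  | cons p P ih =>
    rw [wd, wPath_append] at h
    obtain ⟨h₁, h₂, h₃⟩ := h
    have h₄ : p.2.letter.tgt = wpt x (wd P) := h₂
    rw [← h₄] at h₁
    exact ⟨wPath_map_inl.1 h₃, ih h₁⟩

/-- The index of an element of `Q^*` that corresponds to the index `c` of an element of
`Q^*[d-1]`. -/
def dletter (d : ℤ) (c : Letter O) : Letter O := ⟨c.tgt, c.src, -(c.deg + (d - 1))⟩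

/-- The index of the value at the word `mid`, inserted after the word `L`. -/
def wmid (d : ℤ) (x : O) (L mid : List (Elt Q ⊕ DualElt Q)) : Letter O :=
  ⟨wpt x L, wpt (wpt x L) mid, wsum d mid + 2⟩

/-- The component of `sm(mid)` in `Q`. -/
def insA (M : Multi Q d (d + 2)) (c : Letter O) (mid : List (Elt Q ⊕ DualElt Q)) : Elt Q :=
  ⟨c, toQ M mid c⟩

/-- The component of `sm(mid)` in `Q^*`. -/
def insB (M : Multi Q d (d + 2)) (c : Letter O) (mid : List (Elt Q ⊕ DualElt Q)) : DualElt Q :=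
  ⟨dletter d c, toDual M mid (dletter d c)⟩

variable {V : Type*} [AddCommGroup V]

/-- A term of the Gerstenhaber square, for words with letters in `Q` and in `Q^*`. -/
def wterm (M : Multi Q d (d + 2)) (Λ : List (Elt Q ⊕ DualElt Q) → V) (x : O)
    (L mid R : List (Elt Q ⊕ DualElt Q)) : V :=
  (wsum d L).negOnePow • (Λ (L ++ Sum.inl (insA M (wmid d x L mid) mid) :: R) +
    Λ (L ++ Sum.inr (insB M (wmid d x L mid) mid) :: R))

/-- The Gerstenhaber square, for words with letters in `Q` and in `Q^*`. -/
def wstasheff (M : Multi Q d (d + 2)) (Λ : List (Elt Q ⊕ DualElt Q) → V) (x : O)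
    (l : List (Elt Q ⊕ DualElt Q)) : V :=
  splitSum l fun pre R => splitSum pre fun L mid => wterm M Λ x L mid R

theorem IsLinearMap.map_sign {V V' : Type*} [AddCommGroup V] [Module k V] [AddCommGroup V']
    [Module k V'] {g : V → V'} (h : IsLinearMap k g) (n : ℤ) (x : V) :
    g (n.negOnePow • x) = n.negOnePow • g x :=
  PreCY.map_sign (IsLinearMap.mk' g h) n x

/-- The leading functional of the word is the one attached to the last entry of P; pairing the rest
of the word with it closes the word up cyclically. -/
theorem pairing_of_wd (M : Multi Q d (d + 2)) {P : List (List (Elt Q) × DualElt Q)}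
    {f : DualElt Q} {l : List (Elt Q ⊕ DualElt Q)} (h : wd P = Sum.inr f :: l) :
    pairing M l (Sum.inr f) =
      ((f.letter.deg - 1) * f.tdeg d + f.tdeg d + wordSign d P + d * P.length + d).negOnePow •
        mv M P := by
  rcases List.eq_nil_or_concat' P with rfl | ⟨P, p, rfl⟩
  · simp [wd] at h
  · obtain ⟨s, g⟩ := p
    simp only [wd_append, wd, List.nil_append, List.cons_append, List.cons.injEq,
      Sum.inr.injEq] at h
    obtain ⟨rfl, rfl⟩ := h
    rw [pairing, dual_toQ, sign_smul_smul]
    congr 1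
    apply negOnePow_congr
    simp only [wordSign_append, wordSign, sumS_cons, sumS_nil, List.length_append,
      List.length_cons, List.length_nil]
    push_cast
    grind

/-- The sign that relates the Stasheff identities to the necklace product. -/
def stasheffSign (d : ℤ) (f : DualElt Q) (P : List (List (Elt Q) × DualElt Q)) : ℤ :=
  (f.letter.deg - 1) * f.tdeg d + f.tdeg d + wordSign d P + d * P.length + d + sumT d P + f.tdeg d

/-- The target of the letter tg is the source of the output that g consumes, so the base point of
the inserted subword can be read off from the block tg, s just before it. -/
theorem wmid_wd {X : List (List (Elt Q) × DualElt Q)} {s : List (Elt Q)} {g f : DualElt Q}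
    {L : List (Elt Q ⊕ DualElt Q)} (h : wd ((s, g) :: X) = Sum.inr f :: L)
    (mid : List (Elt Q ⊕ DualElt Q)) :
    wmid d f.letter.src L mid =
      ⟨endpt g.letter.src s, wpt (endpt g.letter.src s) mid, wsum d mid + 2⟩ := by
  have e : wpt f.letter.src L = endpt g.letter.src s := by
    have h₁ : wpt f.letter.src (Sum.inr f :: L) = wpt f.letter.src L := rfl
    rw [← h₁, ← h]
    simp [wd, wtgt]
  rw [wmid, e]

theorem wsum_wd_tail {X : List (List (Elt Q) × DualElt Q)} {s : List (Elt Q)} {g f : DualElt Q}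
    {L : List (Elt Q ⊕ DualElt Q)} (h : wd ((s, g) :: X) = Sum.inr f :: L) :
    wsum d L = segDeg s + sumS X + (g.tdeg d + sumT d X) - f.tdeg d := by
  have := congrArg (wsum d) h
  simp only [wsum_wd, wsum_cons, wdeg, sumS_cons, sumT_cons] at this
  linarith

theorem inner_term (M : PreCYStructure Q d) {X₂ : List (List (Elt Q) × DualElt Q)}
    {L : List (Elt Q)} {g f : DualElt Q} {L' : List (Elt Q ⊕ DualElt Q)}
    (h : wd ((L, g) :: X₂) = Sum.inr f :: L') (y : List (Elt Q))
    (Y X₁ : List (List (Elt Q) × DualElt Q)) (R : List (Elt Q)) (c : Letter O) :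
    pairing M.toMulti (L' ++ Sum.inl (insA M.toMulti c (y.map Sum.inl ++ wd Y)) ::
        (R.map Sum.inl ++ wd X₁)) (Sum.inr f) =
      (wordSign d Y + (sumT d Y + sumS Y) * segDeg y + d * Y.length + ((f.letter.deg - 1) * f.tdeg d +
        f.tdeg d + wordSign d X₁ + (sumT d X₁ + sumS X₁) *
          (segDeg L + (c.deg - 1) + segDeg R + sumS X₂) +
        (g.tdeg d + (segDeg L + (c.deg - 1) + segDeg R)) * sumS X₂ +
        wordSign d X₂ + d * (X₁.length + 1 + X₂.length) + d)).negOnePow •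
      mv M.toMulti (X₁ ++ (L ++ insQ M.toMulti (Y.map Prod.fst ++ [y]) (Y.map Prod.snd) c :: R, g)
        :: X₂) := by
  have hw : ∀ a : Elt Q, wd (X₁ ++ (L ++ a :: R, g) :: X₂) =
      Sum.inr f :: (L' ++ Sum.inl a :: (R.map Sum.inl ++ wd X₁)) := by
    intro a
    rw [← List.cons_append, ← h]
    simp [wd_append, wd]
  rw [insA, toQ_word, IsLinearMap.map_sign ((slotLinear_pairing M (Sum.inr f)).inl L' c _),
    pairing_of_wd _ (hw _), sign_smul_smul]
  congr 2
  simp only [wordSign_append, wordSign, sumS_cons, List.length_append, List.length_cons,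
    segDeg_append, segDeg_cons, Elt.sdeg]
  push_cast
  ring

/-- The inserted subword has no functional, so the Q^*-component of its value is zero and only the
composition with a disc with one output survives. -/
theorem wterm_one (M : PreCYStructure Q d) {X₁ X₂ : List (List (Elt Q) × DualElt Q)}
    {L y R : List (Elt Q)} {g f : DualElt Q} {L' : List (Elt Q ⊕ DualElt Q)}
    (h : wd ((L, g) :: X₂) = Sum.inr f :: L') :
    wterm M.toMulti (fun l => pairing M.toMulti l (Sum.inr f)) f.letter.src L' (y.map Sum.inl)
        (R.map Sum.inl ++ wd X₁) =
      (stasheffSign d f (X₁ ++ (L ++ y ++ R, g) :: X₂)).negOnePow •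
        neckOne M.toMulti X₁ g X₂ L y R := by
  have h₂ : ∀ c, pairing M.toMulti (L' ++ Sum.inr (insB M.toMulti c (y.map Sum.inl)) ::
      (R.map Sum.inl ++ wd X₁)) (Sum.inr f) = 0 := by
    intro c
    rw [insB, toDual_map_inl]
    exact ((slotLinear_pairing M (Sum.inr f)).inr L' _ _).map_zero
  have h₁ := inner_term M h y [] X₁ R
  simp only [wd, List.append_nil] at h₁
  rw [wterm, h₂, add_zero, h₁, neckOne, wmid_wd h, wsum_map_inl, wpt_map_inl, wsum_wd_tail h,
    sign_smul_smul, sign_smul_smul]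
  have e : endpt g.letter.src (L ++ y) = endpt (endpt g.letter.src L) y := by
    simp [endpt]
  rw [e]
  congr 1
  apply negOnePow_congr
  simp only [stasheffSign, wordSign_append, wordSign, sumS_cons, sumS_nil, sumT_cons, sumT_nil,
    sumT_append, List.length_append, List.length_cons, List.length_nil, segDeg_append]
  push_cast
  grind

/-- The subword becomes the disc G: its functionals consume all outputs of G but the last, and the
resulting element of Q is an input of F. -/
theorem wterm_inner (M : PreCYStructure Q d) {X₁ Y X₂ : List (List (Elt Q) × DualElt Q)}
    {y₁ R L yₘ : List (Elt Q)} {p g f : DualElt Q} {L' : List (Elt Q ⊕ DualElt Q)}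
    (h : wd ((L, g) :: X₂) = Sum.inr f :: L') :
    (wsum d L').negOnePow • pairing M.toMulti (L' ++ Sum.inl (insA M.toMulti
          (wmid d f.letter.src L' (yₘ.map Sum.inl ++ wd ((y₁, p) :: Y)))
          (yₘ.map Sum.inl ++ wd ((y₁, p) :: Y))) :: (R.map Sum.inl ++ wd X₁)) (Sum.inr f) =
      (stasheffSign d f (X₁ ++ (y₁ ++ R, p) :: (Y ++ (L ++ yₘ, g) :: X₂))).negOnePow •
        neckInner M.toMulti X₁ p Y g X₂ y₁ R L yₘ := by
  rw [inner_term M h, neckInner, wmid_wd h, wsum_wd_tail h, sign_smul_smul, sign_smul_smul]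
  have e : (⟨endpt g.letter.src L,
        wpt (endpt g.letter.src L) (yₘ.map Sum.inl ++ wd ((y₁, p) :: Y)),
        wsum d (yₘ.map Sum.inl ++ wd ((y₁, p) :: Y)) + 2⟩ : Letter O) =
      ⟨endpt g.letter.src L, endpt p.letter.src y₁,
        segDeg y₁ + sumS Y + segDeg yₘ + 2 + (p.tdeg d + sumT d Y)⟩ := by
    simp only [wsum_append, wsum_map_inl, wsum_wd, sumS_cons, sumT_cons, Letter.mk.injEq,
      true_and]
    refine ⟨by simp [wd, wtgt], by ring⟩
  rw [e]
  refine congrArg₂ (fun (n : ℤˣ) (x : k) => n • x) (negOnePow_congr ?_) rfl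
  simp only [stasheffSign, wordSign_append, wordSign, sumS_cons, sumS_append, sumT_cons,
    sumT_append, List.length_append, List.length_cons, segDeg_append]
  push_cast
  grind

/-- After the defining rotation of `toDual`, one cyclic rotation of M brings the word that contains
the free letter to the first place, as required by the outer compositions. -/
theorem toDual_word (M : PreCYStructure Q d) (R : List (Elt Q))
    (Y : List (List (Elt Q) × DualElt Q)) (f : DualElt Q) (L : List (Elt Q)) (q : Letter O) :
    toDual M.toMulti (R.map Sum.inl ++ wd ((L, f) :: Y)) q =
      ((-q.deg - d + 1) + (segDeg L + (q.deg - 1)) * (segDeg R + sumS Y + sumT d Y + f.tdeg d) +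
        ((f.letter.deg - 1) * f.tdeg d + f.tdeg d) +
        (wordSign d Y + (sumT d Y + sumS Y) * (segDeg L + (q.deg - 1) + segDeg R) + d * Y.length) +
        ((segDeg L + (q.deg - 1) + segDeg R) * sumS Y + f.tdeg d * sumT d Y)).negOnePow •
      mvSlot M.toMulti [] L q R f Y := by
  refine LinearMap.ext fun b => ?_
  have h₁ := pairing_inl M.toMulti (R.map Sum.inl ++ wd Y) f L ⟨q, b⟩
  have e₁ : R.map Sum.inl ++ wd Y ++ Sum.inr f :: L.map Sum.inl =
      R.map Sum.inl ++ wd ((L, f) :: Y) := by simp [wd]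
  have e₂ : L.map Sum.inl ++ Sum.inl ⟨q, b⟩ :: (R.map Sum.inl ++ wd Y) =
      (L ++ ⟨q, b⟩ :: R).map Sum.inl ++ wd Y := by simp
  rw [e₁, e₂] at h₁
  simp only [pairing] at h₁
  rw [dual_toQ, mv_rotate] at h₁
  rw [LinearMap.smul_apply, mvSlot_apply, List.nil_append]
  have h₂ := congrArg (fun x => (-q.deg - d + 1).negOnePow • x) h₁
  simp only [sign_smul_smul] at h₂
  rw [Int.negOnePow_even _ (Even.add_self _), one_smul] at h₂
  rw [h₂]
  congr 2
  simp only [wsum_append, wsum_map_inl, wsum_wd, segDeg_append, segDeg_cons, Elt.sdeg]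
  ring

/-- Here the subword becomes the disc F with one input left free, that is, a functional, which
consumes the connected output of G. The degree hypothesis is what identifies the degree of this
output computed from the subword with the one computed from the rest. -/
theorem wterm_outer (M : PreCYStructure Q d) {X₁ Y X₂ : List (List (Elt Q) × DualElt Q)}
    {L y y' R : List (Elt Q)} {p g f : DualElt Q} {L' : List (Elt Q ⊕ DualElt Q)}
    (h : wd ((y', g) :: X₂) = Sum.inr f :: L')
    (hd : sumS (X₁ ++ (L ++ y, p) :: (Y ++ (y' ++ R, g) :: X₂)) +
      sumT d (X₁ ++ (L ++ y, p) :: (Y ++ (y' ++ R, g) :: X₂)) = -d - 3) :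
    (wsum d L').negOnePow • pairing M.toMulti (L' ++ Sum.inr (insB M.toMulti
          (wmid d f.letter.src L' (R.map Sum.inl ++ wd ((L, p) :: Y)))
          (R.map Sum.inl ++ wd ((L, p) :: Y))) :: (y.map Sum.inl ++ wd X₁)) (Sum.inr f) =
      (stasheffSign d f (X₁ ++ (L ++ y, p) :: (Y ++ (y' ++ R, g) :: X₂))).negOnePow •
        neckOuter M.toMulti X₁ p Y g X₂ L y y' R := by
  have hw : ∀ a : DualElt Q, wd (X₁ ++ (y, a) :: (y', g) :: X₂) =
      Sum.inr f :: (L' ++ Sum.inr a :: (y.map Sum.inl ++ wd X₁)) := by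
    intro a
    rw [← List.cons_append, ← h]
    simp [wd_append, wd]
  simp only [sumS_append, sumS_cons, sumT_append, sumT_cons, segDeg_append] at hd
  have e : dletter d (wmid d f.letter.src L' (R.map Sum.inl ++ wd ((L, p) :: Y))) =
      ⟨endpt p.letter.src L, endpt g.letter.src y', sumS X₁ + segDeg y + segDeg y' + sumS X₂ + 2 +
      sumT d X₁ + (g.tdeg d + sumT d X₂)⟩ := by
    simp only [wmid_wd h, dletter, wsum_append, wsum_map_inl, wsum_wd, sumS_cons, sumT_cons,
      Letter.mk.injEq, true_and]
    refine ⟨by simp [wd, wtgt], by linarith⟩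
  rw [insB, e, toDual_word,
    IsLinearMap.map_sign ((slotLinear_pairing M (Sum.inr f)).inr L' _ _)]
  change _ • _ • pairing M.toMulti (L' ++ Sum.inr (insDual M.toMulti L R p Y _) :: _) _ = _
  rw [pairing_of_wd _ (hw _), sign_smul_smul, sign_smul_smul, neckOuter, sign_smul_smul,
    wsum_wd_tail h]
  congr 1
  apply negOnePow_congr
  have hd' := congrArg (Int.cast : ℤ → ZMod 2) hd
  simp only [stasheffSign, wordSign_append, wordSign, sumS_cons, sumS_append, sumT_cons,
    sumT_append, List.length_append, List.length_cons, segDeg_append, insDual]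
  have hp : p.letter.deg = - p.tdeg d - d := by rw [DualElt.tdeg]; ring
  simp only [hp]
  have ht : DualElt.tdeg (Q := Q) d ⟨⟨endpt p.letter.src L, endpt g.letter.src y', sumS X₁ + segDeg y + segDeg y' + sumS X₂ + 2 +
      sumT d X₁ + (g.tdeg d + sumT d X₂)⟩, mvSlot M.toMulti [] L _ R p Y⟩ = -(sumS X₁ + segDeg y + segDeg y' + sumS X₂ + 2 +
      sumT d X₁ + (g.tdeg d + sumT d X₂)) - d := rfl
  simp only [ht]
  clear ht e hw hp hd
  push_cast at hd' ⊢
  have s1 := zmod_two_sq (p.tdeg d)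
  have s2 := zmod_two_sq (segDeg L)
  have s3 := zmod_two_sq (segDeg R)
  have s4 := zmod_two_sq d
  generalize ((p.tdeg d : ℤ) : ZMod 2) = tp at *
  generalize ((g.tdeg d : ℤ) : ZMod 2) = tg at *
  generalize ((f.tdeg d : ℤ) : ZMod 2) = tf at *
  generalize ((f.letter.deg : ℤ) : ZMod 2) = df at *
  generalize ((d : ℤ) : ZMod 2) = d' at *
  generalize ((segDeg L : ℤ) : ZMod 2) = l at *
  generalize ((segDeg R : ℤ) : ZMod 2) = r at *
  generalize ((segDeg y : ℤ) : ZMod 2) = a at *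
  generalize ((segDeg y' : ℤ) : ZMod 2) = a' at *
  generalize ((sumS X₁ : ℤ) : ZMod 2) = x1 at *
  generalize ((sumS X₂ : ℤ) : ZMod 2) = x2 at *
  generalize ((sumS Y : ℤ) : ZMod 2) = yy at *
  generalize ((sumT d X₁ : ℤ) : ZMod 2) = t1 at *
  generalize ((sumT d X₂ : ℤ) : ZMod 2) = t2 at *
  generalize ((sumT d Y : ℤ) : ZMod 2) = ty at *
  generalize ((wordSign d X₁ : ℤ) : ZMod 2) = w1 at *
  generalize ((wordSign d X₂ : ℤ) : ZMod 2) = w2 at *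
  generalize ((wordSign d Y : ℤ) : ZMod 2) = wy at *
  generalize ((X₁.length : ℕ) : ZMod 2) = n1 at *
  generalize ((X₂.length : ℕ) : ZMod 2) = n2 at *
  generalize ((Y.length : ℕ) : ZMod 2) = ny at *
  have hx : x1 = d' + 1 + l + a + yy + a' + r + x2 + t1 + tp + ty + tg + t2 := by grind
  subst hx
  have s5 := zmod_two_sq ty
  have s6 := zmod_two_sq yy
  have s7 := zmod_two_sq a
  have s8 := zmod_two_sq a'
  grind

end Stasheff


/-! ### Vanishing of the Stasheff expressions on Q ⊕ Q^* -/

section StasheffVanishing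

variable {Q : GradedQuiver k O} {d : ℤ}

theorem ev_necklaceSq (M : Multi Q d (d + 2)) (P : List (List (Elt Q) × DualElt Q)) :
    ev (P.map fun p => p.2.letter) (P.map Prod.snd)
        (necklaceSq M (P.map Prod.fst) (P.map fun p => p.2.letter)) =
      (decompSum P fun X₁ p X₂ => splitSum p.1 fun x y => splitSum x fun x₁ x₂ =>
        neckOne M X₁ p.2 X₂ x₁ x₂ y) +
      decompSum P fun X₁ p P' => decompSum P' fun Y q X₂ => splitSum p.1 fun x y =>
        splitSum q.1 fun x' y' =>
          neckInner M X₁ p.2 Y q.2 X₂ x y x' y' + neckOuter M X₁ p.2 Y q.2 X₂ x y x' y' := by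
  rw [necklaceSq, map_add, map_add, ev_innerOne, ev_innerMany, ev_outer, add_assoc]
  simp only [splitSum_add, decompSum_add]

theorem isNecklace_of_wPath {s : List (Elt Q)} {P : List (List (Elt Q) × DualElt Q)}
    {f : DualElt Q} (h : WPath f.letter.src (s.map Sum.inl ++ wd P) f.letter.tgt) :
    IsNecklace ((P ++ [(s, f)]).map Prod.fst) ((P ++ [(s, f)]).map fun p => p.2.letter) := by
  refine ⟨by simp, ?_⟩
  have e : (((P ++ [(s, f)]).map fun p : List (Elt Q) × DualElt Q => p.2.letter).getLast
      (by simp)).tgt = f.letter.tgt := by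
    simp
  rw [e]
  refine necklaceFrom_of_wPath (x := f.letter.tgt) ?_
  rw [wd_append]
  exact ⟨rfl, h⟩

/-- Term by term, the paired Stasheff sum is a common sign times the evaluated necklace square,
which the Maurer–Cartan equation annihilates. The degree -d - 3 is that of a nonzero pairing, -d -
2, lowered by the degree of the one inserted sm. -/
theorem wstasheff_inr (M : PreCYStructure Q d) (l : List (Elt Q ⊕ DualElt Q)) (f : DualElt Q)
    (hl : WPath f.letter.src l f.letter.tgt) (hd : wsum d l + f.tdeg d = -d - 3) :
    wstasheff M.toMulti (fun l => pairing M.toMulti l (Sum.inr f)) f.letter.src l = 0 := by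
  obtain ⟨s, P₀, rfl⟩ := exists_word l
  have hn := isNecklace_of_wPath hl
  have hP : wd (P₀ ++ [(s, f)]) = Sum.inr f :: (s.map Sum.inl ++ wd P₀) := by
    simp [wd_append, wd]
  have hd' : sumS (P₀ ++ [(s, f)]) + sumT d (P₀ ++ [(s, f)]) = -d - 3 := by
    simp only [wsum_append, wsum_map_inl, wsum_wd] at hd
    simp only [sumS_append, sumS_cons, sumS_nil, sumT_append, sumT_cons, sumT_nil]
    linarith
  generalize P₀ ++ [(s, f)] = P at *
  -- The paired functional is put in front of the word, which then has the form `wd P`. Prefixes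
  -- become nonempty, and `L.tail` removes the added letter again.
  have e : wstasheff M.toMulti (fun l => pairing M.toMulti l (Sum.inr f)) f.letter.src
        (s.map Sum.inl ++ wd P₀) =
      splitSum' (wd P) fun pre R => splitSum' pre fun L mid =>
        wterm M.toMulti (fun l => pairing M.toMulti l (Sum.inr f)) f.letter.src L.tail mid R := by
    rw [hP]
    rfl
  have htail : ∀ L R, wd P = L ++ R → L ≠ [] → L = Sum.inr f :: L.tail := by
    intro L R h hL
    rw [hP] at h
    cases L with
    | nil => exact absurd rfl hL
    | cons x L =>
      rw [List.cons_append, List.cons.injEq] at h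
      rw [← h.1, List.tail_cons]
  have hm := congrArg (ev (P.map fun p => p.2.letter) (P.map Prod.snd)) (M.maurerCartan _ _ hn)
  rw [map_zero, ev_necklaceSq] at hm
  rw [e, splitSum'_splitSum'_wd]
  refine Eq.trans ?_ ((congrArg ((stasheffSign d f P).negOnePow • ·) hm).trans (smul_zero _))
  rw [smul_add, ← decompSum_sign_smul, ← decompSum_sign_smul]
  congr 1
  · refine decompSum_congr fun X₁ p X₂ h => ?_
    rw [← splitSum_sign_smul]
    refine splitSum_congr fun x y hxy => ?_
    rw [← splitSum_sign_smul]
    refine splitSum_congr fun x₁ x₂ hx => ?_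
    have hw := htail (wd ((x₁, p.2) :: X₂)) (x₂.map Sum.inl ++ y.map Sum.inl ++ wd X₁)
      (by rw [h, wd_append, wd, wd, hxy, hx]; simp) (by simp [wd])
    rw [wterm_one M hw, h]
    congr 4
    rw [← hx, ← hxy]
  · refine decompSum_congr fun X₁ p P' h => ?_
    rw [← decompSum_sign_smul]
    refine decompSum_congr fun Y q X₂ h' => ?_
    rw [← splitSum_sign_smul]
    refine splitSum_congr fun x y hxy => ?_
    rw [← splitSum_sign_smul]
    refine splitSum_congr fun x' y' hxy' => ?_
    have hw := htail (wd ((x', q.2) :: X₂))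
      (y'.map Sum.inl ++ wd Y ++ wd [p] ++ wd X₁)
      (by rw [h, h', wd_append, wd, wd_append, wd, wd, hxy']; simp [wd]) (by simp [wd])
    have hP' : P = X₁ ++ (x ++ y, p.2) :: (Y ++ (x' ++ y', q.2) :: X₂) := by
      rw [h, h', ← hxy, ← hxy']
    rw [hP'] at hd'
    rw [wterm, smul_add, smul_add, wterm_inner M hw, wterm_outer M hw hd', ← hP']

theorem wdeg_insA (M : Multi Q d (d + 2)) (x : O) (L mid : List (Elt Q ⊕ DualElt Q)) :
    wdeg d (Sum.inl (insA M (wmid d x L mid) mid)) = wsum d mid + 1 := by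
  simp only [wdeg, Elt.sdeg, insA, wmid]
  ring

theorem wdeg_insB (M : Multi Q d (d + 2)) (x : O) (L mid : List (Elt Q ⊕ DualElt Q)) :
    wdeg d (Sum.inr (insB M (wmid d x L mid) mid)) = wsum d mid + 1 := by
  simp only [wdeg, DualElt.tdeg, insB, dletter, wmid]
  ring

theorem toDual_nil (M : Multi Q d (d + 2)) (q : Letter O) : toDual M [] q = 0 := rfl

theorem wterm_nil (M : PreCYStructure Q d) (x : O) (L R : List (Elt Q ⊕ DualElt Q))
    (y : Elt Q ⊕ DualElt Q) :
    wterm M.toMulti (fun l => pairing M.toMulti l y) x L [] R = 0 := by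
  rw [wterm, insA, insB, toQ_nil, toDual_nil]
  rw [((slotLinear_pairing M y).inl L _ R).map_zero, ((slotLinear_pairing M y).inr L _ R).map_zero,
    add_zero, smul_zero]

/-- Graded antisymmetry of Γ on the values sm(w) and sm(v): the Q-component of each is paired with
the Q^*-component of the other, so the two summands are exchanged. -/
theorem pairing_ins_swap (M : PreCYStructure Q d) (v w : List (Elt Q ⊕ DualElt Q)) (p q : O)
    (h : wsum d v + wsum d w = -d - 3) :
    pairing M.toMulti w (Sum.inl (insA M.toMulti ⟨p, q, wsum d v + 2⟩ v)) +
        pairing M.toMulti w (Sum.inr (insB M.toMulti ⟨p, q, wsum d v + 2⟩ v)) =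
      ((wsum d v + 1) * (wsum d w + 1) + 1).negOnePow •
        (pairing M.toMulti v (Sum.inl (insA M.toMulti ⟨q, p, wsum d w + 2⟩ w)) +
          pairing M.toMulti v (Sum.inr (insB M.toMulti ⟨q, p, wsum d w + 2⟩ w))) := by
  -- The total degree -d - 3 makes the component of sm(v) in Q^* dual to exactly the component of Q
  -- in which sm(w) lies, and conversely.
  have e₁ : dletter d (⟨p, q, wsum d v + 2⟩ : Letter O) = ⟨q, p, wsum d w + 2⟩ := by
    simp only [dletter, Letter.mk.injEq, true_and]
    linarith
  have e₂ : dletter d (⟨q, p, wsum d w + 2⟩ : Letter O) = ⟨p, q, wsum d v + 2⟩ := by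
    simp only [dletter, Letter.mk.injEq, true_and]
    linarith
  rw [insB, insB, e₁, e₂]
  simp only [pairing, insA, DualElt.tdeg]
  rw [smul_add, sign_smul_smul, sign_smul_smul, add_comm (_ • _) (_ • _)]
  have h' := congrArg (Int.cast : ℤ → ZMod 2) h
  push_cast at h'
  have s1 := zmod_two_sq (wsum d v)
  have s2 := zmod_two_sq (wsum d w)
  have s3 := zmod_two_sq d
  congr 2
  · apply negOnePow_congr
    push_cast
    clear h e₁ e₂
    generalize ((wsum d v : ℤ) : ZMod 2) = a at *
    generalize ((wsum d w : ℤ) : ZMod 2) = b at *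
    generalize ((d : ℤ) : ZMod 2) = d' at *
    have : d' = a + b + 1 := by grind
    subst this
    grind
  · apply negOnePow_congr
    push_cast
    clear h e₁ e₂
    generalize ((wsum d v : ℤ) : ZMod 2) = a at *
    generalize ((wsum d w : ℤ) : ZMod 2) = b at *
    generalize ((d : ℤ) : ZMod 2) = d' at *
    have : d' = a + b + 1 := by grind
    subst this
    grind

/-- When the last letter is outside the inserted subword, rotation moves x and y around the
insertion, whose degree |mid| + 1 accounts for the sign. -/
theorem wterm_rotate (M : PreCYStructure Q d) (L mid R : List (Elt Q ⊕ DualElt Q))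
    (y x : Elt Q ⊕ DualElt Q) :
    wterm M.toMulti (fun l => pairing M.toMulti l x) (wtgt x) L mid (R ++ [y]) =
      (wdeg d x * (wsum d (L ++ (mid ++ R)) + wdeg d y)).negOnePow •
        wterm M.toMulti (fun l => pairing M.toMulti l y) (wtgt y) (x :: L) mid R := by
  have e : wmid d (wtgt y) (x :: L) mid = wmid d (wtgt x) L mid := rfl
  rw [wterm, wterm, e]
  simp only [← List.cons_append, ← List.append_assoc]
  rw [pairing_rotate, pairing_rotate]
  simp only [wsum_append, wsum_cons, wdeg_insA, wdeg_insB, smul_add, sign_smul_smul,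
    List.cons_append]
  congr 2
  · apply negOnePow_congr
    push_cast
    grind
  · apply negOnePow_congr
    push_cast
    grind

/-- When the inserted subword ends with y, the expression is a pairing of two values of sm.
Exchanging them makes the complementary word `x :: L` the inserted one, at the start of a word
paired with y. -/
theorem wterm_rotate_last (M : PreCYStructure Q d) (L mid : List (Elt Q ⊕ DualElt Q))
    (y x : Elt Q ⊕ DualElt Q) (h : wsum d L + wsum d mid + wdeg d y + wdeg d x = -d - 3) :
    wterm M.toMulti (fun l => pairing M.toMulti l x) (wtgt x) L (mid ++ [y]) [] =
      (wdeg d x * (wsum d (L ++ mid) + wdeg d y)).negOnePow •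
        wterm M.toMulti (fun l => pairing M.toMulti l y) (wtgt y) [] (x :: L) mid := by
  have hs := pairing_ins_swap M (mid ++ [y]) (x :: L) (wpt (wtgt x) L) (wtgt y)
    (by simp only [wsum_append, wsum_cons, wsum_nil]; linarith)
  have e₁ : wmid d (wtgt x) L (mid ++ [y]) =
      ⟨wpt (wtgt x) L, wtgt y, wsum d (mid ++ [y]) + 2⟩ := by simp [wmid]
  have e₂ : wmid d (wtgt y) [] (x :: L) = ⟨wtgt y, wpt (wtgt x) L, wsum d (x :: L) + 2⟩ := rfl
  have d₁ := wdeg_insA M.toMulti (wtgt x) L (mid ++ [y])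
  have d₂ := wdeg_insB M.toMulti (wtgt x) L (mid ++ [y])
  have d₃ := wdeg_insA M.toMulti (wtgt y) [] (x :: L)
  have d₄ := wdeg_insB M.toMulti (wtgt y) [] (x :: L)
  rw [e₁] at d₁ d₂
  rw [e₂] at d₃ d₄
  rw [wterm, wterm, e₁, e₂, pairing_rotate, pairing_rotate, d₁, d₂, ← smul_add, hs, pairing_rotate,
    pairing_rotate, d₃, d₄, ← smul_add]
  simp only [sign_smul_smul, List.nil_append]
  congr 1
  apply negOnePow_congr
  simp only [wsum_append, wsum_cons, wsum_nil]
  push_cast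
  have s1 := zmod_two_sq (wsum d L)
  have s2 := zmod_two_sq (wsum d mid)
  have s3 := zmod_two_sq (wdeg d x)
  have s4 := zmod_two_sq (wdeg d y)
  grind

/-- The insertions on the left avoid y or end with y; on the right they avoid x or begin with x.
Rotation matches the two families in this order. -/
theorem wstasheff_rotate (M : PreCYStructure Q d) (l : List (Elt Q ⊕ DualElt Q))
    (y x : Elt Q ⊕ DualElt Q) (h : wsum d l + wdeg d y + wdeg d x = -d - 3) :
    wstasheff M.toMulti (fun l => pairing M.toMulti l x) (wtgt x) (l ++ [y]) =
      (wdeg d x * (wsum d l + wdeg d y)).negOnePow •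
        wstasheff M.toMulti (fun l => pairing M.toMulti l y) (wtgt y) (x :: l) := by
  have h₁ : wstasheff M.toMulti (fun l => pairing M.toMulti l x) (wtgt x) (l ++ [y]) =
      (splitSum l fun p q => splitSum p fun L mid =>
        wterm M.toMulti (fun l => pairing M.toMulti l x) (wtgt x) L mid (q ++ [y])) +
      splitSum l fun L mid =>
        wterm M.toMulti (fun l => pairing M.toMulti l x) (wtgt x) L (mid ++ [y]) [] := by
    rw [wstasheff, splitSum_append]
    simp only [splitSum', splitSum, splitSum_append, wterm_nil, add_zero]
  have h₂ : wstasheff M.toMulti (fun l => pairing M.toMulti l y) (wtgt y) (x :: l) =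
      (splitSum l fun p q => splitSum p fun L mid =>
        wterm M.toMulti (fun l => pairing M.toMulti l y) (wtgt y) (x :: L) mid q) +
      splitSum l fun L mid =>
        wterm M.toMulti (fun l => pairing M.toMulti l y) (wtgt y) [] (x :: L) mid := by
    rw [wstasheff]
    simp only [splitSum, wterm_nil, zero_add]
    rw [splitSum_add, add_comm]
  rw [h₁, h₂, smul_add, ← splitSum_sign_smul, ← splitSum_sign_smul]
  congr 1
  · refine splitSum_congr fun p q hpq => ?_
    rw [← splitSum_sign_smul]
    refine splitSum_congr fun L mid hp => ?_
    rw [wterm_rotate, hpq, hp, List.append_assoc]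
  · refine splitSum_congr fun L mid hl => ?_
    rw [wterm_rotate_last, hl]
    rw [hl, wsum_append] at h
    exact h

theorem wstasheff_map_inl (M : PreCYStructure Q d) (s : List (Elt Q)) (b : Elt Q) (x : O) :
    wstasheff M.toMulti (fun l => pairing M.toMulti l (Sum.inl b)) x (s.map Sum.inl) = 0 := by
  rw [wstasheff, splitSum_map]
  simp only [splitSum_map]
  rw [← splitSum_zero s]
  congr 1
  funext p q
  rw [← splitSum_zero p]
  congr 1
  funext L mid
  have h₁ := pairing_map_inl M.toMulti
    (L ++ insA M.toMulti (wmid d x (L.map Sum.inl) (mid.map Sum.inl)) (mid.map Sum.inl) :: q) b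
  rw [List.map_append, List.map_cons] at h₁
  rw [wterm, h₁, insB, toDual_map_inl,
    ((slotLinear_pairing M (Sum.inl b)).inr (L.map Sum.inl) _ (q.map Sum.inl)).map_zero, add_zero,
    smul_zero]

/-- Rotate from the right until the paired letter is a functional. The letters of Q met on the way
accumulate in s; if no functional is ever met, the whole word is in Q and `toDual` vanishes on it.
-/
theorem wstasheff_inl (M : PreCYStructure Q d) (l : List (Elt Q ⊕ DualElt Q)) (s : List (Elt Q))
    (b : Elt Q) (hl : WPath b.letter.tgt (s.map Sum.inl ++ l) b.letter.src)
    (hd : wsum d (s.map Sum.inl ++ l) + b.sdeg = -d - 3) :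
    wstasheff M.toMulti (fun l => pairing M.toMulti l (Sum.inl b)) b.letter.tgt
      (s.map Sum.inl ++ l) = 0 := by
  induction l using List.reverseRecOn generalizing s b with
  | nil => rw [List.append_nil, wstasheff_map_inl]
  | append_singleton l y ih =>
    rw [← List.append_assoc] at hl hd ⊢
    have hr := wstasheff_rotate M (s.map Sum.inl ++ l) y (Sum.inl b)
      (by rw [← hd]; simp only [wsum_append, wsum_cons, wsum_nil, wdeg]; ring)
    refine hr.trans ?_
    rw [wPath_append] at hl
    obtain ⟨hl₁, hl₂, hl₃⟩ := hl
    have hp : WPath (wtgt y) (Sum.inl b :: (s.map Sum.inl ++ l)) (wsrc y) := by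
      rw [← hl₂] at hl₁
      exact ⟨hl₃.symm, hl₁⟩
    have hd' : wsum d (Sum.inl b :: (s.map Sum.inl ++ l)) + wdeg d y = -d - 3 := by
      rw [← hd]
      simp only [wsum_append, wsum_cons, wsum_nil, wdeg]
      ring
    rw [sign_smul_eq_zero]
    cases y with
    | inr f => exact wstasheff_inr M _ f hp hd'
    | inl a => exact ih (b :: s) a hp hd'

/-- The Stasheff identities, paired with a letter. -/
theorem wstasheff_pairing (M : PreCYStructure Q d) (l : List (Elt Q ⊕ DualElt Q))
    (y : Elt Q ⊕ DualElt Q) (hl : WPath (wtgt y) l (wsrc y)) :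
    wstasheff M.toMulti (fun l => pairing M.toMulti l y) (wtgt y) l = 0 := by
  by_cases hd : wsum d l + wdeg d y = -d - 3
  · cases y with
    | inr f => exact wstasheff_inr M l f hl hd
    | inl b => exact wstasheff_inl M l [] b hl hd
  -- In any other total degree every single term is zero, since an insertion raises the degree of
  -- the word by one.
  · rw [wstasheff, ← splitSum_zero l]
    refine splitSum_congr fun p q hpq => ?_
    rw [← splitSum_zero p]
    refine splitSum_congr fun L mid hp => ?_
    have key : ∀ z, wdeg d z = wsum d mid + 1 → pairing M.toMulti (L ++ z :: q) y = 0 := by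
      intro z hz
      by_contra h
      have h₁ := pairing_degree _ h
      apply hd
      rw [hpq, hp]
      simp only [wsum_append, wsum_cons, hz] at h₁ ⊢
      linarith
    rw [wterm, key _ (wdeg_insA _ _ _ _), key _ (wdeg_insB _ _ _ _), add_zero, smul_zero]

theorem map_splitSum {α V V' : Type*} [AddCommGroup V] [AddCommGroup V'] [Module k V] [Module k V']
    (g : V →ₗ[k] V') (l : List α) (F : List α → List α → V) :
    g (splitSum l F) = splitSum l fun p q => g (F p q) := by
  simp only [splitSum_eq_sum, map_sum]

theorem map_wstasheff {V V' : Type*} [AddCommGroup V] [AddCommGroup V'] [Module k V] [Module k V']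
    (g : V →ₗ[k] V') (M : Multi Q d (d + 2)) (Λ : List (Elt Q ⊕ DualElt Q) → V) (x : O)
    (l : List (Elt Q ⊕ DualElt Q)) :
    g (wstasheff M Λ x l) = wstasheff M (fun l => g (Λ l)) x l := by
  simp only [wstasheff, map_splitSum, wterm, map_sign, map_add]

theorem wstasheff_sign_smul {V : Type*} [AddCommGroup V] (n : ℤ) (M : Multi Q d (d + 2))
    (Λ : List (Elt Q ⊕ DualElt Q) → V) (x : O) (l : List (Elt Q ⊕ DualElt Q)) :
    wstasheff M (fun l => n.negOnePow • Λ l) x l = n.negOnePow • wstasheff M Λ x l := by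
  simp only [wstasheff, wterm, ← splitSum_sign_smul, smul_add, sign_smul_smul, add_comm n]

/-- Functionals on a vector space separate its points, and pairing with one is, up to sign, applying
it. -/
theorem wstasheff_toQ (M : PreCYStructure Q d) (l : List (Elt Q ⊕ DualElt Q)) (c : Letter O)
    (hl : WPath c.src l c.tgt) :
    wstasheff M.toMulti (fun l => toQ M.toMulti l c) c.src l = 0 := by
  refine (Module.forall_dual_apply_eq_zero_iff k _).1 fun φ => ?_
  have h := wstasheff_pairing M l (Sum.inr ⟨c, φ⟩) hl
  simp only [pairing] at h
  rw [wstasheff_sign_smul, sign_smul_eq_zero] at h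
  rw [map_wstasheff]
  exact h

theorem wstasheff_toDual (M : PreCYStructure Q d) (l : List (Elt Q ⊕ DualElt Q)) (q : Letter O)
    (hl : WPath q.tgt l q.src) :
    wstasheff M.toMulti (fun l => toDual M.toMulti l q) q.tgt l = 0 := by
  refine LinearMap.ext fun b => ?_
  have h := wstasheff_pairing M l (Sum.inl ⟨q, b⟩) hl
  simp only [pairing] at h
  rw [wstasheff_sign_smul, sign_smul_eq_zero] at h
  have h' := map_wstasheff (LinearMap.applyₗ b : Module.Dual k (Q.at q) →ₗ[k] k) M.toMulti
    (fun l => toDual M.toMulti l q) q.tgt l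
  exact h'.trans h

end StasheffVanishing


/-! ### Sums over sections -/

section Sections

variable {H W V : Type*} [AddCommGroup V]

/-- The sum of the values of `F` at all the words obtained from `l` by replacing each letter `h`
by `α h` or by `β h`. -/
def secSum (α β : H → W) : List H → (List W → V) → V
  | [], F => F []
  | h :: l, F => secSum α β l (fun l' => F (α h :: l')) + secSum α β l fun l' => F (β h :: l')

/-- The word `l'` is obtained from `l` by replacing each letter `h` by `α h` or by `β h`. -/
def IsSection (α β : H → W) (l : List H) (l' : List W) : Prop :=
  List.Forall₂ (fun h w => w = α h ∨ w = β h) l l'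

variable {α β : H → W}

theorem sum_sections (α β : H → W) (l : List H) (F : List W → V) :
    ((l.map fun h => [α h, β h]).sections.map F).sum = secSum α β l F := by
  induction l generalizing F with
  | nil => simp [secSum]
  | cons h l ih =>
    rw [secSum, ← ih, ← ih, List.map_cons, List.sections]
    rw [← List.sum_map_add]
    generalize (l.map fun h => [α h, β h]).sections = S
    induction S with
    | nil => simp
    | cons s S ihS =>
      rw [List.flatMap_cons, List.map_append, List.sum_append, ihS]
      simp

theorem secSum_congr {l : List H} {F G : List W → V}
    (h : ∀ l', IsSection α β l l' → F l' = G l') : secSum α β l F = secSum α β l G := by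
  induction l generalizing F G with
  | nil => exact h [] List.Forall₂.nil
  | cons x l ih =>
    rw [secSum, secSum, ih fun l' hl' => h _ (List.Forall₂.cons (Or.inl rfl) hl'),
      ih fun l' hl' => h _ (List.Forall₂.cons (Or.inr rfl) hl')]

theorem secSum_add (l : List H) (F G : List W → V) :
    secSum α β l (fun l' => F l' + G l') = secSum α β l F + secSum α β l G := by
  induction l generalizing F G with
  | nil => rfl
  | cons x l ih => simp only [secSum, ih]; abel

theorem secSum_zero (l : List H) : secSum α β l (fun _ => (0 : V)) = 0 := by
  induction l with
  | nil => rfl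
  | cons x l ih => simp only [secSum, ih, add_zero]

theorem secSum_eq_zero {l : List H} {F : List W → V}
    (h : ∀ l', IsSection α β l l' → F l' = 0) : secSum α β l F = 0 :=
  (secSum_congr h).trans (secSum_zero l)

theorem secSum_sign_smul (l : List H) (F : List W → V) (n : ℤ) :
    secSum α β l (fun l' => n.negOnePow • F l') = n.negOnePow • secSum α β l F := by
  induction l generalizing F with
  | nil => rfl
  | cons x l ih => simp only [secSum, ih, smul_add]

theorem secSum_append (l₁ l₂ : List H) (F : List W → V) :
    secSum α β (l₁ ++ l₂) F =
      secSum α β l₁ fun p => secSum α β l₂ fun q => F (p ++ q) := by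
  induction l₁ generalizing F with
  | nil => rfl
  | cons x l ih => simp only [List.cons_append, secSum, ih]

theorem secSum_map {W' : Type*} (g : W → W') (l : List H) (F : List W' → V) :
    secSum (g ∘ α) (g ∘ β) l F = secSum α β l fun l' => F (l'.map g) := by
  induction l generalizing F with
  | nil => rfl
  | cons x l ih => simp only [secSum, ih, List.map_cons, Function.comp]

theorem secSum_comm (l₁ l₂ : List H) (F : List W → List W → V) :
    (secSum α β l₁ fun p => secSum α β l₂ fun q => F p q) =
      secSum α β l₂ fun q => secSum α β l₁ fun p => F p q := by
  induction l₁ generalizing F with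
  | nil => rfl
  | cons x l ih => simp only [secSum, ih, secSum_add]

theorem secSum_splitSum_comm {γ : Type*} (l : List H) (s : List γ)
    (F : List W → List γ → List γ → V) :
    (secSum α β l fun l' => splitSum s (F l')) =
      splitSum s fun p q => secSum α β l fun l' => F l' p q := by
  induction s generalizing F with
  | nil => rfl
  | cons x s ih => simp only [splitSum, secSum_add, ih]

/-- Cutting a word commutes with choosing a component of every letter, so the expansion can be
carried out separately on each piece of a Stasheff term. -/
theorem secSum_splitSum (l : List H) (F : List W → List W → V) :
    (secSum α β l fun l' => splitSum l' F) =
      splitSum l fun p q => secSum α β p fun p' => secSum α β q fun q' => F p' q' := by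
  induction l generalizing F with
  | nil => rfl
  | cons x l ih =>
    simp only [splitSum, secSum, secSum_add, ih, splitSum_add]
    abel

theorem map_secSum [Module k V] {V' : Type*} [AddCommGroup V'] [Module k V'] (g : V →ₗ[k] V')
    (l : List H) (F : List W → V) : g (secSum α β l F) = secSum α β l fun l' => g (F l') := by
  induction l generalizing F with
  | nil => rfl
  | cons x l ih => simp only [secSum, map_add, ih]

theorem IsLinearMap.map_secSum [Module k V] {V' : Type*} [AddCommGroup V'] [Module k V']
    {g : V → V'} (hg : IsLinearMap k g) (l : List H) (F : List W → V) :
    g (secSum α β l F) = secSum α β l fun l' => g (F l') :=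
  PreCY.map_secSum (IsLinearMap.mk' g hg) l F

theorem isLinearMap_secSum [Module k V] {U : Type*} [AddCommGroup U] [Module k U] (l : List H)
    {F : U → List W → V} (h : ∀ l', IsLinearMap k fun x => F x l') :
    IsLinearMap k fun x => secSum α β l (F x) where
  map_add x y := by
    rw [← secSum_add]
    congr 1
    funext l'
    exact (h l').map_add x y
  map_smul t x := by
    have := PreCY.map_secSum (α := α) (β := β) (LinearMap.lsmul k V t) l (F x)
    refine Eq.trans ?_ this.symm
    congr 1
    funext l'
    exact (h l').map_smul t x

end Sections

/-! ### Strict morphisms -/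

section Strict

variable {A : GradedQuiver k O} {B : GradedQuiver k O'} {d : ℤ}

/-- Letters in `A` or in `B^*`, the objects being those of `A`. -/
abbrev MixedLetter (Φ : QuiverHom A B) :=
  Elt A ⊕ (Σ ℓ : Letter O, Module.Dual k (B.at (ℓ.map Φ.obj)))

variable (Φ : QuiverHom A B)

/-- The functional `Φ^*(f)`. -/
def dualA (f : Σ ℓ : Letter O, Module.Dual k (B.at (ℓ.map Φ.obj))) : DualElt A :=
  ⟨f.1, f.2 ∘ₗ Φ.map f.1.src f.1.tgt f.1.deg⟩

/-- The functional `f` on `B`. -/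
def dualB (f : Σ ℓ : Letter O, Module.Dual k (B.at (ℓ.map Φ.obj))) : DualElt B :=
  ⟨f.1.map Φ.obj, f.2⟩

/-- The letter in `A` or in `A^*`. -/
def letterA : MixedLetter Φ → Elt A ⊕ DualElt A := Sum.map id (dualA Φ)

/-- The letter in `B` or in `B^*`. -/
def letterB : MixedLetter Φ → Elt B ⊕ DualElt B := Sum.map Φ.elt (dualB Φ)

/-- This is the definition of Φ^* extended to tensors; the functionals live over images of objects
of A, so that both evaluations have the same index list. -/
theorem ev_tens (fs : List (Σ ℓ : Letter O, Module.Dual k (B.at (ℓ.map Φ.obj))))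
    (x : Tens A (fs.map Sigma.fst)) :
    ev ((fs.map Sigma.fst).map (Letter.map Φ.obj)) (fs.map (dualB Φ))
        (Φ.tens (fs.map Sigma.fst) x) =
      ev (fs.map Sigma.fst) (fs.map (dualA Φ)) x := by
  induction fs with
  | nil => rfl
  | cons f fs ih =>
    refine Tens.cons_induction (ℓ := f.1) (r := fs.map Sigma.fst)
      (p := fun x => ev (f.1.map Φ.obj :: (fs.map Sigma.fst).map (Letter.map Φ.obj))
        (dualB Φ f :: fs.map (dualB Φ)) (Φ.tens (f.1 :: fs.map Sigma.fst) x) =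
        ev (f.1 :: fs.map Sigma.fst) (dualA Φ f :: fs.map (dualA Φ)) x) x ?_ ?_ ?_
    · rw [map_zero, map_zero, map_zero]
    · intro a y
      have e : Φ.tens (f.1 :: fs.map Sigma.fst) ((Tens.consEquiv A f.1 _).symm (a ⊗ₜ y)) =
          (Tens.consEquiv B (f.1.map Φ.obj) _).symm
            (Φ.map f.1.src f.1.tgt f.1.deg a ⊗ₜ Φ.tens (fs.map Sigma.fst) y) := rfl
      rw [e, ev_cons, ev_cons, ih, dualA, dualB, ev1_self, ev1_self]
      rfl
    · intro x y hx hy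
      rw [map_add, map_add, map_add, hx, hy]

/-- The pairs of a word of `A` and a functional on `A`. -/
def pairA (p : List (Elt A) × (Σ ℓ : Letter O, Module.Dual k (B.at (ℓ.map Φ.obj)))) :
    List (Elt A) × DualElt A :=
  (p.1, dualA Φ p.2)

/-- The pairs of a word of `B` and a functional on `B`. -/
def pairB (p : List (Elt A) × (Σ ℓ : Letter O, Module.Dual k (B.at (ℓ.map Φ.obj)))) :
    List (Elt B) × DualElt B :=
  (p.1.map Φ.elt, dualB Φ p.2)

theorem segDeg_map_elt (s : List (Elt A)) : segDeg (s.map Φ.elt) = segDeg s := by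
  induction s with
  | nil => rfl
  | cons a s ih => simp [ih, QuiverHom.elt, Elt.sdeg]

theorem tdeg_dualB (f : Σ ℓ : Letter O, Module.Dual k (B.at (ℓ.map Φ.obj))) :
    (dualB Φ f).tdeg d = (dualA Φ f).tdeg d := rfl

variable {Φ}

theorem sumS_pairB (P : List (List (Elt A) × (Σ ℓ : Letter O, Module.Dual k (B.at (ℓ.map Φ.obj))))) :
    sumS (P.map (pairB Φ)) = sumS (P.map (pairA Φ)) := by
  induction P with
  | nil => rfl
  | cons p P ih => simp [ih, pairA, pairB, segDeg_map_elt]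

theorem sumT_pairB (P : List (List (Elt A) × (Σ ℓ : Letter O, Module.Dual k (B.at (ℓ.map Φ.obj))))) :
    sumT d (P.map (pairB Φ)) = sumT d (P.map (pairA Φ)) := by
  induction P with
  | nil => rfl
  | cons p P ih => simp [ih, pairA, pairB, tdeg_dualB]

theorem wordSign_pairB
    (P : List (List (Elt A) × (Σ ℓ : Letter O, Module.Dual k (B.at (ℓ.map Φ.obj))))) :
    wordSign d (P.map (pairB Φ)) = wordSign d (P.map (pairA Φ)) := by
  induction P with
  | nil => rfl
  | cons p P ih =>
    simp [wordSign, ih, sumS_pairB, pairA, pairB, tdeg_dualB, segDeg_map_elt]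

/-- Strictness of Φ after evaluation: the outputs of M_A are pushed to B by Φ, or equivalently the
functionals are pulled back to A. -/
theorem mv_strict {MA : PreCYStructure A d} {MB : PreCYStructure B d} (hΦ : Φ.IsStrict MA MB)
    (P : List (List (Elt A) × (Σ ℓ : Letter O, Module.Dual k (B.at (ℓ.map Φ.obj)))))
    (hP : IsNecklace ((P.map (pairA Φ)).map Prod.fst)
      ((P.map (pairA Φ)).map fun p => p.2.letter)) :
    mv MB.toMulti (P.map (pairB Φ)) = mv MA.toMulti (P.map (pairA Φ)) := by
  have h := hΦ _ _ hP
  have e₁ : (P.map (pairA Φ)).map (fun p => p.2.letter) = (P.map Prod.snd).map Sigma.fst := by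
    simp [pairA, dualA]
  have e₂ : (P.map (pairA Φ)).map Prod.snd = (P.map Prod.snd).map (dualA Φ) := by
    simp [pairA]
  have e₃ : (P.map (pairB Φ)).map (fun p => p.2.letter) =
      ((P.map Prod.snd).map Sigma.fst).map (Letter.map Φ.obj) := by
    simp [pairB, dualB]
  have e₄ : (P.map (pairB Φ)).map Prod.snd = (P.map Prod.snd).map (dualB Φ) := by
    simp [pairB]
  have e₅ : (P.map (pairB Φ)).map Prod.fst =
      ((P.map (pairA Φ)).map Prod.fst).map (List.map Φ.elt) := by
    simp [pairA, pairB]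
  rw [mv, mv, e₁, e₂, e₃, e₄, e₅, evM, evM, ← ev_tens]
  rw [e₁] at h
  rw [h]

theorem exists_mixed_word (l : List (MixedLetter Φ)) :
    ∃ (s : List (Elt A))
      (P : List (List (Elt A) × (Σ ℓ : Letter O, Module.Dual k (B.at (ℓ.map Φ.obj))))),
      l.map (letterA Φ) = s.map Sum.inl ++ wd (P.map (pairA Φ)) ∧
      l.map (letterB Φ) = (s.map Φ.elt).map Sum.inl ++ wd (P.map (pairB Φ)) := by
  induction l with
  | nil => exact ⟨[], [], rfl, rfl⟩
  | cons x l ih =>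
    obtain ⟨s, P, h₁, h₂⟩ := ih
    cases x with
    | inl a =>
      exact ⟨a :: s, P, by rw [List.map_cons, h₁]; rfl, by rw [List.map_cons, h₂]; rfl⟩
    | inr f =>
      refine ⟨[], P ++ [(s, f)], ?_, ?_⟩
      · rw [List.map_cons, h₁]; simp [wd_append, wd, pairA, letterA]
      · rw [List.map_cons, h₂]; simp [wd_append, wd, pairB, letterB]

theorem mixed_word_cases (l : List (MixedLetter Φ)) :
    (∃ s : List (Elt A), l = s.map Sum.inl) ∨
      ∃ (l₀ : List (MixedLetter Φ)) (f : Σ ℓ : Letter O, Module.Dual k (B.at (ℓ.map Φ.obj)))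
        (s : List (Elt A)), l = l₀ ++ Sum.inr f :: s.map Sum.inl := by
  induction l with
  | nil => exact Or.inl ⟨[], rfl⟩
  | cons x l ih =>
    rcases ih with ⟨s, rfl⟩ | ⟨l₀, f, s, rfl⟩
    · cases x with
      | inl a => exact Or.inl ⟨a :: s, rfl⟩
      | inr f => exact Or.inr ⟨[], f, s, rfl⟩
    · exact Or.inr ⟨x :: l₀, f, s, rfl⟩

variable {MA : PreCYStructure A d} {MB : PreCYStructure B d}

theorem toQ_strict_apply (hΦ : Φ.IsStrict MA MB) (l : List (MixedLetter Φ))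
    (f : Σ ℓ : Letter O, Module.Dual k (B.at (ℓ.map Φ.obj)))
    (hl : WPath f.1.src (l.map (letterA Φ)) f.1.tgt) :
    (dualB Φ f).val (toQ MB.toMulti (l.map (letterB Φ)) (dualB Φ f).letter) =
      (dualA Φ f).val (toQ MA.toMulti (l.map (letterA Φ)) (dualA Φ f).letter) := by
  obtain ⟨s, P, h₁, h₂⟩ := exists_mixed_word l
  rw [h₁] at hl ⊢
  rw [h₂, dual_toQ, dual_toQ]
  have hn := isNecklace_of_wPath (f := dualA Φ f) hl
  have hm := mv_strict hΦ (P ++ [(s, f)]) (by rw [List.map_append]; exact hn)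
  rw [List.map_append, List.map_append] at hm
  rw [wordSign_pairB, sumS_pairB, sumT_pairB, segDeg_map_elt, List.length_map, List.length_map]
  exact congrArg _ hm

theorem toQ_strict (hΦ : Φ.IsStrict MA MB) (l : List (MixedLetter Φ)) (c : Letter O)
    (hl : WPath c.src (l.map (letterA Φ)) c.tgt) :
    Φ.map c.src c.tgt c.deg (toQ MA.toMulti (l.map (letterA Φ)) c) =
      toQ MB.toMulti (l.map (letterB Φ)) (c.map Φ.obj) := by
  rw [← sub_eq_zero]
  refine (Module.forall_dual_apply_eq_zero_iff k _).1 fun φ => ?_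
  rw [map_sub, sub_eq_zero]
  exact (toQ_strict_apply hΦ l ⟨c, φ⟩ hl).symm

theorem wsum_letterB (l : List (MixedLetter Φ)) :
    wsum d (l.map (letterB Φ)) = wsum d (l.map (letterA Φ)) := by
  induction l with
  | nil => rfl
  | cons x l ih =>
    simp only [List.map_cons, wsum_cons, ih]
    cases x <;> rfl

/-- If the word contains a functional, the definition of `toDual` makes the last one the paired
letter, and the statement becomes `toQ_strict_apply`. Otherwise both sides are zero. -/
theorem toDual_strict (hΦ : Φ.IsStrict MA MB) (l : List (MixedLetter Φ)) (q : Letter O)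
    (hl : WPath q.tgt (l.map (letterA Φ)) q.src) :
    toDual MB.toMulti (l.map (letterB Φ)) (q.map Φ.obj) ∘ₗ Φ.map q.src q.tgt q.deg =
      toDual MA.toMulti (l.map (letterA Φ)) q := by
  refine LinearMap.ext fun b => ?_
  have key : pairing MB.toMulti (l.map (letterB Φ)) (Sum.inl (Φ.elt ⟨q, b⟩)) =
      pairing MA.toMulti (l.map (letterA Φ)) (Sum.inl ⟨q, b⟩) := by
    rcases mixed_word_cases l with ⟨s, rfl⟩ | ⟨l₀, f, s, rfl⟩
    · have e₁ : (s.map Sum.inl : List (MixedLetter Φ)).map (letterA Φ) = s.map Sum.inl := by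
        simp [letterA]
      have e₂ : (s.map Sum.inl : List (MixedLetter Φ)).map (letterB Φ) =
          (s.map Φ.elt).map Sum.inl := by
        simp [letterB]
      rw [e₁, e₂, pairing_map_inl, pairing_map_inl]
    · have e₁ : (l₀ ++ Sum.inr f :: s.map Sum.inl).map (letterA Φ) =
          l₀.map (letterA Φ) ++ Sum.inr (dualA Φ f) :: s.map Sum.inl := by
        simp [letterA]
      have e₂ : (l₀ ++ Sum.inr f :: s.map Sum.inl).map (letterB Φ) =
          l₀.map (letterB Φ) ++ Sum.inr (dualB Φ f) :: (s.map Φ.elt).map Sum.inl := by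
        simp [letterB]
      rw [e₁] at hl
      rw [e₁, e₂, pairing_inl, pairing_inl, wsum_letterB, segDeg_map_elt]
      have e₃ : (s.map Sum.inl ++ Sum.inl ⟨q, b⟩ :: l₀ : List (MixedLetter Φ)).map (letterA Φ) =
          s.map Sum.inl ++ Sum.inl ⟨q, b⟩ :: l₀.map (letterA Φ) := by
        simp [letterA]
      have e₄ : (s.map Sum.inl ++ Sum.inl ⟨q, b⟩ :: l₀ : List (MixedLetter Φ)).map (letterB Φ) =
          (s.map Φ.elt).map Sum.inl ++ Sum.inl (Φ.elt ⟨q, b⟩) :: l₀.map (letterB Φ) := by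
        simp [letterB]
      -- Strictness is only given on composable tuples: the rotated word is composable because the
      -- original one closes up with the letter b.
      have hs := toQ_strict_apply hΦ (s.map Sum.inl ++ Sum.inl ⟨q, b⟩ :: l₀) f (by
        rw [wPath_append] at hl
        obtain ⟨h₁, h₂, h₃⟩ := hl
        have h₄ := wPath_wpt h₃
        rw [e₃, wPath_append]
        have h₅ : f.1.tgt = wpt q.tgt (l₀.map (letterA Φ)) := h₂
        change wpt f.1.src _ = _ at h₄
        rw [h₄]
        refine ⟨h₃, rfl, ?_⟩
        rw [h₅]
        exact h₁)
      rw [e₃, e₄] at hs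
      rw [pairing, hs]
      rfl
  simp only [pairing] at key
  have h₂ := congrArg (fun x => (-q.deg - d + 1).negOnePow • x) key
  simp only [QuiverHom.elt, sign_smul_smul] at h₂
  rw [Int.negOnePow_even _ (Even.add_self _), one_smul, one_smul] at h₂
  exact h₂

end Strict


/-! ### Splitting the letters of a quiver into letters of `Q` and of `Q^*` -/

section Splitting

variable {P : GradedQuiver k O} {Q : GradedQuiver k O'} {d : ℤ}

theorem isPath_append {x y : O} {l l' : List (Elt P)} :
    IsPath x (l ++ l') y ↔ IsPath x l (endpt x l) ∧ IsPath (endpt x l) l' y := by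
  induction l generalizing x with
  | nil => simp [IsPath, endpt]
  | cons a l ih =>
    simp only [List.cons_append, IsPath, ih, and_assoc]
    rfl

theorem endpt_append (x : O) (l l' : List (Elt P)) :
    endpt x (l ++ l') = endpt (endpt x l) l' := by
  simp [endpt]

/-- The maps `α` and `β` send the homogeneous elements of `P` to elements of `Q` and of `Q^*[d-1]`
of the same degree, the objects being mapped by `ψ`. -/
structure IsSplitting (d : ℤ) (ψ : O → O') (α : Elt P → Elt Q) (β : Elt P → DualElt Q) : Prop where
  letter_inl : ∀ h, (α h).letter = h.letter.map ψ
  letter_inr : ∀ h, (β h).letter = dletter d (h.letter.map ψ)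

variable {ψ : O → O'} {α : Elt P → Elt Q} {β : Elt P → DualElt Q}

namespace IsSplitting

theorem wsum_eq (hs : IsSplitting d ψ α β) {l : List (Elt P)} {l' : List (Elt Q ⊕ DualElt Q)}
    (h : IsSection (Sum.inl ∘ α) (Sum.inr ∘ β) l l') : wsum d l' = segDeg l := by
  induction h with
  | nil => rfl
  | @cons a x _ _ hx _ ih =>
    rw [wsum_cons, segDeg_cons, ih]
    congr 1
    rcases hx with rfl | rfl
    · simp only [Function.comp, wdeg, Elt.sdeg, hs.letter_inl]
    · simp only [Function.comp, wdeg, Elt.sdeg, DualElt.tdeg, hs.letter_inr, dletter]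
      ring

theorem wpt_eq (hs : IsSplitting d ψ α β) {l : List (Elt P)} {l' : List (Elt Q ⊕ DualElt Q)}
    (h : IsSection (Sum.inl ∘ α) (Sum.inr ∘ β) l l') (x : O) : wpt (ψ x) l' = ψ (endpt x l) := by
  induction h generalizing x with
  | nil => rfl
  | @cons a y l l' hx _ ih =>
    have e : wtgt y = ψ a.letter.tgt := by
      rcases hx with rfl | rfl
      · simp only [Function.comp, wtgt, hs.letter_inl]
      · simp only [Function.comp, wtgt, hs.letter_inr, dletter]
    rw [wpt_cons, e, ih]
    rfl

theorem wPath (hs : IsSplitting d ψ α β) {l : List (Elt P)} {l' : List (Elt Q ⊕ DualElt Q)}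
    (h : IsSection (Sum.inl ∘ α) (Sum.inr ∘ β) l l') {x y : O} (hl : IsPath x l y) :
    WPath (ψ x) l' (ψ y) := by
  induction h generalizing x with
  | nil => exact congrArg ψ hl
  | @cons a z l l' hx _ ih =>
    obtain ⟨rfl, hl⟩ := hl
    have e : wtgt z = ψ a.letter.tgt := by
      rcases hx with rfl | rfl
      · simp only [Function.comp, wtgt, hs.letter_inl]
      · simp only [Function.comp, wtgt, hs.letter_inr, dletter]
    have e' : wsrc z = ψ a.letter.src := by
      rcases hx with rfl | rfl
      · simp only [Function.comp, wsrc, hs.letter_inl]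
      · simp only [Function.comp, wsrc, hs.letter_inr, dletter]
    refine ⟨e', ?_⟩
    rw [e]
    exact ih hl

end IsSplitting

variable {V : Type*} [AddCommGroup V] [Module k V]

theorem wterm_nil_of_slotLinear (M : PreCYStructure Q d) {Λ : List (Elt Q ⊕ DualElt Q) → V}
    (hΛ : SlotLinear Λ) (x : O') (L R : List (Elt Q ⊕ DualElt Q)) :
    wterm M.toMulti Λ x L [] R = 0 := by
  rw [wterm, insA, insB, toQ_nil, toDual_nil]
  rw [(hΛ.inl L _ R).map_zero, (hΛ.inr L _ R).map_zero, add_zero, smul_zero]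

theorem isLinearMap_secSum_slot {Λ : List (Elt Q ⊕ DualElt Q) → V} (hΛ : SlotLinear Λ)
    (l₁ l₂ : List (Elt P)) {ℓ : Letter O} {ℓ₁ ℓ₂ : Letter O'} (f : P.at ℓ →ₗ[k] Q.at ℓ₁)
    (g : P.at ℓ →ₗ[k] Module.Dual k (Q.at ℓ₂)) (hα : ∀ v, α ⟨ℓ, v⟩ = ⟨ℓ₁, f v⟩)
    (hβ : ∀ v, β ⟨ℓ, v⟩ = ⟨ℓ₂, g v⟩) :
    IsLinearMap k fun v : P.at ℓ =>
      secSum (Sum.inl ∘ α) (Sum.inr ∘ β) (l₁ ++ ⟨ℓ, v⟩ :: l₂) Λ := by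
  simp only [secSum_append, secSum, Function.comp, hα, hβ]
  refine isLinearMap_secSum l₁ fun p => ?_
  have h₁ := isLinearMap_secSum (α := Sum.inl ∘ α) (β := Sum.inr ∘ β) l₂ fun q =>
    (IsLinearMap.mk' _ (hΛ.inl p ℓ₁ q) ∘ₗ f).isLinear
  have h₂ := isLinearMap_secSum (α := Sum.inl ∘ α) (β := Sum.inr ∘ β) l₂ fun q =>
    (IsLinearMap.mk' _ (hΛ.inr p ℓ₂ q) ∘ₗ g).isLinear
  exact (IsLinearMap.mk' _ h₁ + IsLinearMap.mk' _ h₂).isLinear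

/-- The hypotheses `hα` and `hβ` say that splitting a value of m gives the values of `toQ` and
`toDual` on the split word. Linearity of Λ in the inserted slot then lets the expansion of the
subword be pulled out. -/
theorem secSum_insert (hs : IsSplitting d ψ α β) {m : Op P} {M : PreCYStructure Q d}
    (hα : ∀ l c, IsPath c.src l c.tgt → α ⟨c, m l c⟩ =
      ⟨c.map ψ, secSum (Sum.inl ∘ α) (Sum.inr ∘ β) l fun l' => toQ M.toMulti l' (c.map ψ)⟩)
    (hβ : ∀ l c, IsPath c.src l c.tgt → β ⟨c, m l c⟩ =
      ⟨dletter d (c.map ψ), secSum (Sum.inl ∘ α) (Sum.inr ∘ β) l fun l' =>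
        toDual M.toMulti l' (dletter d (c.map ψ))⟩)
    {Λ : List (Elt Q ⊕ DualElt Q) → V} (hΛ : SlotLinear Λ) (x : O) (L mid R : List (Elt P))
    (c : Letter O) (hc : c = ⟨endpt x L, endpt x (L ++ mid), segDeg mid + 2⟩)
    (hm : IsPath c.src mid c.tgt) :
    (segDeg L).negOnePow •
        secSum (Sum.inl ∘ α) (Sum.inr ∘ β) (L ++ ⟨c, m mid c⟩ :: R) Λ =
      secSum (Sum.inl ∘ α) (Sum.inr ∘ β) L fun L' =>
        secSum (Sum.inl ∘ α) (Sum.inr ∘ β) mid fun mid' =>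
          secSum (Sum.inl ∘ α) (Sum.inr ∘ β) R fun R' =>
            wterm M.toMulti Λ (ψ x) L' mid' R' := by
  rw [secSum_append, ← secSum_sign_smul]
  refine secSum_congr fun L' hL => ?_
  rw [secSum_comm, secSum, ← secSum_add, ← secSum_sign_smul]
  refine secSum_congr fun R' _ => ?_
  have h₁ := IsLinearMap.map_secSum (α := Sum.inl ∘ α) (β := Sum.inr ∘ β)
    (hΛ.inl L' (c.map ψ) R') mid fun l' => toQ M.toMulti l' (c.map ψ)
  have h₂ := IsLinearMap.map_secSum (α := Sum.inl ∘ α) (β := Sum.inr ∘ β)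
    (hΛ.inr L' (dletter d (c.map ψ)) R') mid fun l' =>
      toDual M.toMulti l' (dletter d (c.map ψ))
  simp only [Function.comp] at h₁ h₂ ⊢
  have hα' := hα mid c hm
  have hβ' := hβ mid c hm
  rw [hα', hβ', h₁, h₂, ← secSum_add, ← secSum_sign_smul]
  refine secSum_congr fun mid' hmid => ?_
  have e : wmid d (ψ x) L' mid' = c.map ψ := by
    rw [wmid, hs.wpt_eq hL, hs.wpt_eq hmid, hs.wsum_eq hmid, hc, endpt_append]
  rw [wterm, e, hs.wsum_eq hL]
  rfl

theorem midLetter_eq (x : O) (l : List (Elt P)) {i j : ℕ} (hij : i ≤ j) :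
    midLetter x l i j = ⟨endpt x (l.take i), endpt x (l.take i ++ (l.drop i).take (j - i)),
      segDeg ((l.drop i).take (j - i)) + 2⟩ := by
  have e : l.take i ++ (l.drop i).take (j - i) = l.take j := by
    rw [← List.take_add]
    congr 1
    omega
  rw [e]
  rfl

theorem isPath_mid {x y : O} {l : List (Elt P)} (hl : IsPath x l y) {i j : ℕ} (hij : i ≤ j) :
    IsPath (midLetter x l i j).src ((l.drop i).take (j - i)) (midLetter x l i j).tgt := by
  rw [midLetter_eq x l hij]
  have e : l = l.take i ++ ((l.drop i).take (j - i) ++ (l.drop i).drop (j - i)) := by simp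
  rw [e, isPath_append, isPath_append] at hl
  rw [endpt_append]
  exact hl.2.1

theorem isPath_insert {x y : O} {l : List (Elt P)} (hl : IsPath x l y) {i j : ℕ} (hij : i ≤ j)
    (v : P.at (midLetter x l i j)) :
    IsPath x (l.take i ++ ⟨midLetter x l i j, v⟩ :: l.drop j) y := by
  have e : l = l.take i ++ ((l.drop i).take (j - i) ++ l.drop j) := by
    have : l.drop j = (l.drop i).drop (j - i) := by
      rw [List.drop_drop]
      congr 1
      omega
    rw [this, List.take_append_drop, List.take_append_drop]
  have h := hl
  rw [e, isPath_append, isPath_append] at h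
  rw [isPath_append]
  refine ⟨h.1, rfl, ?_⟩
  have h₂ := congrArg Letter.tgt (midLetter_eq x l hij)
  dsimp only at h₂
  rw [h₂, endpt_append]
  exact h.2.2

/-- Both components of the mixed Stasheff identity are instances of this: once with the letters sent
to A and A^*, once with the letters sent to B and B^*. -/
theorem sum_secSum_insert (hs : IsSplitting d ψ α β) {m : Op P} {M : PreCYStructure Q d}
    (hα : ∀ l c, IsPath c.src l c.tgt → α ⟨c, m l c⟩ =
      ⟨c.map ψ, secSum (Sum.inl ∘ α) (Sum.inr ∘ β) l fun l' => toQ M.toMulti l' (c.map ψ)⟩)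
    (hβ : ∀ l c, IsPath c.src l c.tgt → β ⟨c, m l c⟩ =
      ⟨dletter d (c.map ψ), secSum (Sum.inl ∘ α) (Sum.inr ∘ β) l fun l' =>
        toDual M.toMulti l' (dletter d (c.map ψ))⟩)
    {Λ : List (Elt Q ⊕ DualElt Q) → V} (hΛ : SlotLinear Λ) {x y : O} {l : List (Elt P)}
    (hl : IsPath x l y) :
    (∑ j ∈ Finset.range (l.length + 1), ∑ i ∈ Finset.range j, (segDeg (l.take i)).negOnePow •
        secSum (Sum.inl ∘ α) (Sum.inr ∘ β) (l.take i ++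
          ⟨midLetter x l i j, m ((l.drop i).take (j - i)) (midLetter x l i j)⟩ :: l.drop j) Λ) =
      secSum (Sum.inl ∘ α) (Sum.inr ∘ β) l fun l' => wstasheff M.toMulti Λ (ψ x) l' := by
  simp only [wstasheff]
  rw [secSum_splitSum]
  simp only [secSum_splitSum_comm]
  simp only [secSum_splitSum]
  rw [splitSum_eq_sum]
  refine Finset.sum_congr rfl fun j hj => ?_
  rw [Finset.mem_range] at hj
  have hlen : (l.take j).length = j := by rw [List.length_take]; omega
  -- The sum over all cuts also contains the empty subword i = j, absent from the Gerstenhaber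
  -- product; its term is split off and vanishes.
  rw [splitSum_eq_sum, hlen, Finset.sum_range_succ]
  have h₀ : (l.take j).drop j = [] := by simp
  simp only [h₀, secSum, wterm_nil_of_slotLinear M hΛ, secSum_zero, add_zero]
  refine Finset.sum_congr rfl fun i hi => ?_
  rw [Finset.mem_range] at hi
  rw [List.take_take, Nat.min_eq_left hi.le, List.drop_take]
  exact secSum_insert hs hα hβ hΛ x _ _ _ _ (midLetter_eq x l hi.le) (isPath_mid hl hi.le)

end Splitting


/-! ### The words of the mixed quiver -/

section MixedWords

theorem IsSection.map {H W W' : Type*} {α β : H → W} (g : W → W') {l : List H} {l' : List W}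
    (h : IsSection α β l l') : IsSection (g ∘ α) (g ∘ β) l (l'.map g) := by
  induction h with
  | nil => exact List.Forall₂.nil
  | cons hx _ ih =>
    refine List.Forall₂.cons ?_ ih
    rcases hx with rfl | rfl
    · exact Or.inl rfl
    · exact Or.inr rfl

variable {A : GradedQuiver k O} {B : GradedQuiver k O'} {d : ℤ} (Φ : QuiverHom A B)

theorem isSplitting_left : IsSplitting d id (partA (d := d) Φ) (pullB Φ) :=
  ⟨fun _ => rfl, fun _ => rfl⟩

theorem isSplitting_right :
    IsSplitting d Φ.obj (fun h => Φ.elt (partA (d := d) Φ h)) (partB Φ) :=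
  ⟨fun _ => rfl, fun _ => rfl⟩

/-- The sum over the words with letters in `A` and `A^*`. -/
abbrev sumA {V : Type*} [AddCommGroup V] (l : List (Elt (mixedQuiver A B Φ.obj d)))
    (F : List (Elt A ⊕ DualElt A) → V) : V :=
  secSum (Sum.inl ∘ partA Φ) (Sum.inr ∘ pullB Φ) l F

/-- The sum over the words with letters in `B` and `B^*`. -/
abbrev sumB {V : Type*} [AddCommGroup V] (l : List (Elt (mixedQuiver A B Φ.obj d)))
    (F : List (Elt B ⊕ DualElt B) → V) : V :=
  secSum (Sum.inl ∘ fun h => Φ.elt (partA Φ h)) (Sum.inr ∘ partB Φ) l F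

/-- The component in `A`, as a mixed letter. -/
def mixA (h : Elt (mixedQuiver A B Φ.obj d)) : MixedLetter Φ := Sum.inl (partA Φ h)

/-- The component in `B^*`, as a mixed letter. -/
def mixB (h : Elt (mixedQuiver A B Φ.obj d)) : MixedLetter Φ :=
  Sum.inr ⟨dletter d h.letter, h.val.2⟩

theorem sumA_eq {V : Type*} [AddCommGroup V] (l : List (Elt (mixedQuiver A B Φ.obj d)))
    (F : List (Elt A ⊕ DualElt A) → V) :
    sumA Φ l F = secSum (mixA Φ) (mixB Φ) l fun l' => F (l'.map (letterA Φ)) :=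
  secSum_map (α := mixA Φ) (β := mixB Φ) (letterA Φ) l F

theorem sumB_eq {V : Type*} [AddCommGroup V] (l : List (Elt (mixedQuiver A B Φ.obj d)))
    (F : List (Elt B ⊕ DualElt B) → V) :
    sumB Φ l F = secSum (mixA Φ) (mixB Φ) l fun l' => F (l'.map (letterB Φ)) :=
  secSum_map (α := mixA Φ) (β := mixB Φ) (letterB Φ) l F

theorem wPath_letterA {l : List (Elt (mixedQuiver A B Φ.obj d))} {l' : List (MixedLetter Φ)}
    (h : IsSection (mixA Φ) (mixB Φ) l l') {x y : O} (hl : IsPath x l y) :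
    WPath x (l'.map (letterA Φ)) y :=
  (isSplitting_left Φ).wPath (IsSection.map (letterA Φ) h) hl

variable (MA : PreCYStructure A d) (MB : PreCYStructure B d)

theorem mixedOp_of_isPath {l : List (Elt (mixedQuiver A B Φ.obj d))} {c : Letter O}
    (hl : IsPath c.src l c.tgt) :
    mixedOp Φ MA MB l c =
      (sumA Φ l fun l' => toQ MA.toMulti l' c,
       sumB Φ l fun l' => toDual MB.toMulti l' (dletter d (c.map Φ.obj))) :=
  (if_pos hl).trans <| Prod.ext (sum_sections (Sum.inl ∘ partA Φ) (Sum.inr ∘ pullB Φ) l _)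
    (sum_sections (Sum.inl ∘ fun h => Φ.elt (partA Φ h)) (Sum.inr ∘ partB Φ) l _)

theorem mixedOp_of_not_isPath {l : List (Elt (mixedQuiver A B Φ.obj d))} {c : Letter O}
    (hl : ¬ IsPath c.src l c.tgt) : mixedOp Φ MA MB l c = 0 :=
  if_neg hl

variable {Φ MA MB}

theorem map_sumA_toQ (hΦ : Φ.IsStrict MA MB) {l : List (Elt (mixedQuiver A B Φ.obj d))}
    {c : Letter O} (hl : IsPath c.src l c.tgt) :
    Φ.map c.src c.tgt c.deg (sumA Φ l fun l' => toQ MA.toMulti l' c) =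
      sumB Φ l fun l' => toQ MB.toMulti l' (c.map Φ.obj) := by
  rw [sumA_eq, sumB_eq, map_secSum]
  exact secSum_congr fun l' h => toQ_strict hΦ l' c (wPath_letterA Φ h hl)

theorem sumB_toDual_comp (hΦ : Φ.IsStrict MA MB) {l : List (Elt (mixedQuiver A B Φ.obj d))}
    {q : Letter O} (hl : IsPath q.tgt l q.src) :
    (sumB Φ l fun l' => toDual MB.toMulti l' (q.map Φ.obj)) ∘ₗ Φ.map q.src q.tgt q.deg =
      sumA Φ l fun l' => toDual MA.toMulti l' q := by
  rw [sumA_eq, sumB_eq]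
  refine (map_secSum (LinearMap.lcomp k k (Φ.map q.src q.tgt q.deg)) l _).trans ?_
  exact secSum_congr fun l' h => toDual_strict hΦ l' q (wPath_letterA Φ h hl)

theorem partA_mixedOp (l : List (Elt (mixedQuiver A B Φ.obj d))) (c : Letter O)
    (hl : IsPath c.src l c.tgt) :
    partA Φ ⟨c, mixedOp Φ MA MB l c⟩ = ⟨c, sumA Φ l fun l' => toQ MA.toMulti l' c⟩ := by
  rw [mixedOp_of_isPath Φ MA MB hl]
  rfl

theorem partB_mixedOp (l : List (Elt (mixedQuiver A B Φ.obj d))) (c : Letter O)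
    (hl : IsPath c.src l c.tgt) :
    partB Φ ⟨c, mixedOp Φ MA MB l c⟩ = ⟨dletter d (c.map Φ.obj),
      sumB Φ l fun l' => toDual MB.toMulti l' (dletter d (c.map Φ.obj))⟩ := by
  rw [mixedOp_of_isPath Φ MA MB hl]
  rfl

theorem elt_partA_mixedOp (hΦ : Φ.IsStrict MA MB) (l : List (Elt (mixedQuiver A B Φ.obj d)))
    (c : Letter O) (hl : IsPath c.src l c.tgt) :
    Φ.elt (partA Φ ⟨c, mixedOp Φ MA MB l c⟩) =
      ⟨c.map Φ.obj, sumB Φ l fun l' => toQ MB.toMulti l' (c.map Φ.obj)⟩ := by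
  rw [partA_mixedOp l c hl, ← map_sumA_toQ hΦ hl]
  rfl

/-- The B^*-component is defined through M_B; strictness is what lets its pullback to A be computed
by M_A. `elt_partA_mixedOp` is the mirror statement for Φ. -/
theorem pullB_mixedOp (hΦ : Φ.IsStrict MA MB) (l : List (Elt (mixedQuiver A B Φ.obj d)))
    (c : Letter O) (hl : IsPath c.src l c.tgt) :
    pullB Φ ⟨c, mixedOp Φ MA MB l c⟩ =
      ⟨dletter d c, sumA Φ l fun l' => toDual MA.toMulti l' (dletter d c)⟩ := by
  rw [mixedOp_of_isPath Φ MA MB hl, ← sumB_toDual_comp hΦ (q := dletter d c) hl]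
  rfl

/-- The projection of the mixed quiver to `A`. -/
def projA (Φ : QuiverHom A B) (d : ℤ) (c : Letter O) :
    (mixedQuiver A B Φ.obj d).at c →ₗ[k] A.at c :=
  LinearMap.fst k (A.at c) (Module.Dual k (B.at (dletter d (c.map Φ.obj))))

/-- The projection of the mixed quiver to `B^*[d-1]`. -/
def projB (Φ : QuiverHom A B) (d : ℤ) (c : Letter O) :
    (mixedQuiver A B Φ.obj d).at c →ₗ[k] Module.Dual k (B.at (dletter d (c.map Φ.obj))) :=
  LinearMap.snd k (A.at c) (Module.Dual k (B.at (dletter d (c.map Φ.obj))))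

theorem mixedQuiver_ext {c : Letter O} {x y : (mixedQuiver A B Φ.obj d).at c}
    (h₁ : projA Φ d c x = projA Φ d c y) (h₂ : projB Φ d c x = projB Φ d c y) : x = y :=
  Prod.ext h₁ h₂

theorem projA_mixedOp {l : List (Elt (mixedQuiver A B Φ.obj d))} {c : Letter O}
    (hl : IsPath c.src l c.tgt) :
    projA Φ d c (mixedOp Φ MA MB l c) = sumA Φ l fun l' => toQ MA.toMulti l' c := by
  rw [mixedOp_of_isPath Φ MA MB hl]
  rfl

theorem projB_mixedOp {l : List (Elt (mixedQuiver A B Φ.obj d))} {c : Letter O}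
    (hl : IsPath c.src l c.tgt) :
    projB Φ d c (mixedOp Φ MA MB l c) =
      sumB Φ l fun l' => toDual MB.toMulti l' (dletter d (c.map Φ.obj)) := by
  rw [mixedOp_of_isPath Φ MA MB hl]
  rfl

theorem isPath_slot_iff {P : GradedQuiver k O} {x y : O} {l₁ l₂ : List (Elt P)} {ℓ : Letter O}
    (a b : P.at ℓ) :
    IsPath x (l₁ ++ ⟨ℓ, a⟩ :: l₂) y ↔ IsPath x (l₁ ++ ⟨ℓ, b⟩ :: l₂) y := by
  rw [isPath_append, isPath_append]
  rfl

theorem isLinearMap_mixedOp (l₁ l₂ : List (Elt (mixedQuiver A B Φ.obj d))) (ℓ c : Letter O) :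
    IsLinearMap k fun v : (mixedQuiver A B Φ.obj d).at ℓ =>
      mixedOp Φ MA MB (l₁ ++ ⟨ℓ, v⟩ :: l₂) c := by
  -- Composability depends only on the index of the letter in the slot, not on its value, so one
  -- case distinction at 0 covers all values.
  by_cases h : IsPath c.src (l₁ ++ ⟨ℓ, (0 : (mixedQuiver A B Φ.obj d).at ℓ)⟩ :: l₂) c.tgt
  · have h' : ∀ v, IsPath c.src (l₁ ++ ⟨ℓ, v⟩ :: l₂) c.tgt := fun v => (isPath_slot_iff v 0).2 h
    have hA := isLinearMap_secSum_slot (α := partA Φ) (β := pullB Φ) (slotLinear_toQ MA c) l₁ l₂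
      (projA Φ d ℓ) (LinearMap.lcomp k k (Φ.map _ _ _) ∘ₗ projB Φ d ℓ) (fun _ => rfl)
      (ℓ₂ := dletter d ℓ) (fun _ => rfl)
    have hB := isLinearMap_secSum_slot (α := fun h => Φ.elt (partA Φ h)) (β := partB Φ)
      (slotLinear_toDual MB (dletter d (c.map Φ.obj))) l₁ l₂
      (ℓ₁ := ℓ.map Φ.obj) (Φ.map _ _ _ ∘ₗ projA Φ d ℓ) (projB Φ d ℓ) (fun _ => rfl) (fun _ => rfl)
    refine ⟨fun a b => mixedQuiver_ext ?_ ?_, fun t a => mixedQuiver_ext ?_ ?_⟩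
    · rw [map_add, projA_mixedOp (h' _), projA_mixedOp (h' _), projA_mixedOp (h' _)]
      exact hA.map_add a b
    · rw [map_add, projB_mixedOp (h' _), projB_mixedOp (h' _), projB_mixedOp (h' _)]
      exact hB.map_add a b
    · rw [map_smul, projA_mixedOp (h' _), projA_mixedOp (h' _)]
      exact hA.map_smul t a
    · rw [map_smul, projB_mixedOp (h' _), projB_mixedOp (h' _)]
      exact hB.map_smul t a
  · have h' : ∀ v, mixedOp Φ MA MB (l₁ ++ ⟨ℓ, v⟩ :: l₂) c = 0 := fun v =>
      mixedOp_of_not_isPath Φ MA MB fun hv => h ((isPath_slot_iff v 0).1 hv)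
    refine ⟨fun a b => ?_, fun t a => ?_⟩
    · simp only [h', add_zero]
    · simp only [h', smul_zero]

theorem mixedOp_ne_zero {l : List (Elt (mixedQuiver A B Φ.obj d))} {c : Letter O}
    (h : mixedOp Φ MA MB l c ≠ 0) :
    l ≠ [] ∧ IsPath c.src l c.tgt ∧ c.deg - 1 = segDeg l + 1 := by
  have hl : IsPath c.src l c.tgt := by
    by_contra hl
    exact h (mixedOp_of_not_isPath Φ MA MB hl)
  refine ⟨?_, hl, ?_⟩
  · rintro rfl
    refine h (mixedQuiver_ext ?_ ?_)
    · rw [projA_mixedOp hl, map_zero]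
      exact toQ_nil MA c
    · rw [projB_mixedOp hl, map_zero]
      exact toDual_nil MB.toMulti _
  · by_contra hd
    refine h (mixedQuiver_ext ?_ ?_)
    · rw [projA_mixedOp hl, map_zero]
      refine secSum_eq_zero fun l' hl' => ?_
      by_contra h₀
      have := toQ_degree _ h₀
      rw [(isSplitting_left Φ).wsum_eq hl'] at this
      exact hd this
    · rw [projB_mixedOp hl, map_zero]
      refine secSum_eq_zero fun l' hl' => ?_
      by_contra h₀
      have := toDual_degree _ h₀
      rw [(isSplitting_right Φ).wsum_eq hl', dletter] at this
      dsimp only at this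
      exact hd (by linarith)

theorem isCochain_mixedOp : IsCochain (mixedOp Φ MA MB) where
  map_add l₁ ℓ a b l₂ c := (isLinearMap_mixedOp l₁ l₂ ℓ c).map_add a b
  map_smul l₁ ℓ t a l₂ c := (isLinearMap_mixedOp l₁ l₂ ℓ c).map_smul t a
  support _ _ h := mixedOp_ne_zero h

/-- In each component one of the two compatibilities needed is the definition of the operation and
the other is strictness. The two components exchange these roles. -/
theorem mixedOp_stasheff (hΦ : Φ.IsStrict MA MB) (l : List (Elt (mixedQuiver A B Φ.obj d)))
    (c : Letter O) (hl : IsPath c.src l c.tgt) : gerstenhaberSq (mixedOp Φ MA MB) l c = 0 := by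
  refine mixedQuiver_ext ?_ ?_
  · rw [gerstenhaberSq, map_zero, map_sum]
    have h := sum_secSum_insert (isSplitting_left Φ) (M := MA) (m := mixedOp Φ MA MB)
      partA_mixedOp (pullB_mixedOp hΦ) (slotLinear_toQ MA c) hl
    refine Eq.trans (Finset.sum_congr rfl fun j _ => ?_) (h.trans ?_)
    · rw [map_sum]
      refine Finset.sum_congr rfl fun i hi => ?_
      rw [map_sign, projA_mixedOp (isPath_insert hl (Finset.mem_range.1 hi).le _)]
    · exact secSum_eq_zero fun l' h' =>
        wstasheff_toQ MA l' c ((isSplitting_left Φ).wPath h' hl)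
  · rw [gerstenhaberSq, map_zero, map_sum]
    have h := sum_secSum_insert (isSplitting_right Φ) (M := MB) (m := mixedOp Φ MA MB)
      (elt_partA_mixedOp hΦ) partB_mixedOp
      (slotLinear_toDual MB (dletter d (c.map Φ.obj))) hl
    refine Eq.trans (Finset.sum_congr rfl fun j _ => ?_) (h.trans ?_)
    · rw [map_sum]
      refine Finset.sum_congr rfl fun i hi => ?_
      rw [map_sign, projB_mixedOp (isPath_insert hl (Finset.mem_range.1 hi).le _)]
    · exact secSum_eq_zero fun l' h' =>
        wstasheff_toDual MB l' (dletter d (c.map Φ.obj)) ((isSplitting_right Φ).wPath h' hl)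

theorem isAInfinity_mixedOp (hΦ : Φ.IsStrict MA MB) : IsAInfinity (mixedOp Φ MA MB) :=
  ⟨isCochain_mixedOp, mixedOp_stasheff hΦ⟩

end MixedWords


/-! ### Cyclicity -/

section Cyclicity

variable {A : GradedQuiver k O} {B : GradedQuiver k O'} {d : ℤ}

theorem extend_self (x y : O') (p : ℤ) : extend (B := B) x y p p = LinearMap.id := by
  rw [extend, dif_pos rfl]

theorem extend_of_ne {x y : O'} {p q : ℤ} (h : p ≠ q) : extend (B := B) x y p q = 0 := by
  rw [extend, dif_neg h]

/-- Taking a family of functionals over all degrees avoids transporting a single one: when the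
degrees match, substitution suffices, and otherwise both sides are zero. -/
theorem sign_smul_extend_left {x y : O'} {p q m n : ℤ} (G : ∀ r, Module.Dual k (B.Hom x y r))
    (b : B.Hom x y q) (h : p ≠ q → G q b = 0) (hmn : p = q → m.negOnePow = n.negOnePow) :
    m.negOnePow • extend x y p q (G p) b = n.negOnePow • G q b := by
  by_cases e : p = q
  · subst e
    rw [extend_self, hmn rfl]
    rfl
  · rw [extend_of_ne e, h e]
    simp

theorem sign_smul_extend_right {x y : O'} {p q : ℤ} {m n : ℤˣ} (f : Module.Dual k (B.Hom x y p))
    (F : ∀ r, B.Hom x y r) (h : p ≠ q → F p = 0) (hmn : p = q → m = n) :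
    m • extend x y p q f (F q) = n • f (F p) := by
  by_cases e : p = q
  · subst e
    rw [extend_self, hmn rfl]
    rfl
  · rw [extend_of_ne e, h e]
    simp

variable {Φ : QuiverHom A B} {MA : PreCYStructure A d} {MB : PreCYStructure B d}

/-- The cyclic pairing of a word of the mixed quiver with a letter. -/
def mixedCyc (MB : PreCYStructure B d) (w : List (Elt (mixedQuiver A B Φ.obj d)))
    (a : Elt (mixedQuiver A B Φ.obj d)) : k :=
  sumB Φ w (fun l => pairing MB.toMulti l (Sum.inl (Φ.elt (partA Φ a)))) +
    sumB Φ w fun l => pairing MB.toMulti l (Sum.inr (partB Φ a))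

/-- In the term f(Φ(sm_A(…))) strictness replaces Φ ∘ sm_A by sm_B at the images of the letters.
Everything is then expressed by M_B alone, through the natural form of B. -/
theorem mixedForm_mixedOp (hΦ : Φ.IsStrict MA MB) (w : List (Elt (mixedQuiver A B Φ.obj d)))
    (a : Elt (mixedQuiver A B Φ.obj d)) (hw : IsPath a.letter.tgt w a.letter.src) :
    (mixedForm Φ d).form a.letter.tgt a.letter.src (segDeg w + 2) a.letter.deg
        (mixedOp Φ MA MB w ⟨a.letter.tgt, a.letter.src, segDeg w + 2⟩) a.val =
      mixedCyc MB w a := by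
  obtain ⟨⟨y, x, q⟩, v⟩ := a
  dsimp only at hw ⊢
  have h₁ := projA_mixedOp (Φ := Φ) (MA := MA) (MB := MB) (c := ⟨x, y, segDeg w + 2⟩) hw
  have h₂ := projB_mixedOp (Φ := Φ) (MA := MA) (MB := MB) (c := ⟨x, y, segDeg w + 2⟩) hw
  have h₃ := map_sumA_toQ hΦ (c := ⟨x, y, segDeg w + 2⟩) hw
  rw [← h₁] at h₃
  generalize hp : segDeg w + 2 = p at *
  generalize mixedOp Φ MA MB w ⟨x, y, p⟩ = m at *
  have e : (mixedForm Φ d).form x y p q m v =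
      ((p - 1) + 1).negOnePow • extend (B := B) (Φ.obj y) (Φ.obj x) (-(p + (d - 1))) q
          (projB Φ d _ m) (Φ.map y x q (projA Φ d ⟨y, x, q⟩ v)) +
        (-((p - 1) * (q - 1)).negOnePow * ((q - 1) + 1).negOnePow) •
          extend (B := B) (Φ.obj x) (Φ.obj y) (-(q + (d - 1))) p (projB Φ d ⟨y, x, q⟩ v)
            (Φ.map x y p (projA Φ d _ m)) := rfl
  rw [e, h₂, mixedCyc]
  congr 1
  · refine (sign_smul_extend_left (x := Φ.obj y) (y := Φ.obj x) (n := -q - d + 1)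
      (fun r => sumB Φ w fun l' => toDual MB.toMulti l' ⟨Φ.obj y, Φ.obj x, r⟩) _ ?_ ?_).trans ?_
    · intro hne
      refine LinearMap.congr_fun (g := 0) (secSum_eq_zero fun l' hl' => ?_) _
      by_contra h₀
      have := toDual_degree _ h₀
      rw [(isSplitting_right Φ).wsum_eq hl'] at this
      dsimp only at this
      exact hne (by linarith)
    · rintro rfl
      congr 1
      ring
    · refine Eq.trans ?_ (secSum_sign_smul w _ _).symm
      exact congrArg _ (map_secSum (LinearMap.applyₗ _) w _)
  · refine (congrArg (fun z => _ • extend (B := B) (Φ.obj x) (Φ.obj y) (-(q + (d - 1))) p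
      (projB Φ d ⟨y, x, q⟩ v) z) h₃).trans ?_
    refine (sign_smul_extend_right (x := Φ.obj x) (y := Φ.obj y)
      (n := ((-(q + (d - 1)) - 1) * (-(-(q + (d - 1))) - d) +
        (-(-(q + (d - 1))) - d)).negOnePow) (projB Φ d ⟨y, x, q⟩ v)
      (fun r => sumB Φ w fun l' => toQ MB.toMulti l' ⟨Φ.obj x, Φ.obj y, r⟩) ?_ ?_).trans ?_
    · intro hne
      refine secSum_eq_zero fun l' hl' => ?_
      by_contra h₀
      have := toQ_degree _ h₀
      rw [(isSplitting_right Φ).wsum_eq hl'] at this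
      dsimp only at this
      exact hne (by linarith)
    -- The sign of the mixed form involves p and q, that of `pairing` only the degree of the
    -- functional; they agree because the form is nonzero only for p = -(q + d - 1).
    · intro hpq
      replace hpq : -(q + (d - 1)) = p := hpq
      have : -((p - 1) * (q - 1)).negOnePow = ((p - 1) * (q - 1) + 1).negOnePow := by
        rw [Int.negOnePow_succ]
      rw [this, ← Int.negOnePow_add]
      apply negOnePow_congr
      have e₁ := congrArg (Int.cast : ℤ → ZMod 2) hpq
      push_cast at e₁ ⊢
      grind
    · refine Eq.trans ?_ (secSum_sign_smul w _ _).symm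
      exact congrArg _ (map_secSum (projB Φ d ⟨y, x, q⟩ v) w _)

/-- Expanding a and b into their two components gives four sums, each of which is `pairing_rotate`
for M_B; splitting preserves degrees, so all four have the same sign. -/
theorem mixedCyc_rotate (l : List (Elt (mixedQuiver A B Φ.obj d)))
    (b a : Elt (mixedQuiver A B Φ.obj d)) :
    mixedCyc MB (l ++ [b]) a =
      (a.sdeg * segDeg (l ++ [b])).negOnePow • mixedCyc MB (a :: l) b := by
  have hdeg : ∀ h : Elt (mixedQuiver A B Φ.obj d),
      wdeg d (Sum.inr (partB Φ h) : Elt B ⊕ DualElt B) = h.sdeg := by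
    intro h
    simp only [wdeg, DualElt.tdeg, partB, Elt.sdeg]
    ring
  have hsum : segDeg (l ++ [b]) = segDeg l + b.sdeg := by
    simp [segDeg]
  have key : ∀ x y : Elt B ⊕ DualElt B, wdeg d x = a.sdeg → wdeg d y = b.sdeg →
      (secSum (Sum.inl ∘ fun h => Φ.elt (partA Φ h)) (Sum.inr ∘ partB Φ) l fun p =>
          pairing MB.toMulti (p ++ [y]) x) =
        (a.sdeg * segDeg (l ++ [b])).negOnePow •
          secSum (Sum.inl ∘ fun h => Φ.elt (partA Φ h)) (Sum.inr ∘ partB Φ) l fun p =>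
            pairing MB.toMulti (x :: p) y := by
    intro x y hx hy
    rw [← secSum_sign_smul]
    refine secSum_congr fun l' hl' => ?_
    rw [pairing_rotate, (isSplitting_right Φ).wsum_eq hl', hx, hy, hsum]
  simp only [mixedCyc, secSum_append, secSum, secSum_add, smul_add, Function.comp]
  rw [key _ _ rfl rfl, key _ _ rfl (hdeg b), key _ _ (hdeg a) rfl, key _ _ (hdeg a) (hdeg b)]
  abel

theorem isAlmostCyclic_mixedOp (hΦ : Φ.IsStrict MA MB) :
    IsAlmostCyclic (mixedOp Φ MA MB) (mixedForm Φ d) := by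
  intro l b a hl
  have hb : IsPath b.letter.tgt (a :: l) b.letter.src := by
    rw [isPath_append] at hl
    obtain ⟨h₁, h₂, h₃⟩ := hl
    have h₄ : b.letter.tgt = a.letter.src := h₃
    rw [h₄, h₂]
    exact ⟨rfl, h₁⟩
  rw [mixedForm_mixedOp hΦ _ a hl, mixedForm_mixedOp hΦ _ b hb, mixedCyc_rotate]

end Cyclicity

end PreCY

end

theorem mainTheorem6 {k : Type u} [Field k] [CharZero k] {OA : Type v} {OB : Type w}
    (A : PreCY.GradedQuiver k OA) (B : PreCY.GradedQuiver k OB) (d : ℤ)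
    (MA : PreCY.PreCYStructure A d) (MB : PreCY.PreCYStructure B d)
    (Φ : PreCY.QuiverHom A B) (hΦ : Φ.IsStrict MA MB) :
    PreCY.IsAInfinity (PreCY.mixedOp Φ MA MB) ∧
      PreCY.IsAlmostCyclic (PreCY.mixedOp Φ MA MB) (PreCY.mixedForm Φ d) := by
  exact ⟨PreCY.isAInfinity_mixedOp hΦ, PreCY.isAlmostCyclic_mixedOp hΦ⟩
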